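/- Let $d, s\in\mathbb N$ and let $V, W:\mathbb R^d\to\mathbb R$ be twice differentiable functions with locally bounded Hessians such that, for some real numbers $\beta,\gamma,\gamma'$ (of any sign), \[ D^2V(x)\ge \beta I,\qquad \gamma I\le D^2W(x)\le\gamma' I\qquad\text{for all } x\in\mathbb R^d. \] Assume moreover that, for every multi-index $\alpha\in\mathbb N^d$ with $|\alpha|\le s+1$, the partial derivatives $\partial^\alpha V$ and $\partial^\alpha W$ are continuous and grow at most polynomially at infinity. Let $a,E>0$. Then there exists a continuous function $f:(0,+\infty)\to(0,+\infty)$, depending only on $d,s,V,W,a,E$, such that the following holds. For every probability density $\rho_0$ on $\mathbb R^d$ with \[ \int_{\mathbb R^d}e^{a|x|^2}\rho_0(x)\,dx\le E \] and every classical solution $\rho$, starting from $\rho_0$, of \[ \partial_t\rho=\Delta\rho+\nabla\cdot\bigl(\rho\,\nabla(V+W*\rho)\bigr),\qquad t>0,\ x\in\mathbb R^d, \] one has, for every $t>0$, $\rho(t,\cdot)\in H^s(\mathbb R^d)$ and \[ \|\rho(t,\cdot)\|_{H^s(\mathbb R^d)}\le f(t). \] Here $H^s(\mathbb R^d)$ is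 the space of $u\in L^2$ whose weak derivatives $\partial^\alpha u$, $|\alpha|\le s$, are all in $L^2$, with $\|u\|_{H^s}^2=\sum_{|\alpha|\le s}\int|\partial^\alpha u|^2\,dx$. A classical solution starting from $\rho_0$ is a function $\rho$ on $(0,\infty)\times\mathbb R^d$, of class $C^1$ in $t$ and $C^2$ in $x$ ($\rho$ and these derivatives being jointly continuous), which satisfies the equation pointwise, such that $\rho(t,\cdot)$ is a probability density for each $t>0$, $\sup_{0<t\le T}\int|x|^2\rho(t,x)\,dx<\infty$ for each $T>0$, and $\rho(t,x)\,dx\to\rho_0(x)\,dx$ narrowly (tested against bounded continuous functions) as $t\to0^+$. In particular $f$ does not depend on $\|\rho_0\|_{H^s}$, which may be infinite. -/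

import Mathlib

open MeasureTheory Set Filter Topology
open scoped ContDiff Convolution BoundedContinuousFunction

noncomputable section

namespace McKeanVlasov

/-- The Euclidean space `ℝ^d`. -/
abbrev Space (d : ℕ) : Type := EuclideanSpace ℝ (Fin d)

variable {d : ℕ}

/-! ### Multi-index derivatives -/

/-- The partial derivative `∂_i u`. -/
def partialDeriv (i : Fin d) (u : Space d → ℝ) : Space d → ℝ :=
  fun x => fderiv ℝ u x (EuclideanSpace.single i 1)

/-- The length `|α|` of a multi-index. -/
def multiLength (α : Fin d → ℕ) : ℕ := ∑ i, α i

/-- The classical derivative `∂^α u = ∂_0^{α_0} ⋯ ∂_{d-1}^{α_{d-1}} u`. -/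
def multiDeriv (α : Fin d → ℕ) (u : Space d → ℝ) : Space d → ℝ :=
  (List.finRange d).foldr (fun i v => (partialDeriv i)^[α i] v) u

/-- The finite set of all multi-indices `α ∈ ℕ^d` with `|α| ≤ s`. -/
def multiIndices (d s : ℕ) : Finset (Fin d → ℕ) :=
  (Fintype.piFinset fun _ : Fin d => Finset.range (s + 1)).filter fun α => multiLength α ≤ s

theorem mem_multiIndices {s : ℕ} {α : Fin d → ℕ} :
    α ∈ multiIndices d s ↔ multiLength α ≤ s := by
  simp only [multiIndices, Finset.mem_filter, Fintype.mem_piFinset, Finset.mem_range,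
    and_iff_right_iff_imp]
  intro h i
  have : α i ≤ multiLength α := Finset.single_le_sum (fun _ _ => Nat.zero_le _) (Finset.mem_univ i)
  omega

/-! ### The Sobolev spaces `H^s(ℝ^d)` -/

/-- `v` is the weak (distributional) derivative `∂^α u`. -/
def HasWeakDeriv (α : Fin d → ℕ) (u v : Space d → ℝ) : Prop :=
  ∀ φ : Space d → ℝ, ContDiff ℝ ∞ φ → HasCompactSupport φ →
    ∫ x, u x * multiDeriv α φ x = (-1) ^ multiLength α * ∫ x, v x * φ x

/-- `u ∈ H^s(ℝ^d)`: `u ∈ L²` and every weak derivative `∂^α u` with `|α| ≤ s` is in `L²`. -/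
def MemSobolev (s : ℕ) (u : Space d → ℝ) : Prop :=
  MemLp u 2 ∧ ∀ α : Fin d → ℕ, multiLength α ≤ s → ∃ v, MemLp v 2 ∧ HasWeakDeriv α u v

open Classical in
/-- An `L²` representative of the weak derivative `∂^α u`; it is unique up to null sets when it
exists, and by convention it is `0` when there is none. -/
def weakDeriv (α : Fin d → ℕ) (u : Space d → ℝ) : Space d → ℝ :=
  if h : ∃ v, MemLp v 2 ∧ HasWeakDeriv α u v then h.choose else 0

/-- The norm `‖u‖_{H^s} = (∑_{|α| ≤ s} ∫ |∂^α u|²)^{1/2}`, meaningful for `u ∈ H^s`. -/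
def sobolevNorm (s : ℕ) (u : Space d → ℝ) : ℝ :=
  Real.sqrt (∑ α ∈ multiIndices d s, ∫ x, |weakDeriv α u x| ^ 2)

/-! ### The potentials -/

/-- All `∂^α U` with `|α| ≤ m` are continuous and grow at most polynomially at infinity. -/
def HasPolyGrowthDerivs (m : ℕ) (U : Space d → ℝ) : Prop :=
  ContDiff ℝ m U ∧ ∀ α : Fin d → ℕ, multiLength α ≤ m →
    ∃ C : ℝ, ∃ k : ℕ, ∀ x, |multiDeriv α U x| ≤ C * (1 + ‖x‖) ^ k

/-- The Hessian `D²U(x)`, as a bilinear form. -/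
def hessian (U : Space d → ℝ) (x : Space d) : Space d →L[ℝ] Space d →L[ℝ] ℝ :=
  fderiv ℝ (fderiv ℝ U) x

/-- `U` is twice differentiable and its Hessian is locally bounded. -/
def HasLocallyBoundedHessian (U : Space d → ℝ) : Prop :=
  Differentiable ℝ U ∧ Differentiable ℝ (fderiv ℝ U) ∧
    ∀ K : Set (Space d), IsCompact K → ∃ C : ℝ, ∀ x ∈ K, ‖hessian U x‖ ≤ C

/-- The pair of potentials `(V, W)` satisfies `D²V ≥ β I` and `γ I ≤ D²W ≤ γ' I` on `ℝ^d`, for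
some real numbers `β`, `γ`, `γ'`, with locally bounded Hessians. -/
def HessianBounds (V W : Space d → ℝ) : Prop :=
  HasLocallyBoundedHessian V ∧ HasLocallyBoundedHessian W ∧
    (∃ β : ℝ, ∀ x h, β * ‖h‖ ^ 2 ≤ hessian V x h h) ∧
    ∃ γ γ' : ℝ, ∀ x h, γ * ‖h‖ ^ 2 ≤ hessian W x h h ∧ hessian W x h h ≤ γ' * ‖h‖ ^ 2

/-! ### The equation and its classical solutions -/

/-- `r` is a probability density on `ℝ^d`. -/
def IsProbDensity (r : Space d → ℝ) : Prop :=
  (∀ᵐ x, 0 ≤ r x) ∧ Integrable r ∧ ∫ x, r x = 1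

/-- The convolution `(W * r)(x) = ∫ W(x - y) r(y) dy`. -/
def conv (W r : Space d → ℝ) : Space d → ℝ :=
  r ⋆[ContinuousLinearMap.mul ℝ ℝ, volume] W

/-- The divergence `∇ · F = ∑ i, ∂_i F_i` of a vector field. -/
def divergence (F : Space d → Space d) : Space d → ℝ :=
  fun x => ∑ i, partialDeriv i (fun y => F y i) x

/-- The field `r ∇(V + W * r)`. -/
def flux (V W r : Space d → ℝ) : Space d → Space d :=
  fun x => r x • gradient (fun y => V y + conv W r y) x

/-- `ρ` is a classical solution, starting from the probability density `ρ₀`, of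
`∂_t ρ = Δ ρ + ∇ · (ρ ∇(V + W * ρ))` on `(0, ∞) × ℝ^d`. -/
structure IsClassicalSolution (V W ρ₀ : Space d → ℝ) (ρ : ℝ → Space d → ℝ) : Prop where
  /-- `ρ(t, ·)` is a probability density for `t > 0`. -/
  isProbDensity : ∀ t, 0 < t → IsProbDensity (ρ t)
  /-- The second moment is finite, locally uniformly in `t ∈ [0, ∞)`. -/
  secondMoment : ∀ T, 0 < T → ∃ M : ℝ, ∀ t ∈ Ioc 0 T,
    Integrable (fun x => ‖x‖ ^ 2 * ρ t x) ∧ ∫ x, ‖x‖ ^ 2 * ρ t x ≤ M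
  /-- `ρ` is of class `C^1` in `t` and `C^2` in `x`, jointly continuous with these derivatives. -/
  continuousOn : ContinuousOn (fun p : ℝ × Space d => ρ p.1 p.2) (Ioi 0 ×ˢ univ)
  differentiableAt_time : ∀ t, 0 < t → ∀ x, DifferentiableAt ℝ (fun τ => ρ τ x) t
  continuousOn_time : ContinuousOn (fun p : ℝ × Space d => deriv (fun τ => ρ τ p.2) p.1)
    (Ioi 0 ×ˢ univ)
  contDiff_space : ∀ t, 0 < t → ContDiff ℝ 2 (ρ t)
  continuousOn_fderiv : ContinuousOn (fun p : ℝ × Space d => fderiv ℝ (ρ p.1) p.2)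
    (Ioi 0 ×ˢ univ)
  continuousOn_hessian : ContinuousOn (fun p : ℝ × Space d => hessian (ρ p.1) p.2)
    (Ioi 0 ×ˢ univ)
  /-- The equation holds pointwise. -/
  equation : ∀ t, 0 < t → ∀ x,
    deriv (fun τ => ρ τ x) t = Laplacian.laplacian (ρ t) x + divergence (flux V W (ρ t)) x
  /-- `ρ(t, x) dx` converges narrowly to `ρ₀(x) dx` as `t → 0⁺`. -/
  initial : ∀ φ : Space d →ᵇ ℝ,
    Tendsto (fun t => ∫ x, φ x * ρ t x) (𝓝[>] 0) (𝓝 (∫ x, φ x * ρ₀ x))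

end McKeanVlasov

end

open MeasureTheory Set Filter Topology
open scoped ContDiff Convolution BoundedContinuousFunction NNReal ENNReal

noncomputable section

namespace McKeanVlasov

variable {d : ℕ}

/-! The diffusion regularises instantly, and every estimate can be made to depend on the initial
datum only through its exponential moment. There are three layers of a priori bounds, all uniform
over the class `Admissible`, followed by a passage from bounds to derivatives.

Moments. The lower bound on `D²V` and the two-sided bound on `D²W` make the drift `b = ∇(V + W * ρ)`
satisfy `x · b ≥ -C (1 + |x|² + ∫ (1 + |y|²) ρ)`. Testing the equation against truncated powers of
`1 + |x|²` then propagates every polynomial moment (`exists_second_moment_le`, `exists_moment_le`).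
The derivatives of `W * ρ` fall on `W`, so `b` has derivatives up to order `s` of polynomial growth,
controlled by moments alone (`exists_drift_le`).

From moments to weighted `L²`. In the energy identity for `∫ ρ² η²` the dissipation dominates any
multiple of a weighted `L²` norm, up to a constant built from moments (`exists_nash`). The resulting
differential inequality bounds the energy at positive times whatever its initial size
(`le_of_forall_damping`, `exists_integral_sq_le`).

From order `k` to order `k + 1`. The solution is only `C²` in space, so derivatives are taken on
mollifications `∂^L φ * ρ`, which solve a heat equation with source `∇ · (∂^L φ * (ρ b))`. The
source field involves derivatives of `ρ` and of `b` of order at most `k` only. Hence a space-time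
bound at order `k`, for all polynomial weights, yields both a bound at each time at order `k` and a
space-time bound at order `k + 1` (`EnergyBound.exists_bounds`). Induction reaches `k = s`, and
there the bound at each time is the one wanted. Polynomial weights are lost at each stage, which is
harmless because all of them are carried along.

Finally, bounds uniform in the mollifier give weak derivatives by weak compactness in `L²`
(`exists_hasWeakDeriv`), and bounds that are constant on compact time intervals are glued to a
continuous function (`exists_continuousOn_bound`). -/

/-! ### Calculus of partial derivatives -/

/-- The iterated partial derivative along a list of coordinate directions. -/
def lderiv (L : List (Fin d)) (u : Space d → ℝ) : Space d → ℝ := L.foldr partialDeriv u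

@[simp] theorem lderiv_nil (u : Space d → ℝ) : lderiv [] u = u := rfl

@[simp] theorem lderiv_cons (i : Fin d) (L : List (Fin d)) (u : Space d → ℝ) :
    lderiv (i :: L) u = partialDeriv i (lderiv L u) := rfl

theorem lderiv_append (L L' : List (Fin d)) (u : Space d → ℝ) :
    lderiv (L ++ L') u = lderiv L (lderiv L' u) := by
  simp [lderiv, List.foldr_append]

theorem contDiff_partialDeriv {n m : ℕ∞} {u : Space d → ℝ} (hu : ContDiff ℝ m u)
    (h : n + 1 ≤ m) (i : Fin d) : ContDiff ℝ n (partialDeriv i u) := by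
  have : ContDiff ℝ n (fderiv ℝ u) := hu.fderiv_right (by exact_mod_cast h)
  exact this.clm_apply contDiff_const

theorem contDiff_lderiv {n m : ℕ∞} (L : List (Fin d)) {u : Space d → ℝ} (hu : ContDiff ℝ m u)
    (h : n + L.length ≤ m) : ContDiff ℝ n (lderiv L u) := by
  induction L generalizing n with
  | nil => exact hu.of_le (by simpa using h)
  | cons i L ih =>
    refine contDiff_partialDeriv (m := n + 1) (ih ?_) le_rfl i
    refine le_trans (le_of_eq ?_) h
    rw [List.length_cons]
    push_cast
    ring

theorem contDiff_lderiv_infty (L : List (Fin d)) {u : Space d → ℝ} (hu : ContDiff ℝ ∞ u) :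
    ContDiff ℝ ∞ (lderiv L u) :=
  contDiff_lderiv (n := ⊤) (m := ⊤) L hu le_top

theorem hasCompactSupport_partialDeriv {u : Space d → ℝ} (hu : HasCompactSupport u) (i : Fin d) :
    HasCompactSupport (partialDeriv i u) :=
  (hu.fderiv (𝕜 := ℝ)).comp_left (g := fun T : Space d →L[ℝ] ℝ => T (EuclideanSpace.single i 1)) rfl

theorem tsupport_partialDeriv_subset (u : Space d → ℝ) (i : Fin d) :
    tsupport (partialDeriv i u) ⊆ tsupport u := by
  refine (closure_mono ?_).trans (tsupport_fderiv_subset ℝ (f := u))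
  intro x hx h
  exact hx (by simp [partialDeriv, h])

theorem tsupport_lderiv_subset (L : List (Fin d)) (u : Space d → ℝ) :
    tsupport (lderiv L u) ⊆ tsupport u := by
  induction L with
  | nil => exact subset_rfl
  | cons i L ih => exact (tsupport_partialDeriv_subset _ i).trans ih

theorem hasCompactSupport_lderiv (L : List (Fin d)) {u : Space d → ℝ} (hu : HasCompactSupport u) :
    HasCompactSupport (lderiv L u) :=
  hu.of_isClosed_subset (isClosed_tsupport _) (tsupport_lderiv_subset L u)

theorem hessian_apply {u : Space d → ℝ} (hu : Differentiable ℝ (fderiv ℝ u)) (x : Space d)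
    (i j : Fin d) :
    partialDeriv i (partialDeriv j u) x =
      hessian u x (EuclideanSpace.single i 1) (EuclideanSpace.single j 1) := by
  have : HasFDerivAt (partialDeriv j u)
      ((fderiv ℝ (fderiv ℝ u) x).flip (EuclideanSpace.single j 1)) x := by
    have := ((hu x).hasFDerivAt).clm_apply (hasFDerivAt_const (EuclideanSpace.single j (1:ℝ)) x)
    simp only [ContinuousLinearMap.comp_zero, zero_add] at this
    exact this
  change fderiv ℝ (partialDeriv j u) x _ = _
  rw [this.fderiv]
  rfl

theorem partialDeriv_comm {u : Space d → ℝ} (hu : ContDiff ℝ 2 u) (i j : Fin d) :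
    partialDeriv i (partialDeriv j u) = partialDeriv j (partialDeriv i u) := by
  have h1 : Differentiable ℝ (fderiv ℝ u) :=
    (hu.fderiv_right (m := 1) (by norm_num)).differentiable (by norm_num)
  have h0 : Differentiable ℝ u := hu.differentiable (by norm_num)
  ext x
  rw [hessian_apply h1, hessian_apply h1]
  exact second_derivative_symmetric (fun y => (h0 y).hasFDerivAt) (h1 x).hasFDerivAt _ _

theorem lderiv_perm {L L' : List (Fin d)} (h : L.Perm L') {u : Space d → ℝ}
    (hu : ContDiff ℝ L.length u) : lderiv L u = lderiv L' u := by
  induction h with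
  | nil => rfl
  | cons i h ih =>
    rw [lderiv_cons, lderiv_cons, ih (hu.of_le (by simp))]
  | swap i j L =>
    simp only [lderiv_cons]
    refine partialDeriv_comm (contDiff_lderiv (n := 2) (m := (L.length + 2 : ℕ)) L
      (by exact_mod_cast hu) ?_) _ _
    push_cast
    rw [add_comm]
  | trans h₁ h₂ ih₁ ih₂ => rw [ih₁ hu, ih₂ (by rwa [← h₁.length_eq])]

/-- The list of directions of a multi-index. -/
def multiList (α : Fin d → ℕ) : List (Fin d) :=
  (List.finRange d).flatMap fun i => List.replicate (α i) i

theorem multiDeriv_eq_lderiv (α : Fin d → ℕ) (u : Space d → ℝ) :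
    multiDeriv α u = lderiv (multiList α) u := by
  unfold multiDeriv multiList
  induction List.finRange d with
  | nil => rfl
  | cons i l ih =>
    rw [List.foldr_cons, ih, List.flatMap_cons, lderiv_append]
    generalize lderiv _ u = v
    induction α i with
    | zero => rfl
    | succ n ihn => rw [Function.iterate_succ_apply', ihn, List.replicate_succ, lderiv_cons]

theorem length_multiList (α : Fin d → ℕ) : (multiList α).length = multiLength α := by
  simp [multiList, multiLength, List.length_flatMap, Fin.sum_univ_def]

theorem count_multiList (α : Fin d → ℕ) (i : Fin d) : (multiList α).count i = α i := by
  have h := List.nodup_finRange d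
  have hi := List.mem_finRange i
  unfold multiList
  rw [List.count_flatMap]
  have : (List.count i ∘ fun j => List.replicate (α j) j) = fun j => if j = i then α i else 0 := by
    ext j
    simp only [Function.comp, List.count_replicate]
    by_cases hj : j = i <;> simp [hj]
  rw [this, ← Fin.sum_univ_def]
  simp

/-- Partial derivatives commute, so only the multiplicity of each direction matters. This links the
inductions, which run over lists, to the growth assumptions, which speak of multi-indices. -/
theorem exists_multiDeriv_eq_lderiv (L : List (Fin d)) {u : Space d → ℝ}
    (hu : ContDiff ℝ L.length u) :
    ∃ α : Fin d → ℕ, multiLength α = L.length ∧ lderiv L u = multiDeriv α u := by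
  have hp : L.Perm (multiList fun i => L.count i) := by
    rw [List.perm_iff_count]
    intro i
    rw [count_multiList]
  refine ⟨fun i => L.count i, ?_, ?_⟩
  · rw [← length_multiList, hp.length_eq]
  · rw [multiDeriv_eq_lderiv, ← lderiv_perm hp hu]

theorem partialDeriv_add {u v : Space d → ℝ} (hu : Differentiable ℝ u) (hv : Differentiable ℝ v)
    (i : Fin d) : partialDeriv i (fun x => u x + v x) =
      fun x => partialDeriv i u x + partialDeriv i v x := by
  ext x
  simp [partialDeriv, fderiv_fun_add (hu x) (hv x)]

theorem partialDeriv_mul {u v : Space d → ℝ} (hu : Differentiable ℝ u) (hv : Differentiable ℝ v)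
    (i : Fin d) : partialDeriv i (fun x => u x * v x) =
      fun x => partialDeriv i u x * v x + u x * partialDeriv i v x := by
  ext x
  simp only [partialDeriv, fderiv_fun_mul (hu x) (hv x)]
  simp
  ring

theorem abs_partialDeriv_le (u : Space d → ℝ) (i : Fin d) (x : Space d) :
    |partialDeriv i u x| ≤ ‖fderiv ℝ u x‖ := by
  have := (fderiv ℝ u x).le_opNorm (EuclideanSpace.single i 1)
  simpa [partialDeriv] using this

theorem clm_apply_eq_sum (T : Space d →L[ℝ] ℝ) (x : Space d) :
    T x = ∑ i, x i * T (EuclideanSpace.single i 1) := by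
  have h : x = ∑ i, x i • EuclideanSpace.single i (1:ℝ) := by
    have := (EuclideanSpace.basisFun (Fin d) ℝ).sum_repr x
    simpa using this.symm
  conv_lhs => rw [h]
  simp

/-- The squared length of the gradient. -/
def gradSq (u : Space d → ℝ) (x : Space d) : ℝ := ∑ i, partialDeriv i u x ^ 2

theorem gradSq_nonneg (u : Space d → ℝ) (x : Space d) : 0 ≤ gradSq u x :=
  Finset.sum_nonneg fun _ _ => sq_nonneg _

theorem norm_fderiv_sq_le (u : Space d → ℝ) (x : Space d) : ‖fderiv ℝ u x‖ ^ 2 ≤ gradSq u x := by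
  have h : ‖fderiv ℝ u x‖ ≤ Real.sqrt (gradSq u x) := by
    refine ContinuousLinearMap.opNorm_le_bound _ (Real.sqrt_nonneg _) fun y => ?_
    rw [clm_apply_eq_sum, Real.norm_eq_abs, EuclideanSpace.norm_eq, ← Real.sqrt_mul (gradSq_nonneg u x)]
    refine Real.abs_le_sqrt ?_
    refine (Finset.sum_mul_sq_le_sq_mul_sq _ _ _).trans (le_of_eq ?_)
    simp [gradSq, partialDeriv, mul_comm]
  calc _ ≤ Real.sqrt (gradSq u x) ^ 2 := by gcongr
    _ = _ := Real.sq_sqrt (gradSq_nonneg u x)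

theorem laplacian_eq_sum {u : Space d → ℝ} (hu : ContDiff ℝ 2 u) (x : Space d) :
    Laplacian.laplacian u x = ∑ i, partialDeriv i (partialDeriv i u) x := by
  rw [InnerProductSpace.laplacian_eq_iteratedFDeriv_orthonormalBasis u
    (EuclideanSpace.basisFun (Fin d) ℝ)]
  have h1 : Differentiable ℝ (fderiv ℝ u) :=
    (hu.fderiv_right (m := 1) (by norm_num)).differentiable (by norm_num)
  refine Finset.sum_congr rfl fun i _ => ?_
  rw [iteratedFDeriv_two_apply, hessian_apply h1]
  simp [hessian]

/-! ### Integration by parts -/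

/-- `f` is differentiable with locally bounded derivative. -/
def LocBoundedDeriv (f : Space d → ℝ) : Prop :=
  Differentiable ℝ f ∧ ∀ K : Set (Space d), IsCompact K → ∃ C : ℝ, ∀ x ∈ K, ‖fderiv ℝ f x‖ ≤ C

theorem LocBoundedDeriv.of_contDiff {f : Space d → ℝ} (hf : ContDiff ℝ 1 f) : LocBoundedDeriv f := by
  refine ⟨hf.differentiable (by norm_num), fun K hK => ?_⟩
  exact hK.exists_bound_of_continuousOn (hf.continuous_fderiv (by norm_num)).continuousOn

theorem LocBoundedDeriv.add {f g : Space d → ℝ} (hf : LocBoundedDeriv f) (hg : LocBoundedDeriv g) :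
    LocBoundedDeriv fun x => f x + g x := by
  refine ⟨hf.1.add hg.1, fun K hK => ?_⟩
  obtain ⟨C, hC⟩ := hf.2 K hK
  obtain ⟨C', hC'⟩ := hg.2 K hK
  refine ⟨C + C', fun x hx => ?_⟩
  rw [fderiv_fun_add (hf.1 x) (hg.1 x)]
  exact (norm_add_le _ _).trans (add_le_add (hC x hx) (hC' x hx))

theorem LocBoundedDeriv.mul {f g : Space d → ℝ} (hf : LocBoundedDeriv f) (hg : LocBoundedDeriv g) :
    LocBoundedDeriv fun x => f x * g x := by
  refine ⟨hf.1.mul hg.1, fun K hK => ?_⟩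
  obtain ⟨C, hC⟩ := hf.2 K hK
  obtain ⟨C', hC'⟩ := hg.2 K hK
  obtain ⟨A, hA⟩ := hK.exists_bound_of_continuousOn hf.1.continuous.continuousOn
  obtain ⟨A', hA'⟩ := hK.exists_bound_of_continuousOn hg.1.continuous.continuousOn
  refine ⟨A * C' + A' * C, fun x hx => ?_⟩
  rw [fderiv_fun_mul (hf.1 x) (hg.1 x)]
  refine (norm_add_le _ _).trans ?_
  rw [norm_smul, norm_smul]
  have := hA x hx; have := hA' x hx; have := hC x hx; have := hC' x hx
  have := (norm_nonneg _).trans (hA x hx)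
  have := (norm_nonneg _).trans (hA' x hx)
  gcongr

theorem LocBoundedDeriv.integrable_partialDeriv_mul {f g : Space d → ℝ} (hf : LocBoundedDeriv f)
    (hg : Continuous g) (hgc : HasCompactSupport g) (i : Fin d) :
    Integrable fun x => partialDeriv i f x * g x := by
  obtain ⟨C, hC⟩ := hf.2 _ hgc
  refine ((hg.integrable_of_hasCompactSupport hgc).norm.const_mul C).mono' ?_ ?_
  · exact ((measurable_fderiv_apply_const ℝ f _).mul hg.measurable).aestronglyMeasurable
  · refine Eventually.of_forall fun x => ?_
    by_cases hx : x ∈ tsupport g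
    · rw [norm_mul]
      exact mul_le_mul_of_nonneg_right ((abs_partialDeriv_le f i x).trans (hC x hx)) (norm_nonneg _)
    · simp [image_eq_zero_of_notMem_tsupport hx]

/-- The factor `f` need not be `C¹`: it will be the density times the drift, whose derivative
involves Hessians that are only locally bounded. Integrability on the support of `g` is all that
integration by parts requires. -/
theorem integral_partialDeriv_mul {f g : Space d → ℝ} (hf : LocBoundedDeriv f)
    (hg : ContDiff ℝ 1 g) (hgc : HasCompactSupport g) (i : Fin d) :
    ∫ x, partialDeriv i f x * g x = -∫ x, f x * partialDeriv i g x := by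
  have hgi : Continuous (partialDeriv i g) :=
    (contDiff_partialDeriv (n := 0) (m := 1) hg (by simp) i).continuous
  have h := integral_mul_fderiv_eq_neg_fderiv_mul_of_integrable (μ := (volume : Measure (Space d)))
    (f := f) (g := g)
    (v := EuclideanSpace.single i 1) (hf.integrable_partialDeriv_mul hg.continuous hgc i)
    ((hf.1.continuous.mul hgi).integrable_of_hasCompactSupport
      ((hasCompactSupport_partialDeriv hgc i).mul_left))
    ((hf.1.continuous.mul hg.continuous).integrable_of_hasCompactSupport hgc.mul_left)
    (fun x _ => hf.1 x) (fun x _ => hg.differentiable (by norm_num) x)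
  change _ = -∫ x, f x * (fderiv ℝ g x) (EuclideanSpace.single i 1)
  rw [h, neg_neg]
  rfl

theorem integral_lderiv_mul {L : List (Fin d)} {f g : Space d → ℝ} (hf : ContDiff ℝ L.length f)
    (hg : ContDiff ℝ ∞ g) (hgc : HasCompactSupport g) :
    ∫ x, lderiv L f x * g x = (-1) ^ L.length * ∫ x, f x * lderiv L.reverse g x := by
  induction L generalizing g with
  | nil => simp
  | cons i L ih =>
    have h1 : ContDiff ℝ 1 (lderiv L f) :=
      contDiff_lderiv (n := 1) (m := (L.length + 1 : ℕ)) L (by simpa using hf)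
        (by push_cast; rw [add_comm])
    rw [lderiv_cons, integral_partialDeriv_mul (.of_contDiff h1) (hg.of_le (by exact_mod_cast le_top)) hgc,
      ih (g := partialDeriv i g) (hf.of_le (by simp)) (contDiff_lderiv_infty [i] hg)
        (hasCompactSupport_partialDeriv hgc i), List.reverse_cons, lderiv_append, List.length_cons]
    simp only [lderiv_cons, lderiv_nil]
    ring

/-! ### Polynomial weights -/

/-- The weight `1 + |x|²`. -/
def wt (x : Space d) : ℝ := 1 + ‖x‖ ^ 2

theorem one_le_wt (x : Space d) : 1 ≤ wt x := by
  have := sq_nonneg ‖x‖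
  unfold wt; linarith

theorem wt_pos (x : Space d) : 0 < wt x := one_pos.trans_le (one_le_wt x)

theorem contDiff_wt {n : WithTop ℕ∞} : ContDiff ℝ n (wt (d := d)) :=
  contDiff_const.add (contDiff_id.norm_sq ℝ)

theorem continuous_wt : Continuous (wt (d := d)) := contDiff_wt (n := 0).continuous

/-- A Peetre-type inequality: it separates the variables in a convolution, so that growth in `x` is
paid for by a moment in `y`. -/
theorem wt_sub_le (x y : Space d) : wt (x - y) ≤ 2 * wt x * wt y := by
  have h := norm_sub_le x y
  have h0 := norm_nonneg (x - y)
  have : ‖x - y‖ ^ 2 ≤ (‖x‖ + ‖y‖) ^ 2 := by gcongr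
  unfold wt
  nlinarith [sq_nonneg (‖x‖ - ‖y‖), mul_nonneg (sq_nonneg ‖x‖) (sq_nonneg ‖y‖)]

/-- The weight varies by a bounded factor at unit distance, hence mollification at scale at most one
preserves weighted norms. -/
theorem wt_le_of_norm_sub_le {x y : Space d} (h : ‖x - y‖ ≤ 1) : wt x ≤ 4 * wt y := by
  have h1 := norm_sub_norm_le x y
  have h2 := norm_nonneg y
  have : ‖x‖ ^ 2 ≤ (‖y‖ + 1) ^ 2 := by gcongr; linarith
  unfold wt
  nlinarith [sq_nonneg (‖y‖ - 1), sq_nonneg ‖y‖]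

theorem one_add_norm_le_wt (x : Space d) : 1 + ‖x‖ ≤ 2 * wt x := by
  unfold wt
  nlinarith [sq_nonneg (‖x‖ - 1), sq_nonneg ‖x‖]

theorem wt_pow_mono (x : Space d) {m n : ℕ} (h : m ≤ n) : wt x ^ m ≤ wt x ^ n :=
  pow_le_pow_right₀ (one_le_wt x) h

theorem norm_fderiv_le_sum (u : Space d → ℝ) (x : Space d) :
    ‖fderiv ℝ u x‖ ≤ ∑ i, |partialDeriv i u x| := by
  refine ContinuousLinearMap.opNorm_le_bound _ (Finset.sum_nonneg fun _ _ => abs_nonneg _)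
    fun y => ?_
  rw [clm_apply_eq_sum, Finset.sum_mul]
  refine (norm_sum_le _ _).trans (Finset.sum_le_sum fun i _ => ?_)
  rw [norm_mul, mul_comm]
  exact mul_le_mul_of_nonneg_left (PiLp.norm_apply_le y i) (abs_nonneg _)

theorem fderiv_eq_sum (u : Space d → ℝ) : fderiv ℝ u =
    fun x => ∑ i, partialDeriv i u x • (EuclideanSpace.proj i : Space d →L[ℝ] ℝ) := by
  ext x y
  rw [clm_apply_eq_sum]
  simp [partialDeriv, mul_comm]

theorem contDiff_succ_of_partialDeriv {n : ℕ} {u : Space d → ℝ} (hu : Differentiable ℝ u)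
    (h : ∀ i, ContDiff ℝ n (partialDeriv i u)) : ContDiff ℝ ((n + 1 : ℕ) : WithTop ℕ∞) u := by
  push_cast
  rw [contDiff_succ_iff_fderiv]
  refine ⟨hu, fun h => by simp at h, ?_⟩
  rw [fderiv_eq_sum]
  exact ContDiff.sum fun i _ => (h i).smul contDiff_const

/-! ### Convolution of a function of polynomial growth with a density -/

theorem conv_apply (f r : Space d → ℝ) (x : Space d) : conv f r x = ∫ y, r y * f (x - y) := rfl

section Conv

variable {f r : Space d → ℝ} {C : ℝ} {m : ℕ}

theorem abs_mul_sub_le (hC : 0 ≤ C) (hf : ∀ x, |f x| ≤ C * wt x ^ m) (h0 : ∀ x, 0 ≤ r x)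
    (x y : Space d) : ‖r y * f (x - y)‖ ≤ C * 2 ^ m * wt x ^ m * (wt y ^ m * r y) := by
  rw [norm_mul, Real.norm_eq_abs, abs_of_nonneg (h0 y), Real.norm_eq_abs]
  have h1 : wt (x - y) ^ m ≤ (2 * wt x * wt y) ^ m :=
    pow_le_pow_left₀ (wt_pos _).le (wt_sub_le x y) m
  calc r y * |f (x - y)| ≤ r y * (C * (2 * wt x * wt y) ^ m) := by
        refine mul_le_mul_of_nonneg_left ((hf _).trans ?_) (h0 y)
        gcongr
    _ = _ := by rw [mul_pow, mul_pow]; ring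

theorem integrable_conv (hC : 0 ≤ C) (hfm : Measurable f) (hf : ∀ x, |f x| ≤ C * wt x ^ m)
    (hrc : Continuous r) (h0 : ∀ x, 0 ≤ r x) (hr : Integrable fun y => wt y ^ m * r y)
    (x : Space d) : Integrable fun y => r y * f (x - y) :=
  (hr.const_mul (C * 2 ^ m * wt x ^ m)).mono'
    ((hrc.measurable.mul (hfm.comp (measurable_const.sub measurable_id))).aestronglyMeasurable)
    (Eventually.of_forall fun y => abs_mul_sub_le hC hf h0 x y)

theorem abs_conv_le (hC : 0 ≤ C) (hf : ∀ x, |f x| ≤ C * wt x ^ m)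
    (h0 : ∀ x, 0 ≤ r x) (hr : Integrable fun y => wt y ^ m * r y) (x : Space d) :
    |conv f r x| ≤ C * 2 ^ m * (∫ y, wt y ^ m * r y) * wt x ^ m := by
  rw [conv_apply]
  refine (norm_integral_le_of_norm_le (hr.const_mul (C * 2 ^ m * wt x ^ m))
    (Eventually.of_forall fun y => abs_mul_sub_le hC hf h0 x y)).trans (le_of_eq ?_)
  rw [integral_const_mul]
  ring

theorem continuous_conv (hC : 0 ≤ C) (hfc : Continuous f) (hf : ∀ x, |f x| ≤ C * wt x ^ m)
    (hrc : Continuous r) (h0 : ∀ x, 0 ≤ r x) (hr : Integrable fun y => wt y ^ m * r y) :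
    Continuous (conv f r) := by
  rw [continuous_iff_continuousAt]
  intro x₀
  change ContinuousAt (fun x => ∫ y, r y * f (x - y)) x₀
  -- On the unit ball around `x₀` the weight is at most `4 * wt x₀`, which makes the majorant
  -- independent of `x`.
  refine continuousAt_of_dominated (bound := fun y => C * 2 ^ m * (4 * wt x₀) ^ m * (wt y ^ m * r y))
    ?_ ?_ (hr.const_mul _) ?_
  · exact Eventually.of_forall fun x =>
      (integrable_conv hC hfc.measurable hf hrc h0 hr x).aestronglyMeasurable
  · filter_upwards [Metric.closedBall_mem_nhds x₀ one_pos] with x hx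
    refine Eventually.of_forall fun y => (abs_mul_sub_le hC hf h0 x y).trans ?_
    have h1 : wt x ≤ 4 * wt x₀ := wt_le_of_norm_sub_le (by simpa [dist_eq_norm] using hx)
    have h2 : 0 ≤ wt y ^ m * r y := mul_nonneg (pow_nonneg (wt_pos y).le m) (h0 y)
    have h3 : wt x ^ m ≤ (4 * wt x₀) ^ m := pow_le_pow_left₀ (wt_pos _).le h1 m
    gcongr
  · exact Eventually.of_forall fun y => by fun_prop

theorem hasFDerivAt_conv (hC : 0 ≤ C) (hfd : Differentiable ℝ f) (hf : ∀ x, |f x| ≤ C * wt x ^ m)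
    (hf' : ∀ x, ‖fderiv ℝ f x‖ ≤ C * wt x ^ m)
    (hrc : Continuous r) (h0 : ∀ x, 0 ≤ r x) (hr : Integrable fun y => wt y ^ m * r y)
    (x₀ : Space d) :
    HasFDerivAt (conv f r) (∫ y, r y • fderiv ℝ f (x₀ - y)) x₀ ∧
      Integrable (fun y => r y • fderiv ℝ f (x₀ - y)) ∧
      ‖∫ y, r y • fderiv ℝ f (x₀ - y)‖ ≤ C * 2 ^ m * (∫ y, wt y ^ m * r y) * wt x₀ ^ m := by
  have hm : AEStronglyMeasurable (fun y => r y • fderiv ℝ f (x₀ - y)) :=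
    (hrc.measurable.smul ((measurable_fderiv ℝ f).comp
      (measurable_const.sub measurable_id))).aestronglyMeasurable
  have hb : ∀ x y, ‖r y • fderiv ℝ f (x - y)‖ ≤ C * 2 ^ m * wt x ^ m * (wt y ^ m * r y) := by
    intro x y
    have := abs_mul_sub_le (f := fun x => ‖fderiv ℝ f x‖) hC (fun x => by simpa using hf' x) h0 x y
    simpa [norm_smul] using this
  refine ⟨?_, (hr.const_mul _).mono' hm (Eventually.of_forall fun y => hb x₀ y), ?_⟩
  · refine hasFDerivAt_integral_of_dominated_of_fderiv_le
      (F := fun x y => r y * f (x - y)) (F' := fun x y => r y • fderiv ℝ f (x - y))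
      (bound := fun y => C * 2 ^ m * (4 * wt x₀) ^ m * (wt y ^ m * r y))
      (Metric.closedBall_mem_nhds x₀ one_pos) ?_ ?_ hm ?_ (hr.const_mul _) ?_
    · exact Eventually.of_forall fun x =>
        (integrable_conv hC hfd.continuous.measurable hf hrc h0 hr x).aestronglyMeasurable
    · exact integrable_conv hC hfd.continuous.measurable hf hrc h0 hr x₀
    · refine Eventually.of_forall fun y x hx => (hb x y).trans ?_
      have h1 : wt x ≤ 4 * wt x₀ := wt_le_of_norm_sub_le (by simpa [dist_eq_norm] using hx)
      have h2 : 0 ≤ wt y ^ m * r y := mul_nonneg (pow_nonneg (wt_pos y).le m) (h0 y)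
      have h3 : wt x ^ m ≤ (4 * wt x₀) ^ m := pow_le_pow_left₀ (wt_pos _).le h1 m
      gcongr
    · refine Eventually.of_forall fun y x _ => ?_
      have h1 : HasFDerivAt (fun x => f (x - y)) (fderiv ℝ f (x - y)) x := by
        rw [hasFDerivAt_comp_sub]
        exact (hfd (x - y)).hasFDerivAt
      exact h1.const_mul (r y)
  · refine (norm_integral_le_of_norm_le (hr.const_mul (C * 2 ^ m * wt x₀ ^ m))
      (Eventually.of_forall fun y => hb x₀ y)).trans (le_of_eq ?_)
    rw [integral_const_mul]
    ring

theorem partialDeriv_conv (hC : 0 ≤ C) (hfd : Differentiable ℝ f) (hf : ∀ x, |f x| ≤ C * wt x ^ m)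
    (hf' : ∀ x, ‖fderiv ℝ f x‖ ≤ C * wt x ^ m)
    (hrc : Continuous r) (h0 : ∀ x, 0 ≤ r x) (hr : Integrable fun y => wt y ^ m * r y)
    (i : Fin d) : partialDeriv i (conv f r) = conv (partialDeriv i f) r := by
  ext x
  obtain ⟨h1, h2, -⟩ := hasFDerivAt_conv hC hfd hf hf' hrc h0 hr x
  rw [partialDeriv, h1.fderiv, ContinuousLinearMap.integral_apply h2]
  rfl

theorem locBoundedDeriv_conv (hC : 0 ≤ C) (hfd : Differentiable ℝ f)
    (hf : ∀ x, |f x| ≤ C * wt x ^ m) (hf' : ∀ x, ‖fderiv ℝ f x‖ ≤ C * wt x ^ m)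
    (hrc : Continuous r) (h0 : ∀ x, 0 ≤ r x) (hr : Integrable fun y => wt y ^ m * r y) :
    LocBoundedDeriv (conv f r) := by
  have h := hasFDerivAt_conv hC hfd hf hf' hrc h0 hr
  refine ⟨fun x => (h x).1.differentiableAt, fun K hK => ?_⟩
  obtain ⟨A, hA⟩ := hK.exists_bound_of_continuousOn (f := fun x : Space d =>
    C * 2 ^ m * (∫ y, wt y ^ m * r y) * wt x ^ m)
    (continuous_const.mul (continuous_wt.pow m)).continuousOn
  refine ⟨A, fun x hx => ?_⟩
  rw [(h x).1.fderiv]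
  exact (h x).2.2.trans ((le_abs_self _).trans (hA x hx))

end Conv

/-- All derivatives fall on `f`, so `r` contributes only continuity and a moment. The induction
splits off the innermost derivative: the bounds for `partialDeriv i f` are then instances of those
for `f`. -/
theorem contDiff_conv {r : Space d → ℝ} {C : ℝ} {m : ℕ} (hC : 0 ≤ C)
    (hrc : Continuous r) (h0 : ∀ x, 0 ≤ r x) (hr : Integrable fun y => wt y ^ m * r y)
    (n : ℕ) {f : Space d → ℝ} (hfd : ContDiff ℝ n f)
    (hf : ∀ L : List (Fin d), L.length ≤ n → ∀ x, |lderiv L f x| ≤ C * wt x ^ m) :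
    ContDiff ℝ n (conv f r) ∧
      ∀ L : List (Fin d), L.length ≤ n → lderiv L (conv f r) = conv (lderiv L f) r := by
  induction n generalizing f with
  | zero =>
    refine ⟨?_, fun L hL => ?_⟩
    · exact contDiff_zero.2 (continuous_conv hC hfd.continuous (hf [] le_rfl) hrc h0 hr)
    · obtain rfl : L = [] := List.length_eq_zero_iff.1 (by omega)
      rfl
  | succ n ih =>
    -- One constant has to bound both `f` and its full derivative; the latter is a sum of `d`
    -- partial derivatives.
    have hC' : C ≤ d * C + C := by have : 0 ≤ d * C := by positivity
                                   linarith
    have hdC : 0 ≤ d * C + C := hC.trans hC'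
    have hd : Differentiable ℝ f := hfd.differentiable (by simp)
    have hw : ∀ x : Space d, 0 ≤ wt x ^ m := fun x => pow_nonneg (wt_pos x).le m
    have hf0 : ∀ x, |f x| ≤ (d * C + C) * wt x ^ m := fun x =>
      (hf [] (by simp) x).trans (mul_le_mul_of_nonneg_right hC' (hw x))
    have hf1 : ∀ x, ‖fderiv ℝ f x‖ ≤ (d * C + C) * wt x ^ m := fun x => by
      refine (norm_fderiv_le_sum f x).trans ((Finset.sum_le_card_nsmul _ _ (C * wt x ^ m)
        fun i _ => hf [i] (by simp) x).trans ?_)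
      have := mul_nonneg hC (hw x)
      simp
      nlinarith
    have hp := partialDeriv_conv hdC hd hf0 hf1 hrc h0 hr
    have hi : ∀ i, _ := fun i => ih (f := partialDeriv i f)
      (contDiff_partialDeriv (n := n) (m := (n + 1 : ℕ)) hfd (by simp) i)
      (fun L hL x => by
        have := hf (L ++ [i]) (by simpa using hL) x
        rwa [lderiv_append] at this)
    refine ⟨contDiff_succ_of_partialDeriv (locBoundedDeriv_conv hdC hd hf0 hf1 hrc h0 hr).1
      fun i => by rw [hp]; exact (hi i).1, fun L hL => ?_⟩
    rcases List.eq_nil_or_concat L with rfl | ⟨L', i, rfl⟩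
    · rfl
    · have hL' : L'.length ≤ n := by simpa using hL
      simp only [List.concat_eq_append, lderiv_append]
      simp only [lderiv_cons, lderiv_nil]
      rw [hp, (hi i).2 L' (by omega)]

/-! ### Growth of the potentials -/

theorem HasPolyGrowthDerivs.exists_lderiv_le {n : ℕ} {U : Space d → ℝ}
    (hU : HasPolyGrowthDerivs n U) : ∃ C : ℝ, 0 ≤ C ∧ ∃ m : ℕ, ∀ L : List (Fin d), L.length ≤ n →
      ∀ x, |lderiv L U x| ≤ C * wt x ^ m := by
  obtain ⟨hc, hg⟩ := hU
  have : ∀ α : Fin d → ℕ, ∃ C : ℝ, ∃ k : ℕ, multiLength α ≤ n →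
      ∀ x, |multiDeriv α U x| ≤ C * (1 + ‖x‖) ^ k := by
    intro α
    by_cases h : multiLength α ≤ n
    · obtain ⟨C, k, hk⟩ := hg α h
      exact ⟨C, k, fun _ => hk⟩
    · exact ⟨0, 0, fun h' => absurd h' h⟩
  choose C k hk using this
  have hpos : ∀ α ∈ multiIndices d n, 0 ≤ |C α| * 2 ^ k α := fun _ _ => by positivity
  refine ⟨∑ α ∈ multiIndices d n, |C α| * 2 ^ k α, Finset.sum_nonneg hpos,
    ∑ α ∈ multiIndices d n, k α, fun L hL x => ?_⟩
  obtain ⟨α, hα, hLα⟩ := exists_multiDeriv_eq_lderiv L (hc.of_le (by exact_mod_cast hL))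
  have hαn : multiLength α ≤ n := hα ▸ hL
  have hmem := mem_multiIndices.2 hαn
  rw [hLα]
  calc |multiDeriv α U x| ≤ C α * (1 + ‖x‖) ^ k α := hk α hαn x
    _ ≤ |C α| * (2 * wt x) ^ k α := by
        have := one_add_norm_le_wt x
        have := le_abs_self (C α)
        gcongr
    _ = |C α| * 2 ^ k α * wt x ^ k α := by rw [mul_pow]; ring
    _ ≤ _ := by
        gcongr
        · exact pow_nonneg (wt_pos x).le _
        · exact Finset.single_le_sum (f := fun α => |C α| * 2 ^ k α) hpos hmem
        · exact one_le_wt x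
        · exact Finset.single_le_sum (f := k) (fun _ _ => Nat.zero_le _) hmem

/-- Along the segment from `0` to `x`, the function `t ↦ ∇V(t x) · x` has derivative `D²V(t x)(x, x)
≥ β |x|²`, so the mean value theorem compares its value at `1` with `∇V(0) · x`. -/
theorem HessianBounds.exists_fderiv_apply_ge {V W : Space d → ℝ} (h : HessianBounds V W) :
    ∃ C : ℝ, 0 ≤ C ∧ ∀ x, -(C * wt x) ≤ fderiv ℝ V x x := by
  obtain ⟨⟨h1, h2, -⟩, -, ⟨β, hβ⟩, -⟩ := h
  refine ⟨‖fderiv ℝ V 0‖ + |β|, by positivity, fun x => ?_⟩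
  have hd : ∀ t : ℝ, HasDerivAt (fun t : ℝ => fderiv ℝ V (t • x) x) (hessian V (t • x) x x) t := by
    intro t
    have e1 : HasDerivAt (fun t : ℝ => t • x) x t := by
      simpa using (hasDerivAt_id t).smul_const x
    have e2 := (h2 (t • x)).hasFDerivAt.comp_hasDerivAt t e1
    have e3 := e2.clm_apply (hasDerivAt_const t x)
    simp only [map_zero, add_zero] at e3
    exact e3
  obtain ⟨c, -, hc⟩ := exists_hasDerivAt_eq_slope (fun t : ℝ => fderiv ℝ V (t • x) x)
    (fun t => hessian V (t • x) x x) zero_lt_one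
    (fun t _ => (hd t).continuousAt.continuousWithinAt) (fun t _ => hd t)
  simp only [one_smul, zero_smul, sub_zero, div_one] at hc
  have e1 := hβ (c • x) x
  have e2 := (abs_le.1 ((fderiv ℝ V 0).le_opNorm x)).1
  have e3 := neg_abs_le β
  have e4 := norm_nonneg (fderiv ℝ V 0)
  have e5 := norm_nonneg x
  have e6 : ‖x‖ ≤ wt x := by unfold wt; nlinarith [sq_nonneg (‖x‖ - 1)]
  have e7 : ‖x‖ ^ 2 ≤ wt x := by unfold wt; linarith
  have e8 : -(|β| * wt x) ≤ β * ‖x‖ ^ 2 := by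
    have : |β| * ‖x‖ ^ 2 ≤ |β| * wt x := by gcongr
    nlinarith [sq_nonneg ‖x‖]
  have e9 : ‖fderiv ℝ V 0‖ * ‖x‖ ≤ ‖fderiv ℝ V 0‖ * wt x := by gcongr
  linarith

/-- A two-sided bound on the quadratic form bounds every second derivative, so `∇W` is Lipschitz. It
therefore grows linearly, and `W` quadratically, which is what a density with finite second moment
can integrate. -/
theorem HessianBounds.exists_interaction_le {V W : Space d → ℝ} (h : HessianBounds V W) :
    ∃ C : ℝ, 0 ≤ C ∧ (∀ x, |W x| ≤ C * wt x ^ 1) ∧ (∀ x, ‖fderiv ℝ W x‖ ≤ C * wt x ^ 1) ∧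
      ∀ i, Differentiable ℝ (partialDeriv i W) ∧ (∀ x, |partialDeriv i W x| ≤ C * (1 + ‖x‖)) ∧
        (∀ x, |partialDeriv i W x| ≤ C * wt x ^ 1) ∧
        ∀ x, ‖fderiv ℝ (partialDeriv i W) x‖ ≤ C * wt x ^ 1 := by
  obtain ⟨-, ⟨h1, h2, -⟩, -, γ, γ', hW⟩ := h
  set A := |γ| + |γ'| with hA
  have hA0 : 0 ≤ A := by positivity
  have hd : ∀ x u, |hessian W x u u| ≤ A * ‖u‖ ^ 2 := by
    intro x u
    obtain ⟨e1, e2⟩ := hW x u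
    have := neg_abs_le γ; have := le_abs_self γ'; have := abs_nonneg γ; have := abs_nonneg γ'
    have := sq_nonneg ‖u‖
    rw [abs_le]
    constructor <;> nlinarith
  have hij : ∀ x i j, |partialDeriv i (partialDeriv j W) x| ≤ 2 * A := by
    intro x i j
    rw [hessian_apply h2]
    set u : Space d := EuclideanSpace.single i 1
    set v : Space d := EuclideanSpace.single j 1
    have hu : ‖u‖ = 1 := by simp [u]
    have hv : ‖v‖ = 1 := by simp [v]
    have hs : hessian W x u v = hessian W x v u :=
      second_derivative_symmetric (fun y => (h1 y).hasFDerivAt) (h2 x).hasFDerivAt _ _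
    -- Polarisation: `4 D²W(u, v) = D²W(u + v, u + v) - D²W(u - v, u - v)`, and both terms are at
    -- most `4 A` in absolute value.
    have e1 := hd x (u + v)
    have e2 := hd x (u - v)
    have n1 : ‖u + v‖ ^ 2 ≤ 4 := by
      have := norm_add_le u v
      nlinarith [norm_nonneg (u + v)]
    have n2 : ‖u - v‖ ^ 2 ≤ 4 := by
      have := norm_sub_le u v
      nlinarith [norm_nonneg (u - v)]
    simp only [map_add, map_sub, add_apply, sub_apply]
      at e1 e2
    have m1 : A * ‖u + v‖ ^ 2 ≤ A * 4 := by gcongr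
    have m2 : A * ‖u - v‖ ^ 2 ≤ A * 4 := by gcongr
    rw [abs_le] at *
    constructor <;> linarith
  have hdi : ∀ i, Differentiable ℝ (partialDeriv i W) := fun i =>
    h2.clm_apply (differentiable_const (c := (EuclideanSpace.single i (1:ℝ) : Space d)))
  have hfi : ∀ i x, ‖fderiv ℝ (partialDeriv i W) x‖ ≤ d * (2 * A) := by
    intro i x
    refine (norm_fderiv_le_sum _ x).trans ((Finset.sum_le_card_nsmul _ _ _
      fun j _ => hij x j i).trans ?_)
    simp
  set A₁ := ∑ i, |partialDeriv i W 0| + d * (2 * A) with hA₁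
  have hA₁0 : 0 ≤ A₁ := by positivity
  have hli : ∀ i x, |partialDeriv i W x| ≤ A₁ * (1 + ‖x‖) := by
    intro i x
    have e := Convex.norm_image_sub_le_of_norm_fderiv_le (𝕜 := ℝ) (f := partialDeriv i W)
      (s := univ) (x := 0) (y := x) (fun y _ => hdi i y) (fun y _ => hfi i y) convex_univ
      (mem_univ _) (mem_univ _)
    rw [sub_zero] at e
    have e1 : |partialDeriv i W x| ≤ |partialDeriv i W 0| + d * (2 * A) * ‖x‖ := by
      have := abs_sub_abs_le_abs_sub (partialDeriv i W x) (partialDeriv i W 0)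
      rw [Real.norm_eq_abs] at e
      linarith
    have e2 : |partialDeriv i W 0| ≤ ∑ i, |partialDeriv i W 0| :=
      Finset.single_le_sum (f := fun i => |partialDeriv i W 0|) (fun _ _ => abs_nonneg _)
        (Finset.mem_univ i)
    have e3 : 0 ≤ d * (2 * A) := by positivity
    have e4 := norm_nonneg x
    have e5 := abs_nonneg (partialDeriv i W 0)
    nlinarith
  have hlf : ∀ x, ‖fderiv ℝ W x‖ ≤ d * A₁ * (1 + ‖x‖) := by
    intro x
    refine (norm_fderiv_le_sum _ x).trans ((Finset.sum_le_card_nsmul _ _ _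
      fun j _ => hli j x).trans ?_)
    simp [mul_assoc]
  have hl : ∀ x, |W x| ≤ (|W 0| + 2 * (d * A₁)) * wt x := by
    intro x
    have e := Convex.norm_image_sub_le_of_norm_fderiv_le (𝕜 := ℝ) (f := W)
      (s := Metric.closedBall 0 ‖x‖) (x := 0) (y := x) (C := d * A₁ * (1 + ‖x‖)) (fun y _ => h1 y)
      (fun y hy => (hlf y).trans (by
        have : ‖y‖ ≤ ‖x‖ := by simpa using hy
        gcongr)) (convex_closedBall _ _) (by simp) (by simp)
    rw [sub_zero, Real.norm_eq_abs] at e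
    have e1 := abs_sub_abs_le_abs_sub (W x) (W 0)
    have e2 : (1 + ‖x‖) * ‖x‖ ≤ 2 * wt x := by
      unfold wt; nlinarith [sq_nonneg (‖x‖ - 1)]
    have e3 : d * A₁ * ((1 + ‖x‖) * ‖x‖) ≤ d * A₁ * (2 * wt x) := by gcongr
    have e4 : |W 0| ≤ |W 0| * wt x := le_mul_of_one_le_right (abs_nonneg _) (one_le_wt x)
    nlinarith
  refine ⟨(|W 0| + 2 * (d * A₁)) + 2 * A₁ + d * (2 * A), by positivity, fun x => ?_, fun x => ?_,
    fun i => ⟨hdi i, fun x => ?_, fun x => ?_, fun x => ?_⟩⟩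
  · rw [pow_one]
    refine (hl x).trans (mul_le_mul_of_nonneg_right ?_ (wt_pos x).le)
    have : 0 ≤ d * (2 * A) := by positivity
    linarith
  · rw [pow_one]
    refine (hlf x).trans ?_
    have e := one_add_norm_le_wt x
    calc d * A₁ * (1 + ‖x‖) ≤ d * A₁ * (2 * wt x) := by gcongr
      _ = (2 * (d * A₁)) * wt x := by ring
      _ ≤ _ := by
        refine mul_le_mul_of_nonneg_right ?_ (wt_pos x).le
        have : 0 ≤ d * (2 * A) := by positivity
        have := abs_nonneg (W 0)
        linarith
  · refine (hli i x).trans (mul_le_mul_of_nonneg_right ?_ (by positivity))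
    have : 0 ≤ d * (2 * A) := by positivity
    have : 0 ≤ d * A₁ := by positivity
    have := abs_nonneg (W 0)
    linarith
  · rw [pow_one]
    refine (hli i x).trans ?_
    calc A₁ * (1 + ‖x‖) ≤ A₁ * (2 * wt x) := by have := one_add_norm_le_wt x; gcongr
      _ = (2 * A₁) * wt x := by ring
      _ ≤ _ := by
        refine mul_le_mul_of_nonneg_right ?_ (wt_pos x).le
        have : 0 ≤ d * (2 * A) := by positivity
        have : 0 ≤ d * A₁ := by positivity
        have := abs_nonneg (W 0)
        linarith
  · rw [pow_one]
    refine (hfi i x).trans ((le_mul_of_one_le_right (by positivity) (one_le_wt x)).trans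
      (mul_le_mul_of_nonneg_right ?_ (wt_pos x).le))
    have : 0 ≤ d * A₁ := by positivity
    have := abs_nonneg (W 0)
    linarith

/-! ### The drift -/

/-- The `i`-th component of `∇(V + W * r)`. -/
def drift (V W r : Space d → ℝ) (i : Fin d) : Space d → ℝ :=
  partialDeriv i fun y => V y + conv W r y

theorem divergence_flux (V W r : Space d → ℝ) (x : Space d) :
    divergence (flux V W r) x = ∑ i, partialDeriv i (fun y => r y * drift V W r i y) x := by
  unfold divergence
  refine Finset.sum_congr rfl fun i _ => ?_
  refine congrArg (fun u => partialDeriv i u x) (funext fun y => ?_)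
  have : gradient (fun y => V y + conv W r y) y i = drift V W r i y := by
    have h : inner ℝ (gradient (fun y => V y + conv W r y) y) (EuclideanSpace.single i (1:ℝ)) =
        drift V W r i y := by
      rw [gradient, InnerProductSpace.toDual_symm_apply]
      rfl
    rw [← h, EuclideanSpace.inner_single_right]
    simp
  simp [flux, this]

/-- `r` is a continuous probability density with finite second moment. -/
structure IsNiceDensity (r : Space d → ℝ) : Prop where
  continuous : Continuous r
  nonneg : ∀ x, 0 ≤ r x
  integrable : Integrable r
  integral_eq : ∫ x, r x = 1
  integrable_wt : Integrable fun x => wt x ^ 1 * r x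

theorem IsNiceDensity.one_le {r : Space d → ℝ} (hr : IsNiceDensity r) :
    1 ≤ ∫ x, wt x ^ 1 * r x := by
  rw [← hr.integral_eq]
  refine integral_mono hr.integrable hr.integrable_wt fun x => ?_
  rw [pow_one]
  exact le_mul_of_one_le_left (hr.nonneg x) (one_le_wt x)

section Drift

variable {V W r : Space d → ℝ}

theorem drift_eq (h : HessianBounds V W) (hr : IsNiceDensity r) (i : Fin d) :
    drift V W r i = fun x => partialDeriv i V x + conv (partialDeriv i W) r x := by
  obtain ⟨C, hC, h1, h2, -⟩ := h.exists_interaction_le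
  have hWd : Differentiable ℝ W := h.2.1.1
  rw [drift, partialDeriv_add h.1.1
    (locBoundedDeriv_conv hC hWd h1 h2 hr.continuous hr.nonneg hr.integrable_wt).1,
    partialDeriv_conv hC hWd h1 h2 hr.continuous hr.nonneg hr.integrable_wt]

theorem HasLocallyBoundedHessian.locBoundedDeriv {U : Space d → ℝ}
    (h : HasLocallyBoundedHessian U) (i : Fin d) : LocBoundedDeriv (partialDeriv i U) := by
  obtain ⟨-, h2, h3⟩ := h
  refine ⟨h2.clm_apply (differentiable_const (c := (EuclideanSpace.single i (1:ℝ) : Space d))),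
    fun K hK => ?_⟩
  obtain ⟨C, hC⟩ := h3 K hK
  refine ⟨d * C, fun x hx => ?_⟩
  refine (norm_fderiv_le_sum _ x).trans ((Finset.sum_le_card_nsmul _ _ C fun j _ => ?_).trans ?_)
  · rw [hessian_apply h2]
    refine ((hessian U x _).le_opNorm _).trans ?_
    have := (hessian U x).le_opNorm (EuclideanSpace.single j (1:ℝ))
    simp only [PiLp.norm_single, norm_one, mul_one] at this ⊢
    exact this.trans (hC x hx)
  · simp

theorem locBoundedDeriv_drift (h : HessianBounds V W) (hr : IsNiceDensity r) (i : Fin d) :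
    LocBoundedDeriv (drift V W r i) := by
  rw [drift_eq h hr]
  obtain ⟨C, hC, -, -, h3⟩ := h.exists_interaction_le
  obtain ⟨e1, -, e3, e4⟩ := h3 i
  exact (h.1.locBoundedDeriv i).add
    (locBoundedDeriv_conv hC e1 e3 e4 hr.continuous hr.nonneg hr.integrable_wt)

/-- The dissipativity estimate behind the moment bounds. Linear growth of `∇W` gives `|x| |∇W(x -
y)| ≤ C (wt x + wt y)` up to a factor, and integrating in `y` brings in no more than the second
moment of `r`. -/
theorem exists_drift_inner_ge (h : HessianBounds V W) : ∃ C : ℝ, 0 ≤ C ∧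
    ∀ r : Space d → ℝ, IsNiceDensity r → ∀ x : Space d,
      -(C * (wt x + ∫ y, wt y ^ 1 * r y)) ≤ ∑ i, drift V W r i x * x i := by
  obtain ⟨C₀, hC₀, hV⟩ := h.exists_fderiv_apply_ge
  obtain ⟨C, hC, -, -, hW⟩ := h.exists_interaction_le
  refine ⟨C₀ + d * (2 * C), by positivity, fun r hr x => ?_⟩
  set S := ∫ y, wt y ^ 1 * r y
  have hS : 1 ≤ S := hr.one_le
  have hsum : ∑ i, drift V W r i x * x i =
      fderiv ℝ V x x + ∑ i, conv (partialDeriv i W) r x * x i := by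
    simp only [drift_eq h hr, add_mul, Finset.sum_add_distrib]
    rw [clm_apply_eq_sum (fderiv ℝ V x) x]
    simp only [partialDeriv, mul_comm]
  have hterm : ∀ i, -(2 * C * (wt x + S)) ≤ conv (partialDeriv i W) r x * x i := by
    intro i
    obtain ⟨e1, e2, e3, e4⟩ := hW i
    have hb : ∀ y, ‖x i * (r y * partialDeriv i W (x - y))‖ ≤ 2 * C * (wt x * r y + wt y ^ 1 * r y) := by
      intro y
      have hxi : |x i| ≤ ‖x‖ := PiLp.norm_apply_le x i
      have hd : |partialDeriv i W (x - y)| ≤ C * (1 + (‖x‖ + ‖y‖)) :=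
        (e2 _).trans (by have := norm_sub_le x y; gcongr)
      have h0 := hr.nonneg y
      have hq : ‖x‖ * (1 + (‖x‖ + ‖y‖)) ≤ 2 * (wt x + wt y) := by
        unfold wt
        nlinarith [sq_nonneg (‖x‖ - 1), sq_nonneg (‖x‖ - ‖y‖), sq_nonneg ‖y‖]
      rw [norm_mul, norm_mul, Real.norm_eq_abs, Real.norm_eq_abs, Real.norm_eq_abs, abs_of_nonneg h0]
      calc |x i| * (r y * |partialDeriv i W (x - y)|)
          ≤ ‖x‖ * (r y * (C * (1 + (‖x‖ + ‖y‖)))) := by gcongr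
        _ = C * (‖x‖ * (1 + (‖x‖ + ‖y‖))) * r y := by ring
        _ ≤ C * (2 * (wt x + wt y)) * r y := by
            exact mul_le_mul_of_nonneg_right (mul_le_mul_of_nonneg_left hq hC) h0
        _ = _ := by ring
    have hI : Integrable fun y => 2 * C * (wt x * r y + wt y ^ 1 * r y) :=
      ((hr.integrable.const_mul _).add hr.integrable_wt).const_mul _
    have := norm_integral_le_of_norm_le hI (Eventually.of_forall hb)
    rw [integral_const_mul, integral_const_mul, integral_add (hr.integrable.const_mul _)
      hr.integrable_wt, integral_const_mul, hr.integral_eq, mul_one, mul_comm (x i)] at this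
    exact (abs_le.1 this).1
  rw [hsum]
  have e1 := hV x
  have e2 : ∑ _i : Fin d, -(2 * C * (wt x + S)) ≤ ∑ i, conv (partialDeriv i W) r x * x i :=
    Finset.sum_le_sum fun i _ => hterm i
  simp only [Finset.sum_const, Finset.card_univ, Fintype.card_fin, nsmul_eq_mul] at e2
  have e3 : C₀ * wt x ≤ C₀ * (wt x + S) := by gcongr; linarith
  nlinarith

/-- The drift is as smooth as `∇V` and `∇W`, whatever the regularity of `r`; this is where `s + 1`
derivatives of the potentials are spent. The exponent `m` and the constant `C` do not depend on `r`.
-/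
theorem exists_drift_lderiv_le {s : ℕ} (h : HessianBounds V W)
    (hV : HasPolyGrowthDerivs (s + 1) V) (hW : HasPolyGrowthDerivs (s + 1) W) :
    ∃ C : ℝ, 0 ≤ C ∧ ∃ m : ℕ, ∀ r : Space d → ℝ, IsNiceDensity r →
      (Integrable fun y => wt y ^ m * r y) → ∀ i, ContDiff ℝ s (drift V W r i) ∧
        ∀ L : List (Fin d), L.length ≤ s → ∀ x,
          |lderiv L (drift V W r i) x| ≤ C * (1 + ∫ y, wt y ^ m * r y) * wt x ^ m := by
  obtain ⟨C₁, hC₁, m₁, h₁⟩ := hV.exists_lderiv_le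
  obtain ⟨C₂, hC₂, m₂, h₂⟩ := hW.exists_lderiv_le
  set m := m₁ + m₂
  refine ⟨C₁ + C₂ * 2 ^ m, by positivity, m, fun r hr hm i => ?_⟩
  have hWi : ContDiff ℝ s (partialDeriv i W) :=
    contDiff_partialDeriv (n := s) (m := (s + 1 : ℕ)) hW.1 (by simp) i
  have hVi : ContDiff ℝ s (partialDeriv i V) :=
    contDiff_partialDeriv (n := s) (m := (s + 1 : ℕ)) hV.1 (by simp) i
  have hb : ∀ L : List (Fin d), L.length ≤ s → ∀ x,
      |lderiv L (partialDeriv i W) x| ≤ C₂ * wt x ^ m := by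
    intro L hL x
    have := h₂ (L ++ [i]) (by simpa using hL) x
    rw [lderiv_append] at this
    exact this.trans (mul_le_mul_of_nonneg_left (wt_pow_mono x (by omega)) hC₂)
  obtain ⟨e1, e2⟩ := contDiff_conv hC₂ hr.continuous hr.nonneg hm s hWi hb
  rw [drift_eq h hr]
  refine ⟨hVi.add e1, fun L hL x => ?_⟩
  have hadd : lderiv L (fun x => partialDeriv i V x + conv (partialDeriv i W) r x) =
      fun x => lderiv L (partialDeriv i V) x + conv (lderiv L (partialDeriv i W)) r x := by
    rw [← e2 L hL]
    clear e2
    induction L with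
    | nil => rfl
    | cons j L ih =>
      have hL' : L.length < s := hL
      have hle : (1 : ℕ∞) + L.length ≤ (s : ℕ) := by
        rw [add_comm]; exact_mod_cast hL'
      rw [lderiv_cons, ih hL'.le, partialDeriv_add
        ((contDiff_lderiv (n := 1) (m := s) L hVi hle).differentiable (by simp))
        ((contDiff_lderiv (n := 1) (m := s) L e1 hle).differentiable (by simp))]
      rfl
  rw [hadd]
  have f1 := h₁ (L ++ [i]) (by simpa using hL) x
  rw [lderiv_append] at f1
  have f2 := abs_conv_le hC₂ (hb L hL) hr.nonneg hm x
  have f3 : wt x ^ m₁ ≤ wt x ^ m := wt_pow_mono x (by omega)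
  have f4 : 0 ≤ ∫ y, wt y ^ m * r y :=
    integral_nonneg fun y => mul_nonneg (pow_nonneg (wt_pos y).le m) (hr.nonneg y)
  have f5 : 0 ≤ wt x ^ m := pow_nonneg (wt_pos x).le m
  have f6 := f1.trans (mul_le_mul_of_nonneg_left f3 hC₁)
  generalize (∫ y, wt y ^ m * r y) = I at f2 f4 ⊢
  generalize wt x ^ m = w at f2 f5 f6 ⊢
  refine (abs_add_le _ _).trans ((add_le_add f6 f2).trans ?_)
  have g1 : 0 ≤ C₁ * I * w := by positivity
  have g2 : 0 ≤ C₂ * 2 ^ m * w := by positivity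
  linarith

end Drift

/-! ### Basic properties of classical solutions -/

/-- Differentiation under the integral sign, for integrands supported in a fixed compact set. -/
theorem hasDerivAt_integral_of_support {H H' : ℝ → Space d → ℝ} {K : Set (Space d)}
    (hK : IsCompact K) (hH : ∀ t, 0 < t → Continuous (H t))
    (hd : ∀ t, 0 < t → ∀ x, HasDerivAt (fun τ => H τ x) (H' t x) t)
    (hc : ContinuousOn (fun p : ℝ × Space d => H' p.1 p.2) (Ioi 0 ×ˢ univ))
    (h0 : ∀ t, 0 < t → ∀ x, x ∉ K → H t x = 0) {t : ℝ} (ht : 0 < t) :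
    HasDerivAt (fun τ => ∫ x, H τ x) (∫ x, H' t x) t := by
  have h0' : ∀ t, 0 < t → ∀ x, x ∉ K → H' t x = 0 := by
    intro t ht x hx
    refine (hd t ht x).unique ((hasDerivAt_const t (0:ℝ)).congr_of_eventuallyEq ?_)
    filter_upwards [Ioi_mem_nhds ht] with τ hτ using h0 τ hτ x hx
  have hcont : ∀ t, 0 < t → Continuous (H' t) := fun t ht =>
    continuousOn_univ.1 (hc.comp (f := fun x : Space d => (t, x)) (by fun_prop)
      (fun x _ => ⟨ht, mem_univ _⟩))
  obtain ⟨C, hC⟩ := ((isCompact_Icc (a := t / 2) (b := 2 * t)).prod hK).exists_bound_of_continuousOn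
    (hc.mono (prod_mono (fun τ hτ => lt_of_lt_of_le (by linarith) hτ.1) (subset_univ _)))
  refine (hasDerivAt_integral_of_dominated_loc_of_deriv_le (F := H) (F' := H')
    (bound := K.indicator fun _ => C) (s := Icc (t / 2) (2 * t))
    (Icc_mem_nhds (by linarith) (by linarith)) ?_ ?_ (hcont t ht).aestronglyMeasurable ?_ ?_ ?_).2
  · filter_upwards [Ioi_mem_nhds ht] with τ hτ using (hH τ hτ).aestronglyMeasurable
  · exact (hH t ht).integrable_of_hasCompactSupport (.of_support_subset_isCompact hK fun x hx => by
      by_contra h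
      exact hx (h0 t ht x h))
  · refine Eventually.of_forall fun x τ hτ => ?_
    have hτ0 : 0 < τ := lt_of_lt_of_le (by linarith) hτ.1
    by_cases hx : x ∈ K
    · rw [indicator_of_mem hx]
      exact hC (τ, x) ⟨hτ, hx⟩
    · rw [indicator_of_notMem hx, h0' τ hτ0 x hx, norm_zero]
  · exact (integrable_indicator_iff hK.measurableSet).2 (integrableOn_const hK.measure_lt_top.ne)
  · refine Eventually.of_forall fun x τ hτ => hd τ (lt_of_lt_of_le (by linarith) hτ.1) x

/-- Slices of a function that is jointly continuous for positive times are continuous. -/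
theorem continuous_slice {Y : Type*} [TopologicalSpace Y] {f : ℝ → Space d → Y}
    (h : ContinuousOn (fun p : ℝ × Space d => f p.1 p.2) (Ioi 0 ×ˢ univ)) {t : ℝ} (ht : 0 < t) :
    Continuous (f t) :=
  continuousOn_univ.1 (h.comp (f := fun x : Space d => (t, x)) (by fun_prop)
      (fun x _ => ⟨ht, mem_univ _⟩))

section Solution

variable {V W ρ₀ : Space d → ℝ} {ρ : ℝ → Space d → ℝ}

theorem IsClassicalSolution.isNiceDensity (h : IsClassicalSolution V W ρ₀ ρ) {t : ℝ} (ht : 0 < t) :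
    IsNiceDensity (ρ t) := by
  obtain ⟨h1, h2, h3⟩ := h.isProbDensity t ht
  have hc := (h.contDiff_space t ht).continuous
  obtain ⟨M, hM⟩ := h.secondMoment t ht
  refine ⟨hc, fun x => ?_, h2, h3, ?_⟩
  -- Nonnegativity almost everywhere becomes pointwise: by continuity the exceptional set is open,
  -- and an open null set is empty.
  · have ho : IsOpen {x | ρ t x < 0} := isOpen_lt hc continuous_const
    have hz : volume {x | ρ t x < 0} = 0 := by
      have : {x | ρ t x < 0} = {x | ¬ 0 ≤ ρ t x} := by ext; simp
      rw [this]
      exact ae_iff.1 h1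
    have := (ho.measure_eq_zero_iff volume).1 hz
    by_contra hx
    exact (this ▸ (not_le.1 hx : x ∈ {x | ρ t x < 0}) : x ∈ (∅ : Set (Space d)))
  · refine (h2.add (hM t ⟨ht, le_rfl⟩).1).congr (Eventually.of_forall fun x => ?_)
    simp [wt, add_mul]

theorem IsClassicalSolution.deriv_eq (h : IsClassicalSolution V W ρ₀ ρ) {t : ℝ} (ht : 0 < t)
    (x : Space d) : deriv (fun τ => ρ τ x) t = ∑ i, partialDeriv i (partialDeriv i (ρ t)) x +
      ∑ i, partialDeriv i (fun y => ρ t y * drift V W (ρ t) i y) x := by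
  rw [h.equation t ht x, laplacian_eq_sum (h.contDiff_space t ht), divergence_flux]

theorem IsClassicalSolution.locBoundedDeriv_mul_drift (hVW : HessianBounds V W)
    (h : IsClassicalSolution V W ρ₀ ρ) {t : ℝ} (ht : 0 < t) (i : Fin d) :
    LocBoundedDeriv fun y => ρ t y * drift V W (ρ t) i y :=
  (LocBoundedDeriv.of_contDiff ((h.contDiff_space t ht).of_le (by norm_num))).mul
    (locBoundedDeriv_drift hVW (h.isNiceDensity ht) i)

theorem IsClassicalSolution.integral_deriv_mul (hVW : HessianBounds V W)
    (h : IsClassicalSolution V W ρ₀ ρ) {φ : Space d → ℝ} (hφ : ContDiff ℝ 2 φ)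
    (hφc : HasCompactSupport φ) {t : ℝ} (ht : 0 < t) :
    ∫ x, deriv (fun τ => ρ τ x) t * φ x =
      ∫ x, ρ t x * (∑ i, (partialDeriv i (partialDeriv i φ) x -
        drift V W (ρ t) i x * partialDeriv i φ x)) := by
  have hρ := h.contDiff_space t ht
  have hρ1 : ∀ i, LocBoundedDeriv (partialDeriv i (ρ t)) := fun i =>
    .of_contDiff (contDiff_partialDeriv (n := 1) (m := 2) hρ (by norm_num) i)
  have hF := fun i => h.locBoundedDeriv_mul_drift hVW ht i
  have hφ1 : ContDiff ℝ 1 φ := hφ.of_le (by norm_num)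
  have hφi : ∀ i, ContDiff ℝ 1 (partialDeriv i φ) := fun i =>
    contDiff_partialDeriv (n := 1) (m := 2) hφ (by norm_num) i
  have hφii : ∀ i, Continuous (partialDeriv i (partialDeriv i φ)) := fun i =>
    (contDiff_partialDeriv (n := 0) (m := 1) (hφi i) (by norm_num) i).continuous
  have hci : ∀ i, HasCompactSupport (partialDeriv i φ) := hasCompactSupport_partialDeriv hφc
  have hcii : ∀ i, HasCompactSupport (partialDeriv i (partialDeriv i φ)) := fun i =>
    hasCompactSupport_partialDeriv (hci i) i
  have e1 : ∀ i, ∫ x, partialDeriv i (partialDeriv i (ρ t)) x * φ x =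
      ∫ x, ρ t x * partialDeriv i (partialDeriv i φ) x := by
    intro i
    rw [integral_partialDeriv_mul (hρ1 i) hφ1 hφc,
      integral_partialDeriv_mul (.of_contDiff (hρ.of_le (by norm_num))) (hφi i) (hci i), neg_neg]
  have e2 := fun i => integral_partialDeriv_mul (hF i) hφ1 hφc i
  have i1 : ∀ i, Integrable fun x => ρ t x * partialDeriv i (partialDeriv i φ) x := fun i =>
    (hρ.continuous.mul (hφii i)).integrable_of_hasCompactSupport (hcii i).mul_left
  have i2 : ∀ i, Integrable fun x => ρ t x * drift V W (ρ t) i x * partialDeriv i φ x := fun i =>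
    ((hF i).1.continuous.mul (hφi i).continuous).integrable_of_hasCompactSupport (hci i).mul_left
  simp only [h.deriv_eq ht, add_mul, Finset.sum_mul]
  rw [integral_add (integrable_finsetSum _ fun i _ =>
      (hρ1 i).integrable_partialDeriv_mul hφ.continuous hφc i)
    (integrable_finsetSum _ fun i _ => (hF i).integrable_partialDeriv_mul hφ.continuous hφc i),
    integral_finsetSum _ (fun i _ => (hρ1 i).integrable_partialDeriv_mul hφ.continuous hφc i),
    integral_finsetSum _ (fun i _ => (hF i).integrable_partialDeriv_mul hφ.continuous hφc i),
    ← Finset.sum_add_distrib]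
  simp only [Finset.mul_sum, mul_sub, ← mul_assoc]
  rw [integral_finsetSum _ fun i _ => show Integrable fun x =>
    ρ t x * partialDeriv i (partialDeriv i φ) x - ρ t x * drift V W (ρ t) i x * partialDeriv i φ x
    from (i1 i).sub (i2 i)]
  refine Finset.sum_congr rfl fun i _ => ?_
  rw [integral_sub (i1 i) (i2 i), e1, e2, sub_eq_add_neg]

theorem IsClassicalSolution.hasDerivAt_integral_mul
    (h : IsClassicalSolution V W ρ₀ ρ) {φ : Space d → ℝ} (hφ : Continuous φ)
    (hφc : HasCompactSupport φ) {t : ℝ} (ht : 0 < t) :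
    HasDerivAt (fun τ => ∫ x, ρ τ x * φ x) (∫ x, deriv (fun τ => ρ τ x) t * φ x) t := by
  refine hasDerivAt_integral_of_support (H := fun τ x => ρ τ x * φ x)
    (H' := fun t x => deriv (fun τ => ρ τ x) t * φ x) hφc ?_ ?_ ?_ ?_ ht
  · exact fun t ht => (continuous_slice h.continuousOn ht).mul hφ
  · exact fun t ht x => (h.differentiableAt_time t ht x).hasDerivAt.mul_const _
  · exact h.continuousOn_time.mul (hφ.comp continuous_snd).continuousOn
  · intro t _ x hx
    simp [image_eq_zero_of_notMem_tsupport hx]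

end Solution

/-! ### Truncated powers -/

/-- The derivative of `truncPow`. -/
def truncDeriv (m : ℕ) (R r : ℝ) : ℝ := m * r ^ (m - 1) * Real.smoothTransition (2 - r / R)

/-- A smooth nondecreasing function that equals `r ^ m` on `[0, R]` and is constant after `2R`. -/
def truncPow (m : ℕ) (R r : ℝ) : ℝ := ∫ s in (0 : ℝ)..r, truncDeriv m R s

section Trunc

variable {m : ℕ} {R : ℝ}

theorem contDiff_truncDeriv {n : ℕ∞} : ContDiff ℝ n (truncDeriv m R) := by
  have : ContDiff ℝ n fun r : ℝ => Real.smoothTransition (2 - r / R) :=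
    Real.smoothTransition.contDiff.comp (contDiff_const.sub (contDiff_id.div_const R))
  exact (contDiff_const.mul (contDiff_id.pow _)).mul this

theorem continuous_truncDeriv : Continuous (truncDeriv m R) := (contDiff_truncDeriv (n := 0)).continuous

theorem hasDerivAt_truncPow (r : ℝ) : HasDerivAt (truncPow m R) (truncDeriv m R r) r :=
  continuous_truncDeriv.integral_hasStrictDerivAt 0 r |>.hasDerivAt

theorem contDiff_truncPow : ContDiff ℝ 2 (truncPow m R) := by
  have h : deriv (truncPow m R) = truncDeriv m R := funext fun r => (hasDerivAt_truncPow r).deriv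
  rw [show (2 : WithTop ℕ∞) = 1 + 1 by norm_num, contDiff_succ_iff_deriv]
  refine ⟨fun r => (hasDerivAt_truncPow r).differentiableAt, fun h => by simp at h, ?_⟩
  rw [h]
  exact contDiff_truncDeriv (n := 1)

theorem truncDeriv_nonneg {r : ℝ} (hr : 0 ≤ r) : 0 ≤ truncDeriv m R r := by
  have := Real.smoothTransition.nonneg (2 - r / R)
  unfold truncDeriv
  positivity

theorem truncDeriv_le {r : ℝ} (hr : 0 ≤ r) : truncDeriv m R r ≤ m * r ^ (m - 1) :=
  mul_le_of_le_one_right (by positivity) (Real.smoothTransition.le_one _)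

theorem truncDeriv_eq_zero (hR : 0 < R) {r : ℝ} (hr : 2 * R ≤ r) : truncDeriv m R r = 0 := by
  have : 2 - r / R ≤ 0 := by rw [sub_nonpos, le_div_iff₀ hR]; exact hr
  rw [truncDeriv, Real.smoothTransition.zero_of_nonpos this, mul_zero]

/-- The term where the derivative hits the cut-off is nonpositive, since the cut-off decreases, and
is dropped. What remains has a constant independent of `R`. -/
theorem deriv_truncDeriv_mul_le (hR : 0 < R) {r : ℝ} (hr : 0 ≤ r) :
    deriv (truncDeriv m R) r * r ≤ m * truncDeriv m R r := by
  have h1 : HasDerivAt (fun r : ℝ => 2 - r / R) (-(1 / R)) r :=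
    ((hasDerivAt_id r).div_const R).const_sub 2
  have h2 : HasDerivAt Real.smoothTransition (deriv Real.smoothTransition (2 - r / R)) (2 - r / R) :=
    ((Real.smoothTransition.contDiff (n := 1)).differentiable (by norm_num) _).hasDerivAt
  have h3 := ((hasDerivAt_pow (m - 1) r).const_mul (m : ℝ)).mul (h2.comp r h1)
  have h4 : 0 ≤ deriv Real.smoothTransition (2 - r / R) := Real.smoothTransition.monotone.deriv_nonneg
  have h5 : ((m - 1 : ℕ) : ℝ) * r ^ (m - 1 - 1) * r ≤ m * r ^ (m - 1) := by
    rcases Nat.eq_zero_or_pos (m - 1) with h | h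
    · simp [h]
    · have : r ^ (m - 1) = r ^ (m - 1 - 1) * r := by
        rw [← pow_succ]
        congr 1
        omega
      rw [this, mul_assoc]
      gcongr
      omega
  have h6 := Real.smoothTransition.nonneg (2 - r / R)
  have h7 : 0 ≤ m * r ^ (m - 1) * (deriv Real.smoothTransition (2 - r / R) * (1 / R)) * r := by
    positivity
  have h8 : deriv (truncDeriv m R) r = _ := h3.deriv
  rw [h8]
  simp only [Function.comp]
  unfold truncDeriv
  have h9 : (m * (((m - 1 : ℕ) : ℝ) * r ^ (m - 1 - 1) * r)) * Real.smoothTransition (2 - r / R) ≤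
      (m * (m * r ^ (m - 1))) * Real.smoothTransition (2 - r / R) := by
    gcongr
  linarith

theorem truncPow_eq_of_ge (hR : 0 < R) {r : ℝ} (hr : 2 * R ≤ r) :
    truncPow m R r = truncPow m R (2 * R) := by
  have hi := fun a b : ℝ => (continuous_truncDeriv (m := m) (R := R)).intervalIntegrable
    (μ := volume) a b
  have h := intervalIntegral.integral_add_adjacent_intervals (hi 0 (2 * R)) (hi (2 * R) r)
  have h0 : ∫ s in (2 * R)..r, truncDeriv m R s = 0 := by
    rw [intervalIntegral.integral_congr (g := fun _ => 0), intervalIntegral.integral_zero]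
    intro s hs
    rw [uIcc_of_le hr] at hs
    exact truncDeriv_eq_zero hR hs.1
  unfold truncPow
  rw [← h, h0, add_zero]

theorem integral_natCast_mul_pow (hm : 1 ≤ m) (r : ℝ) :
    ∫ s in (0 : ℝ)..r, (m : ℝ) * s ^ (m - 1) = r ^ m := by
  obtain ⟨k, rfl⟩ : ∃ k, m = k + 1 := ⟨m - 1, by omega⟩
  rw [intervalIntegral.integral_const_mul, Nat.add_sub_cancel, integral_pow]
  push_cast
  field_simp
  simp

theorem truncPow_eq (hR : 0 < R) (hm : 1 ≤ m) {r : ℝ} (h0 : 0 ≤ r) (hr : r ≤ R) :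
    truncPow m R r = r ^ m := by
  rw [← integral_natCast_mul_pow hm r]
  refine intervalIntegral.integral_congr fun s hs => ?_
  rw [uIcc_of_le h0] at hs
  have : 1 ≤ 2 - s / R := by
    have : s / R ≤ 1 := (div_le_one hR).2 (hs.2.trans hr)
    linarith
  simp only [truncDeriv, Real.smoothTransition.one_of_one_le this, mul_one]

theorem truncPow_nonneg {r : ℝ} (h0 : 0 ≤ r) : 0 ≤ truncPow m R r :=
  intervalIntegral.integral_nonneg h0 fun _ hs => truncDeriv_nonneg hs.1

theorem truncPow_le (hm : 1 ≤ m) {r : ℝ} (h0 : 0 ≤ r) : truncPow m R r ≤ r ^ m := by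
  rw [← integral_natCast_mul_pow hm r]
  refine intervalIntegral.integral_mono_on h0 (continuous_truncDeriv.intervalIntegrable _ _)
    (Continuous.intervalIntegrable (by fun_prop) _ _) fun s hs => truncDeriv_le hs.1

theorem truncPow_le_const (hR : 0 < R) (r : ℝ) (h0 : 0 ≤ r) : truncPow m R r ≤ truncPow m R (2 * R) := by
  rcases le_total (2 * R) r with h | h
  · exact (truncPow_eq_of_ge hR h).le
  · have hi := fun a b : ℝ => (continuous_truncDeriv (m := m) (R := R)).intervalIntegrable
      (μ := volume) a b
    have h1 := intervalIntegral.integral_add_adjacent_intervals (hi 0 r) (hi r (2 * R))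
    have h2 : 0 ≤ ∫ s in r..(2 * R), truncDeriv m R s :=
      intervalIntegral.integral_nonneg h fun s hs => truncDeriv_nonneg (h0.trans hs.1)
    unfold truncPow
    linarith

/-- The truncated form of `r (r ^ m)' = m r ^ m`, which closes the Grönwall argument uniformly in
`R`. As the cut-off decreases, its value at `r` bounds from below its values on `[0, r]`, and
integration gives the claim. -/
theorem mul_truncDeriv_le (hR : 0 < R) (hm : 1 ≤ m) {r : ℝ} (h0 : 0 ≤ r) :
    r * truncDeriv m R r ≤ m * truncPow m R r := by
  have h : ∫ s in (0 : ℝ)..r, (m : ℝ) * s ^ (m - 1) * Real.smoothTransition (2 - r / R) ≤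
      truncPow m R r := by
    refine intervalIntegral.integral_mono_on h0 (Continuous.intervalIntegrable (by fun_prop) _ _)
      (continuous_truncDeriv.intervalIntegrable _ _) fun s hs => ?_
    have hs0 := hs.1
    refine mul_le_mul_of_nonneg_left (Real.smoothTransition.monotone ?_) (by positivity)
    have := hs.2
    gcongr
  rw [intervalIntegral.integral_mul_const, integral_natCast_mul_pow hm] at h
  have e : r * truncDeriv m R r = m * (r ^ m * Real.smoothTransition (2 - r / R)) := by
    have : r ^ m = r * r ^ (m - 1) := by
      rw [← pow_succ']
      congr 1
      omega
    rw [truncDeriv, this]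
    ring
  rw [e]
  gcongr

end Trunc

/-! ### Functions of the weight -/

theorem hasFDerivAt_wt (x : Space d) : HasFDerivAt (wt (d := d)) (2 • innerSL ℝ x) x := by
  have := (hasStrictFDerivAt_norm_sq x).hasFDerivAt.const_add 1
  exact this

theorem partialDeriv_comp_wt {g g' : ℝ → ℝ} (hg : ∀ r, HasDerivAt g (g' r) r) (i : Fin d) :
    partialDeriv i (fun x => g (wt x)) = fun x => g' (wt x) * (2 * x i) := by
  ext x
  have : HasFDerivAt (fun x => g (wt x)) _ x := (hg (wt x)).comp_hasFDerivAt x (hasFDerivAt_wt x)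
  rw [partialDeriv, HasFDerivAt.fderiv this]
  simp [EuclideanSpace.inner_single_right]

theorem partialDeriv_coord (i : Fin d) : partialDeriv i (fun x : Space d => 2 * x i) = fun _ => 2 := by
  ext x
  have : HasFDerivAt (fun x : Space d => 2 * x i)
      ((2:ℝ) • (EuclideanSpace.proj i : Space d →L[ℝ] ℝ)) x :=
    (EuclideanSpace.proj i : Space d →L[ℝ] ℝ).hasFDerivAt.const_mul 2
  rw [partialDeriv, this.fderiv]
  simp

theorem wt_pow_le_exp {a : ℝ} (ha : 0 < a) (m : ℕ) (x : Space d) :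
    wt x ^ m ≤ m.factorial / a ^ m * Real.exp a * Real.exp (a * ‖x‖ ^ 2) := by
  have h := Real.pow_div_factorial_le_exp (a * wt x) (mul_pos ha (wt_pos x)).le m
  have hf : (0:ℝ) < m.factorial := by exact_mod_cast m.factorial_pos
  rw [mul_assoc, ← Real.exp_add, show a + a * ‖x‖ ^ 2 = a * wt x by unfold wt; ring]
  rw [mul_pow, div_le_iff₀ hf] at h
  rw [div_mul_eq_mul_div, le_div_iff₀ (by positivity)]
  linarith

theorem integrable_of_tendsto_of_integral_le {F : ℕ → Space d → ℝ} {f : Space d → ℝ} {K : ℝ}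
    (hF : ∀ n, Integrable (F n)) (hF0 : ∀ n x, 0 ≤ F n x) (hf : Measurable f)
    (hlim : ∀ x, Tendsto (fun n => F n x) atTop (𝓝 (f x))) (hK : ∀ n, ∫ x, F n x ≤ K) :
    Integrable f ∧ ∫ x, f x ≤ K := by
  have hf0 : ∀ x, 0 ≤ f x := fun x => ge_of_tendsto' (hlim x) fun n => hF0 n x
  have hK0 : 0 ≤ K := (integral_nonneg (hF0 0)).trans (hK 0)
  have h1 : ∀ x, ENNReal.ofReal (f x) = liminf (fun n => ENNReal.ofReal (F n x)) atTop := fun x =>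
    ((ENNReal.continuous_ofReal.tendsto _).comp (hlim x)).liminf_eq.symm
  have h2 : ∫⁻ x, ENNReal.ofReal (f x) ≤ ENNReal.ofReal K := by
    simp only [h1]
    refine (lintegral_liminf_le' fun n => (hF n).1.aemeasurable.ennreal_ofReal).trans ?_
    refine liminf_le_of_frequently_le' (Frequently.of_forall fun n => ?_)
    rw [← ofReal_integral_eq_lintegral_ofReal (hF n) (Eventually.of_forall (hF0 n))]
    exact ENNReal.ofReal_le_ofReal (hK n)
  refine ⟨⟨hf.aestronglyMeasurable, ?_⟩, ?_⟩
  · rw [hasFiniteIntegral_iff_ofReal (Eventually.of_forall hf0)]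
    exact h2.trans_lt ENNReal.ofReal_lt_top
  · rw [integral_eq_lintegral_of_nonneg_ae (Eventually.of_forall hf0) hf.aestronglyMeasurable]
    exact ENNReal.toReal_le_of_le_ofReal hK0 h2

/-! ### Propagation of moments -/

section Moments

variable {V W ρ₀ : Space d → ℝ} {ρ : ℝ → Space d → ℝ} {m : ℕ} {R : ℝ}

/-- The truncated power is constant near infinity instead of compactly supported. Subtracting it
from that constant gives an admissible test function, and conservation of mass accounts for the
constant. -/
theorem IsClassicalSolution.hasDerivAt_integral_truncPow (hVW : HessianBounds V W)
    (h : IsClassicalSolution V W ρ₀ ρ) (hR : 0 < R) {t : ℝ} (ht : 0 < t) :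
    HasDerivAt (fun τ => ∫ x, ρ τ x * truncPow m R (wt x))
      (∫ x, ρ t x * ∑ i, (deriv (truncDeriv m R) (wt x) * (2 * x i) * (2 * x i) +
        truncDeriv m R (wt x) * 2 - drift V W (ρ t) i x * (truncDeriv m R (wt x) * (2 * x i)))) t := by
  set φ : Space d → ℝ := fun x => truncPow m R (2 * R) - truncPow m R (wt x) with hφ
  have hφ2 : ContDiff ℝ 2 φ := contDiff_const.sub (contDiff_truncPow.comp contDiff_wt)
  have hφc : HasCompactSupport φ := by
    refine .of_support_subset_isCompact (isCompact_closedBall (0 : Space d) (2 * R + 1)) fun x hx => ?_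
    by_contra hx'
    refine hx ?_
    have : 2 * R + 1 < ‖x‖ := by simpa using hx'
    have : 2 * R ≤ wt x := by unfold wt; nlinarith
    simp [hφ, truncPow_eq_of_ge hR this]
  have hD : ∀ r, HasDerivAt (truncDeriv m R) (deriv (truncDeriv m R) r) r := fun r =>
    ((contDiff_truncDeriv (n := 1)).differentiable (by norm_num) r).hasDerivAt
  have p1 : ∀ i, partialDeriv i φ = fun x => -truncDeriv m R (wt x) * (2 * x i) := fun i =>
    partialDeriv_comp_wt (g := fun r => truncPow m R (2 * R) - truncPow m R r)
      (g' := fun r => -truncDeriv m R r) (fun r => (hasDerivAt_truncPow r).const_sub _) i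
  have p2 : ∀ i, partialDeriv i (partialDeriv i φ) = fun x =>
      -deriv (truncDeriv m R) (wt x) * (2 * x i) * (2 * x i) + -truncDeriv m R (wt x) * 2 := by
    intro i
    have hq : ContDiff ℝ 1 fun x : Space d => -truncDeriv m R (wt x) :=
      ((contDiff_truncDeriv (n := 1)).comp contDiff_wt).neg
    rw [p1, partialDeriv_mul (hq.differentiable (by norm_num)) (by fun_prop) i,
      partialDeriv_comp_wt (g := fun r => -truncDeriv m R r)
        (g' := fun r => -deriv (truncDeriv m R) r) (fun r => (hD r).neg) i, partialDeriv_coord]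
  have e1 := h.hasDerivAt_integral_mul hφ2.continuous hφc ht
  rw [h.integral_deriv_mul hVW hφ2 hφc ht] at e1
  have e2 : ∀ τ, 0 < τ → ∫ x, ρ τ x * truncPow m R (wt x) =
      truncPow m R (2 * R) - ∫ x, ρ τ x * φ x := by
    intro τ hτ
    have hn := h.isNiceDensity hτ
    have i1 : Integrable fun x => ρ τ x * φ x :=
      (hn.continuous.mul hφ2.continuous).integrable_of_hasCompactSupport hφc.mul_left
    have : ∀ x, ρ τ x * truncPow m R (wt x) = truncPow m R (2 * R) * ρ τ x - ρ τ x * φ x := by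
      intro x
      simp only [hφ]
      ring
    simp only [this]
    rw [integral_sub (hn.integrable.const_mul _) i1, integral_const_mul, hn.integral_eq, mul_one]
  have e3 := (e1.const_sub (truncPow m R (2 * R))).congr_of_eventuallyEq
    (f₁ := fun τ => ∫ x, ρ τ x * truncPow m R (wt x))
    (by filter_upwards [Ioi_mem_nhds ht] with τ hτ using e2 τ hτ)
  refine e3.congr_deriv ?_
  rw [← integral_neg]
  refine integral_congr_ae (Eventually.of_forall fun x => ?_)
  simp only [p2]; simp only [p1]
  rw [← mul_neg, ← Finset.sum_neg_distrib]
  refine congrArg _ (Finset.sum_congr rfl fun i _ => ?_)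
  ring

/-- With `g = truncPow m R`, the integrand is `4 g'' |x|² + 2 d g' - 2 g' x · b` evaluated at `wt
x`. The first term is at most `4 m g'` by `deriv_truncDeriv_mul_le` and the last is controlled by
dissipativity, whence `A = 4 m + 2 d + 2 C`, independent of `R` and of the solution. -/
theorem exists_moment_deriv_le (hVW : HessianBounds V W) (m : ℕ) : ∃ A : ℝ, 0 ≤ A ∧
    ∀ (ρ₀ : Space d → ℝ) (ρ : ℝ → Space d → ℝ), IsClassicalSolution V W ρ₀ ρ →
    ∀ R, 0 < R → ∀ t, 0 < t → ∃ D : ℝ,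
      HasDerivAt (fun τ => ∫ x, ρ τ x * truncPow m R (wt x)) D t ∧
      D ≤ A * ∫ x, ρ t x * (truncDeriv m R (wt x) * (wt x + ∫ y, wt y ^ 1 * ρ t y)) := by
  obtain ⟨C, hC, hdr⟩ := exists_drift_inner_ge hVW
  refine ⟨4 * m + 2 * d + 2 * C, by positivity, fun ρ₀ ρ h R hR t ht =>
    ⟨_, h.hasDerivAt_integral_truncPow hVW hR ht, ?_⟩⟩
  have hn := h.isNiceDensity ht
  set S := ∫ y, wt y ^ 1 * ρ t y with hSdef
  have hS : 1 ≤ S := hn.one_le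
  have hb : ∀ i, Continuous (drift V W (ρ t) i) := fun i =>
    (locBoundedDeriv_drift hVW hn i).1.continuous
  have hq : Continuous fun x : Space d => truncDeriv m R (wt x) :=
    continuous_truncDeriv.comp continuous_wt
  have hdq : Continuous fun x : Space d => deriv (truncDeriv m R) (wt x) :=
    ((contDiff_truncDeriv (n := 1)).continuous_deriv (by norm_num)).comp continuous_wt
  have hz : ∀ x : Space d, 2 * R < wt x → truncDeriv m R (wt x) = 0 ∧
      deriv (truncDeriv m R) (wt x) = 0 := by
    intro x hx
    refine ⟨truncDeriv_eq_zero hR hx.le, ?_⟩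
    refine HasDerivAt.deriv ((hasDerivAt_const _ (0:ℝ)).congr_of_eventuallyEq ?_)
    filter_upwards [Ioi_mem_nhds hx] with r hr using truncDeriv_eq_zero hR (le_of_lt hr)
  have hcs : ∀ f : Space d → ℝ, (∀ x, 2 * R < wt x → f x = 0) → HasCompactSupport f := by
    intro f hf
    refine .of_support_subset_isCompact (isCompact_closedBall (0 : Space d) (2 * R + 1)) fun x hx => ?_
    by_contra hx'
    refine hx (hf x ?_)
    have : 2 * R + 1 < ‖x‖ := by simpa using hx'
    unfold wt; nlinarith
  rw [← integral_const_mul]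
  refine integral_mono ?_ ?_ fun x => ?_
  · refine Continuous.integrable_of_hasCompactSupport ?_ (hcs _ fun x hx => ?_)
    · refine hn.continuous.mul (continuous_finsetSum _ fun i _ => ?_)
      have := hb i
      fun_prop
    · simp [(hz x hx).1, (hz x hx).2]
  · refine (Continuous.integrable_of_hasCompactSupport ?_ (hcs _ fun x hx => ?_)).const_mul _
    · have := continuous_wt (d := d)
      have := hn.continuous
      fun_prop
    · simp [(hz x hx).1]
  · have f1 := hdr (ρ t) hn x
    have f2 : 0 ≤ truncDeriv m R (wt x) := truncDeriv_nonneg (wt_pos x).le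
    have f3 := deriv_truncDeriv_mul_le (m := m) hR (wt_pos x).le
    have f4 := hn.nonneg x
    have f5 := one_le_wt x
    have hx2 : ∑ i, x i ^ 2 = ‖x‖ ^ 2 := by
      rw [EuclideanSpace.norm_sq_eq]
      simp
    have f6 : deriv (truncDeriv m R) (wt x) * ‖x‖ ^ 2 ≤ m * truncDeriv m R (wt x) := by
      rcases le_total (deriv (truncDeriv m R) (wt x)) 0 with hneg | hpos
      · exact (mul_nonpos_of_nonpos_of_nonneg hneg (sq_nonneg _)).trans (by positivity)
      · refine le_trans ?_ f3
        refine mul_le_mul_of_nonneg_left ?_ hpos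
        unfold wt; linarith
    have hsum : ∑ i, (deriv (truncDeriv m R) (wt x) * (2 * x i) * (2 * x i) +
        truncDeriv m R (wt x) * 2 - drift V W (ρ t) i x * (truncDeriv m R (wt x) * (2 * x i))) =
        4 * (deriv (truncDeriv m R) (wt x) * ‖x‖ ^ 2) + 2 * d * truncDeriv m R (wt x) -
          2 * truncDeriv m R (wt x) * ∑ i, drift V W (ρ t) i x * x i := by
      rw [← hx2, Finset.mul_sum, Finset.mul_sum, Finset.mul_sum, Finset.sum_sub_distrib,
        Finset.sum_add_distrib]
      simp only [Finset.sum_const, Finset.card_univ, Fintype.card_fin, nsmul_eq_mul]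
      congr 1
      · congr 1
        · exact Finset.sum_congr rfl fun i _ => by ring
        · ring
      · exact Finset.sum_congr rfl fun i _ => by ring
    change ρ t x * _ ≤ _
    rw [hsum]
    refine le_of_le_of_eq (mul_le_mul_of_nonneg_left (c := (4 * m + 2 * d + 2 * C) *
      (truncDeriv m R (wt x) * (wt x + S))) ?_ f4) (mul_left_comm _ _ _)
    generalize truncDeriv m R (wt x) = q at *
    generalize ∑ i, drift V W (ρ t) i x * x i = b at *
    generalize deriv (truncDeriv m R) (wt x) * ‖x‖ ^ 2 = p at *
    have g1 : q * (-(C * (wt x + S))) ≤ q * b := mul_le_mul_of_nonneg_left f1 f2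
    have g2 : q ≤ q * (wt x + S) := le_mul_of_one_le_right f2 (by linarith)
    have g3 : (4 * m + 2 * d) * q ≤ (4 * m + 2 * d) * (q * (wt x + S)) := by gcongr
    nlinarith

end Moments

/-- The left endpoint enters through a limit only, because the initial datum is attained merely in
the narrow sense. -/
theorem le_of_hasDerivAt_nonpos_of_tendsto {y D : ℝ → ℝ} {τ T l : ℝ} (hT : τ < T)
    (hy : ∀ t ∈ Ioc τ T, HasDerivAt y (D t) t) (hD : ∀ t ∈ Ioc τ T, D t ≤ 0)
    (hl : Tendsto y (𝓝[>] τ) (𝓝 l)) : y T ≤ l := by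
  have hanti : AntitoneOn y (Ioc τ T) := by
    refine antitoneOn_of_deriv_nonpos (convex_Ioc τ T)
      (fun t ht => (hy t ht).continuousAt.continuousWithinAt) (fun t ht => ?_) (fun t ht => ?_)
    · rw [interior_Ioc] at ht
      exact (hy t ⟨ht.1, ht.2.le⟩).differentiableAt.differentiableWithinAt
    · rw [interior_Ioc] at ht
      rw [(hy t ⟨ht.1, ht.2.le⟩).deriv]
      exact hD t ⟨ht.1, ht.2.le⟩
  refine ge_of_tendsto hl ?_
  filter_upwards [Ioc_mem_nhdsGT hT] with t ht using hanti ht ⟨hT, le_rfl⟩ ht.2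

/-- The solutions that the main theorem is about. -/
def Admissible (V W : Space d → ℝ) (a E : ℝ) (ρ : ℝ → Space d → ℝ) : Prop :=
  ∃ ρ₀ : Space d → ℝ, IsProbDensity ρ₀ ∧ (Integrable fun x => Real.exp (a * ‖x‖ ^ 2) * ρ₀ x) ∧
    ∫ x, Real.exp (a * ‖x‖ ^ 2) * ρ₀ x ≤ E ∧ IsClassicalSolution V W ρ₀ ρ

section Moments

variable {V W ρ₀ : Space d → ℝ} {ρ : ℝ → Space d → ℝ}

theorem exists_initial_moment_le {a : ℝ} (ha : 0 < a) (E : ℝ) (m : ℕ) : ∃ M : ℝ, 0 ≤ M ∧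
    ∀ ρ₀ : Space d → ℝ, IsProbDensity ρ₀ → (Integrable fun x => Real.exp (a * ‖x‖ ^ 2) * ρ₀ x) →
      ∫ x, Real.exp (a * ‖x‖ ^ 2) * ρ₀ x ≤ E →
      (Integrable fun x => wt x ^ m * ρ₀ x) ∧ ∫ x, wt x ^ m * ρ₀ x ≤ M := by
  set A : ℝ := m.factorial / a ^ m * Real.exp a with hA
  have hA0 : 0 ≤ A := by positivity
  refine ⟨A * |E|, by positivity, fun ρ₀ h0 hi hE => ?_⟩
  have hle : ∀ᵐ x, wt x ^ m * ρ₀ x ≤ A * (Real.exp (a * ‖x‖ ^ 2) * ρ₀ x) := by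
    filter_upwards [h0.1] with x hx
    rw [← mul_assoc]
    exact mul_le_mul_of_nonneg_right (wt_pow_le_exp ha m x) hx
  have hint : Integrable fun x => wt x ^ m * ρ₀ x := by
    refine (hi.const_mul A).mono' ?_ ?_
    · exact ((continuous_wt.pow m).aestronglyMeasurable).mul h0.2.1.1
    · filter_upwards [hle, h0.1] with x hx hx0
      rwa [Real.norm_eq_abs, abs_of_nonneg (mul_nonneg (pow_nonneg (wt_pos x).le m) hx0)]
  refine ⟨hint, (integral_mono_ae hint (hi.const_mul A) hle).trans ?_⟩
  rw [integral_const_mul]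
  exact mul_le_mul_of_nonneg_left (hE.trans (le_abs_self E)) hA0

theorem IsClassicalSolution.tendsto_integral_truncPow (h : IsClassicalSolution V W ρ₀ ρ) (m : ℕ)
    {R : ℝ} (hR : 0 < R) :
    Tendsto (fun t => ∫ x, ρ t x * truncPow m R (wt x)) (𝓝[>] 0)
      (𝓝 (∫ x, truncPow m R (wt x) * ρ₀ x)) := by
  have := h.initial (BoundedContinuousFunction.ofNormedAddCommGroup
    (fun x : Space d => truncPow m R (wt x)) (contDiff_truncPow.continuous.comp continuous_wt)
    (truncPow m R (2 * R)) fun x => by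
      rw [Real.norm_eq_abs, abs_of_nonneg (truncPow_nonneg (wt_pos x).le)]
      exact truncPow_le_const hR _ (wt_pos x).le)
  simpa [mul_comm] using this

theorem integral_truncPow_le {m : ℕ} (hm : 1 ≤ m) (R : ℝ) (h0 : IsProbDensity ρ₀)
    (hi : Integrable fun x => wt x ^ m * ρ₀ x) :
    ∫ x, truncPow m R (wt x) * ρ₀ x ≤ ∫ x, wt x ^ m * ρ₀ x := by
  have hle : ∀ᵐ x, truncPow m R (wt x) * ρ₀ x ≤ wt x ^ m * ρ₀ x := by
    filter_upwards [h0.1] with x hx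
    exact mul_le_mul_of_nonneg_right (truncPow_le hm (wt_pos x).le) hx
  refine integral_mono_ae (hi.mono' ?_ ?_) hi hle
  · exact (contDiff_truncPow.continuous.comp continuous_wt).aestronglyMeasurable.mul h0.2.1.1
  · filter_upwards [hle, h0.1] with x hx hx0
    rwa [Real.norm_eq_abs, abs_of_nonneg (mul_nonneg (truncPow_nonneg (wt_pos x).le) hx0)]

theorem integrable_truncPow {r : Space d → ℝ} (hr : IsNiceDensity r) (m : ℕ) {R : ℝ} (hR : 0 < R) :
    Integrable fun x => r x * truncPow m R (wt x) := by
  refine (hr.integrable.mul_const (truncPow m R (2 * R))).mono' (hr.continuous.mul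
    (contDiff_truncPow.continuous.comp continuous_wt)).aestronglyMeasurable
    (Eventually.of_forall fun x => ?_)
  rw [Real.norm_eq_abs, abs_of_nonneg (mul_nonneg (hr.nonneg x) (truncPow_nonneg (wt_pos x).le))]
  exact mul_le_mul_of_nonneg_left (truncPow_le_const hR _ (wt_pos x).le) (hr.nonneg x)

theorem moment_le_of_truncPow {r : Space d → ℝ} (hr : IsNiceDensity r) {m : ℕ} (hm : 1 ≤ m) {K : ℝ}
    (hK : ∀ R, 0 < R → ∫ x, r x * truncPow m R (wt x) ≤ K) :
    (Integrable fun x => wt x ^ m * r x) ∧ ∫ x, wt x ^ m * r x ≤ K := by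
  refine integrable_of_tendsto_of_integral_le
    (F := fun n x => r x * truncPow m ((n : ℝ) + 1) (wt x))
    (fun n => integrable_truncPow hr m (by positivity))
    (fun n x => mul_nonneg (hr.nonneg x) (truncPow_nonneg (wt_pos x).le))
    ((continuous_wt.pow m).mul hr.continuous).measurable (fun x => ?_)
    (fun n => hK _ (by positivity))
  refine tendsto_const_nhds.congr' ?_
  obtain ⟨N, hN⟩ := exists_nat_ge (wt x)
  filter_upwards [eventually_ge_atTop N] with n hn
  have : wt x ≤ (n : ℝ) + 1 := by
    have : (N : ℝ) ≤ n := by exact_mod_cast hn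
    linarith
  rw [truncPow_eq (by positivity) hm (wt_pos x).le this, mul_comm]

theorem integrable_mul_truncDeriv {r : Space d → ℝ} (hr : IsNiceDensity r) (m : ℕ) {R : ℝ}
    (hR : 0 < R) (S : ℝ) :
    Integrable fun x => r x * (truncDeriv m R (wt x) * (wt x + S)) := by
  refine Continuous.integrable_of_hasCompactSupport ?_ ?_
  · have := continuous_wt (d := d)
    have := hr.continuous
    have := (continuous_truncDeriv (m := m) (R := R)).comp (continuous_wt (d := d))
    fun_prop
  · refine .of_support_subset_isCompact (isCompact_closedBall (0 : Space d) (2 * R + 1)) fun x hx => ?_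
    by_contra hx'
    have : 2 * R + 1 < ‖x‖ := by simpa using hx'
    have : 2 * R ≤ wt x := by unfold wt; nlinarith
    exact hx (by simp [truncDeriv_eq_zero hR this])

/-- The derivative of the truncated moment is bounded by the untruncated one, so Grönwall does not
apply directly. Instead let `B` be the supremum of `exp (-l t) J t`, finite by the second-moment
condition on solutions. Integrating the inequality and removing the truncation gives `B ≤ M₀ + B /
2`, hence a bound free of that qualitative information. -/
theorem exists_second_moment_le (hVW : HessianBounds V W) {a : ℝ} (ha : 0 < a) (E T : ℝ) :
    ∃ M : ℝ, 0 ≤ M ∧ ∀ ρ, Admissible V W a E ρ → ∀ t ∈ Ioc 0 T, ∫ x, wt x ^ 1 * ρ t x ≤ M := by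
  obtain ⟨A, hA, hder⟩ := exists_moment_deriv_le hVW 1
  obtain ⟨M₀, hM₀, hinit⟩ := exists_initial_moment_le (d := d) ha E 1
  -- The derivative is at most `2 A J ≤ 2 A B exp (l t)`; taking `l ≥ 4 A` makes this at most the
  -- derivative of `(B / 2) exp (l t)`.
  set l := 4 * A + 1 with hl
  have hl0 : 0 < l := by positivity
  refine ⟨2 * M₀ * Real.exp (l * |T|), by positivity, fun ρ hρ t₁ ht₁ => ?_⟩
  obtain ⟨ρ₀, h0, hi, hE, h⟩ := hρ
  obtain ⟨hi1, hM1⟩ := hinit ρ₀ h0 hi hE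
  have hT : 0 < T := ht₁.1.trans_le ht₁.2
  obtain ⟨M, hM⟩ := h.secondMoment T hT
  set J : ℝ → ℝ := fun t => ∫ x, wt x ^ 1 * ρ t x with hJ
  have hJ1 : ∀ t ∈ Ioc 0 T, 1 ≤ J t := fun t ht => (h.isNiceDensity ht.1).one_le
  have hJM : ∀ t ∈ Ioc 0 T, J t ≤ 1 + M := by
    intro t ht
    have hn := h.isNiceDensity ht.1
    have : J t = 1 + ∫ x, ‖x‖ ^ 2 * ρ t x := by
      rw [← hn.integral_eq, ← integral_add hn.integrable (hM t ht).1]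
      refine integral_congr_ae (Eventually.of_forall fun x => ?_)
      simp [wt, add_mul]
    rw [this]
    linarith [(hM t ht).2]
  set Z : Set ℝ := (fun t => Real.exp (-(l * t)) * J t) '' Ioc 0 T with hZ
  have hZb : BddAbove Z := by
    refine ⟨1 + M, ?_⟩
    rintro _ ⟨t, ht, rfl⟩
    have e1 : Real.exp (-(l * t)) ≤ 1 := Real.exp_le_one_iff.2 (by have := ht.1; nlinarith)
    have e2 := hJ1 t ht
    exact (mul_le_of_le_one_left (by linarith) e1).trans (hJM t ht)
  set B := sSup Z with hB
  have hBJ : ∀ t ∈ Ioc 0 T, J t ≤ B * Real.exp (l * t) := by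
    intro t ht
    have : Real.exp (-(l * t)) * J t ≤ B := le_csSup hZb ⟨t, ht, rfl⟩
    rw [Real.exp_neg, inv_mul_le_iff₀ (Real.exp_pos _)] at this
    linarith
  have hB0 : 0 ≤ B := by
    have := hBJ t₁ ht₁
    have := hJ1 t₁ ht₁
    by_contra hneg
    nlinarith [Real.exp_pos (l * t₁)]
  have hJle : ∀ t ∈ Ioc 0 T, J t ≤ M₀ + B / 2 * Real.exp (l * t) := by
    intro t ht
    have hn := h.isNiceDensity ht.1
    refine (moment_le_of_truncPow hn le_rfl fun R hR => ?_).2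
    choose! D hD1 hD2 using hder ρ₀ ρ h R hR
    have key : (∫ x, ρ t x * truncPow 1 R (wt x)) - B / 2 * Real.exp (l * t) ≤
        (∫ x, truncPow 1 R (wt x) * ρ₀ x) - B / 2 * Real.exp (l * 0) := by
      refine le_of_hasDerivAt_nonpos_of_tendsto (τ := 0)
        (y := fun t => (∫ x, ρ t x * truncPow 1 R (wt x)) - B / 2 * Real.exp (l * t))
        (D := fun t => D t - B / 2 * (Real.exp (l * t) * (l * 1))) ht.1 ?_ ?_ ?_
      · exact fun σ hσ => (hD1 σ hσ.1).sub
          (((hasDerivAt_id σ).const_mul l).exp.const_mul (B / 2))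
      · intro σ hσ
        have hσT : σ ∈ Ioc 0 T := ⟨hσ.1, hσ.2.trans ht.2⟩
        have hnσ := h.isNiceDensity hσ.1
        have e1 := hD2 σ hσ.1
        have e2 : ∫ x, ρ σ x * (truncDeriv 1 R (wt x) * (wt x + J σ)) ≤ 2 * J σ := by
          have i2 : Integrable fun x => wt x ^ 1 * ρ σ x + J σ * ρ σ x :=
            hnσ.integrable_wt.add (hnσ.integrable.const_mul _)
          have : ∫ x, wt x ^ 1 * ρ σ x + J σ * ρ σ x = 2 * J σ := by
            rw [integral_add hnσ.integrable_wt (hnσ.integrable.const_mul _), integral_const_mul,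
              hnσ.integral_eq]
            ring
          rw [← this]
          refine integral_mono (integrable_mul_truncDeriv hnσ 1 hR _) i2 fun x => ?_
          have f1 : truncDeriv 1 R (wt x) ≤ 1 := by
            simpa using truncDeriv_le (m := 1) (R := R) (wt_pos x).le
          have f2 : 0 ≤ wt x + J σ := by have := wt_pos x; have := hJ1 σ hσT; linarith
          have f3 := hnσ.nonneg x
          calc ρ σ x * (truncDeriv 1 R (wt x) * (wt x + J σ)) ≤ ρ σ x * (wt x + J σ) :=
                mul_le_mul_of_nonneg_left (mul_le_of_le_one_left f2 f1) f3
            _ = _ := by ring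
        have e3 := hBJ σ hσT
        have e4 : A * (2 * J σ) ≤ A * (2 * (B * Real.exp (l * σ))) := by gcongr
        have e5 := mul_le_mul_of_nonneg_left e2 hA
        have e6 : 0 ≤ B * Real.exp (l * σ) := by positivity
        have e7 : A * (2 * (B * Real.exp (l * σ))) ≤ B / 2 * (Real.exp (l * σ) * (l * 1)) := by
          rw [hl]; nlinarith
        change D σ - _ ≤ 0
        linarith
      · refine (h.tendsto_integral_truncPow 1 hR).sub ?_
        have : Continuous fun t => B / 2 * Real.exp (l * t) := by fun_prop
        exact (this.tendsto 0).mono_left nhdsWithin_le_nhds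
    have e1 := integral_truncPow_le le_rfl R h0 hi1
    have e2 : 0 ≤ B / 2 * Real.exp (l * 0) := by positivity
    linarith
  have hB2 : B ≤ M₀ + B / 2 := by
    refine csSup_le ⟨_, t₁, ht₁, rfl⟩ ?_
    rintro _ ⟨t, ht, rfl⟩
    have e1 := hJle t ht
    have e2 : 1 ≤ Real.exp (l * t) := Real.one_le_exp (by have := ht.1; positivity)
    change Real.exp (-(l * t)) * J t ≤ _
    rw [Real.exp_neg, inv_mul_le_iff₀ (Real.exp_pos _)]
    nlinarith
  refine (hBJ t₁ ht₁).trans ?_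
  have : Real.exp (l * t₁) ≤ Real.exp (l * |T|) := by
    have := ht₁.2.trans (le_abs_self T)
    gcongr
  have : B ≤ 2 * M₀ := by linarith
  gcongr

/-- Once the second moment is bounded by `S`, the inequality is linear: `wt x + J ≤ (1 + S) wt x`,
and `mul_truncDeriv_le` returns the truncated moment itself. Grönwall then has rate `A (1 + S) m`,
uniformly in `R`. -/
theorem exists_moment_le (hVW : HessianBounds V W) {a : ℝ} (ha : 0 < a) (E T : ℝ) (m : ℕ) :
    ∃ M : ℝ, 0 ≤ M ∧ ∀ ρ, Admissible V W a E ρ → ∀ t ∈ Ioc 0 T,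
      (Integrable fun x => wt x ^ m * ρ t x) ∧ ∫ x, wt x ^ m * ρ t x ≤ M := by
  -- `truncPow 0 R` is identically zero rather than one, so exponent zero is treated apart; there
  -- the claim is conservation of mass.
  wlog hm : 1 ≤ m generalizing m
  · obtain rfl : m = 0 := by omega
    refine ⟨1, zero_le_one, fun ρ hρ t ht => ?_⟩
    obtain ⟨ρ₀, -, -, -, h⟩ := hρ
    have hn := h.isNiceDensity ht.1
    simpa using ⟨hn.integrable, hn.integral_eq.le⟩
  obtain ⟨A, hA, hder⟩ := exists_moment_deriv_le hVW m
  obtain ⟨M₀, hM₀, hinit⟩ := exists_initial_moment_le (d := d) ha E m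
  obtain ⟨S, hS, hsec⟩ := exists_second_moment_le hVW ha E T
  set l := A * (1 + S) * m with hl
  have hl0 : 0 ≤ l := by positivity
  refine ⟨Real.exp (l * |T|) * M₀, by positivity, fun ρ hρ t ht => ?_⟩
  have hsecρ := hsec ρ hρ
  obtain ⟨ρ₀, h0, hi, hE, h⟩ := hρ
  obtain ⟨hi1, hM1⟩ := hinit ρ₀ h0 hi hE
  have hn := h.isNiceDensity ht.1
  refine moment_le_of_truncPow hn hm fun R hR => ?_
  choose! D hD1 hD2 using hder ρ₀ ρ h R hR
  have key : Real.exp (-l * t) * (∫ x, ρ t x * truncPow m R (wt x)) ≤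
      Real.exp (-l * 0) * (∫ x, truncPow m R (wt x) * ρ₀ x) := by
    refine le_of_hasDerivAt_nonpos_of_tendsto (τ := 0)
      (y := fun t => Real.exp (-l * t) * (∫ x, ρ t x * truncPow m R (wt x)))
      (D := fun t => Real.exp (-l * t) * (-l * 1) * (∫ x, ρ t x * truncPow m R (wt x)) +
        Real.exp (-l * t) * D t) ht.1 ?_ ?_ ?_
    · exact fun σ hσ => (((hasDerivAt_id σ).const_mul (-l)).exp).mul (hD1 σ hσ.1)
    · intro σ hσ
      have hσT : σ ∈ Ioc 0 T := ⟨hσ.1, hσ.2.trans ht.2⟩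
      have hnσ := h.isNiceDensity hσ.1
      have e1 := hD2 σ hσ.1
      set J := ∫ y, wt y ^ 1 * ρ σ y with hJ
      have hJS : J ≤ S := hsecρ σ hσT
      have e2 : ∫ x, ρ σ x * (truncDeriv m R (wt x) * (wt x + J)) ≤
          (1 + S) * m * ∫ x, ρ σ x * truncPow m R (wt x) := by
        rw [← integral_const_mul]
        refine integral_mono (integrable_mul_truncDeriv hnσ m hR _)
          ((integrable_truncPow hnσ m hR).const_mul _) fun x => ?_
        have f1 := one_le_wt x
        have f2 : wt x + J ≤ (1 + S) * wt x := by nlinarith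
        have f3 := truncDeriv_nonneg (m := m) (R := R) (wt_pos x).le
        have f4 := mul_truncDeriv_le hR hm (wt_pos x).le
        have f5 := hnσ.nonneg x
        calc ρ σ x * (truncDeriv m R (wt x) * (wt x + J))
            ≤ ρ σ x * (truncDeriv m R (wt x) * ((1 + S) * wt x)) := by gcongr
          _ = ρ σ x * (1 + S) * (wt x * truncDeriv m R (wt x)) := by ring
          _ ≤ ρ σ x * (1 + S) * (m * truncPow m R (wt x)) := by gcongr
          _ = _ := by ring
      have e3 := mul_le_mul_of_nonneg_left e2 hA
      have e4 : D σ ≤ l * ∫ x, ρ σ x * truncPow m R (wt x) := by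
        rw [hl]; linarith
      have e5 := mul_le_mul_of_nonneg_left e4 (Real.exp_pos (-l * σ)).le
      change Real.exp (-l * σ) * (-l * 1) * _ + _ ≤ 0
      linarith
    · refine Tendsto.mul ?_ (h.tendsto_integral_truncPow m hR)
      have : Continuous fun t => Real.exp (-l * t) := by fun_prop
      exact (this.tendsto 0).mono_left nhdsWithin_le_nhds
  have e1 := integral_truncPow_le hm R h0 hi1
  rw [mul_zero, Real.exp_zero, one_mul, neg_mul, Real.exp_neg,
    inv_mul_le_iff₀ (Real.exp_pos _)] at key
  have e2 : Real.exp (l * t) ≤ Real.exp (l * |T|) := by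
    have := ht.2.trans (le_abs_self T)
    gcongr
  calc _ ≤ Real.exp (l * t) * M₀ := key.trans (by gcongr; linarith)
    _ ≤ _ := by gcongr

end Moments


/-! ### A Nash type inequality -/

/-- The Sobolev inequality for `W^{1,1}` applied to `v(x)² χ(z)` on `ℝ^d × ℝ²`, with `χ` a bump
function. The two extra variables bring the dimension to at least two for every `d`, including `0`,
and give the exponent `(d + 2) / (d + 1)`; the gradient of `χ` accounts for the term `|v|²` on the
right. -/
theorem exists_lintegral_sq_rpow_le (d : ℕ) : ∃ C : ℝ≥0, ∀ v : Space d → ℝ, ContDiff ℝ 1 v →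
    HasCompactSupport v →
    ∫⁻ x, (‖v x‖ₑ ^ 2) ^ (((d + 2 : ℕ) : ℝ) / ((d + 1 : ℕ) : ℝ)) ≤
      C * (∫⁻ x, ‖v x‖ₑ * (‖fderiv ℝ v x‖ₑ + ‖v x‖ₑ)) ^ (((d + 2 : ℕ) : ℝ) / ((d + 1 : ℕ) : ℝ)) := by
  set p : ℝ := ((d + 2 : ℕ) : ℝ) / ((d + 1 : ℕ) : ℝ) with hp
  have hp0 : 0 < p := by positivity
  let χ : ContDiffBump (0 : (Space 2)) := ⟨1, 2, one_pos, one_lt_two⟩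
  let μ : Measure (Space d × (Space 2)) := (volume : Measure (Space d)).prod (volume : Measure (Space 2))
  have : μ.IsAddHaarMeasure := Measure.prod.instIsAddHaarMeasure _ _
  have hχc : ContDiff ℝ 1 χ := χ.contDiff
  have hχs : HasCompactSupport χ := χ.hasCompactSupport
  have hconj : ((Module.finrank ℝ (Space d × (Space 2)) : ℕ) : ℝ).HolderConjugate p := by
    have : Module.finrank ℝ (Space d × (Space 2)) = d + 2 := by simp
    rw [this, Real.holderConjugate_iff]
    refine ⟨by push_cast; linarith [(Nat.cast_nonneg d : (0:ℝ) ≤ d)], ?_⟩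
    rw [hp]
    push_cast
    field_simp
    ring
  set c₁ : ℝ≥0∞ := ∫⁻ z : (Space 2), ‖χ z‖ₑ ^ p with hc₁
  set c₂ : ℝ≥0∞ := ∫⁻ z : (Space 2), (‖χ z‖ₑ + ‖fderiv ℝ χ z‖ₑ) with hc₂
  -- The constant is divided by `c₁` at the end; it is positive because `χ = 1` on the unit ball.
  have hc₁0 : c₁ ≠ 0 := by
    have : volume (Metric.closedBall (0 : (Space 2)) 1) ≤ c₁ := by
      rw [← setLIntegral_one]
      refine le_trans (lintegral_mono_ae ?_) (setLIntegral_le_lintegral (Metric.closedBall (0 : (Space 2)) 1) _)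
      filter_upwards [ae_restrict_mem Metric.isClosed_closedBall.measurableSet] with z hz
      rw [χ.one_of_mem_closedBall hz]
      simp
    intro h0
    rw [h0] at this
    exact (Metric.measure_closedBall_pos volume (0 : (Space 2)) one_pos).not_ge this
  have hc₁t : c₁ ≠ ⊤ := by
    have hle : c₁ ≤ ∫⁻ z : (Space 2), ‖χ z‖ₑ := by
      refine lintegral_mono fun z => ?_
      have h1 : ‖χ z‖ₑ ≤ 1 := by
        rw [Real.enorm_eq_ofReal χ.nonneg]
        exact ENNReal.ofReal_le_one.2 χ.le_one
      calc ‖χ z‖ₑ ^ p ≤ ‖χ z‖ₑ ^ (1 : ℝ) := ENNReal.rpow_le_rpow_of_exponent_ge h1 (by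
            rw [hp, le_div_iff₀ (by positivity)]; push_cast; linarith)
        _ = _ := ENNReal.rpow_one _
    exact (hle.trans_lt (χ.continuous.integrable_of_hasCompactSupport hχs).2).ne
  have hc₂t : c₂ ≠ ⊤ := by
    rw [hc₂, lintegral_add_left χ.continuous.enorm.measurable]
    exact ENNReal.add_ne_top.2 ⟨(χ.continuous.integrable_of_hasCompactSupport hχs).2.ne,
      ((hχc.continuous_fderiv (by norm_num)).integrable_of_hasCompactSupport (hχs.fderiv ℝ)).2.ne⟩
  set C₀ : ℝ≥0 := lintegralPowLePowLIntegralFDerivConst μ p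
  set K : ℝ≥0∞ := C₀ * (2 * c₂) ^ p / c₁ with hK
  have hKt : K ≠ ⊤ := by
    refine ENNReal.div_ne_top (ENNReal.mul_ne_top ENNReal.coe_ne_top
      (ENNReal.rpow_ne_top_of_nonneg hp0.le (ENNReal.mul_ne_top (by norm_num) hc₂t))) hc₁0
  refine ⟨K.toNNReal, fun v hv hvc => ?_⟩
  rw [ENNReal.coe_toNNReal hKt]
  set Z := ∫⁻ x, ‖v x‖ₑ * (‖fderiv ℝ v x‖ₑ + ‖v x‖ₑ) with hZ
  have hv2 : ContDiff ℝ 1 fun x => v x ^ 2 := hv.pow 2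
  let u : Space d × (Space 2) → ℝ := fun q => v q.1 ^ 2 * χ q.2
  have hu : ContDiff ℝ 1 u := (hv2.comp contDiff_fst).mul (hχc.comp contDiff_snd)
  have huc : HasCompactSupport u := by
    refine .of_support_subset_isCompact (hvc.prod hχs) fun q hq => ?_
    refine ⟨subset_tsupport _ fun h => hq ?_, subset_tsupport _ fun h => hq ?_⟩
    · simp [u, h]
    · simp [u, h]
  have main := lintegral_pow_le_pow_lintegral_fderiv μ hu huc hconj
  have lhs : ∫⁻ q, ‖u q‖ₑ ^ p ∂μ = (∫⁻ x, (‖v x‖ₑ ^ 2) ^ p) * c₁ := by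
    rw [hc₁, ← lintegral_prod_mul]
    · refine lintegral_congr fun q => ?_
      simp only [u]
      rw [enorm_mul, ENNReal.mul_rpow_of_nonneg _ _ hp0.le, enorm_pow]
    · exact ((hv.continuous.enorm.measurable.pow_const 2).pow_const p).aemeasurable
    · exact (χ.continuous.enorm.measurable.pow_const p).aemeasurable
  have rhs : ∫⁻ q, ‖fderiv ℝ u q‖ₑ ∂μ ≤ 2 * c₂ * Z := by
    have hpt : ∀ q, ‖fderiv ℝ u q‖ₑ ≤
        (2 * (‖v q.1‖ₑ * (‖fderiv ℝ v q.1‖ₑ + ‖v q.1‖ₑ))) * (‖χ q.2‖ₑ + ‖fderiv ℝ χ q.2‖ₑ) := by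
      intro q
      have h1 : HasFDerivAt (fun q : Space d × (Space 2) => v q.1)
          ((fderiv ℝ v q.1).comp (ContinuousLinearMap.fst ℝ (Space d) (Space 2))) q :=
        ((hv.differentiable (by norm_num) q.1).hasFDerivAt).comp q hasFDerivAt_fst
      have h2 : HasFDerivAt (fun q : Space d × (Space 2) => χ q.2)
          ((fderiv ℝ χ q.2).comp (ContinuousLinearMap.snd ℝ (Space d) (Space 2))) q :=
        ((hχc.differentiable (by norm_num) q.2).hasFDerivAt).comp q hasFDerivAt_snd
      have h3 := (h1.pow 2).mul h2
      have h4 : fderiv ℝ u q = _ := h3.fderiv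
      have n1 : ‖(fderiv ℝ v q.1).comp (ContinuousLinearMap.fst ℝ (Space d) (Space 2))‖ ≤ ‖fderiv ℝ v q.1‖ :=
        (ContinuousLinearMap.opNorm_comp_le _ _).trans
          (mul_le_of_le_one_right (norm_nonneg _) (ContinuousLinearMap.norm_fst_le _ _ _))
      have n2 : ‖(fderiv ℝ χ q.2).comp (ContinuousLinearMap.snd ℝ (Space d) (Space 2))‖ ≤ ‖fderiv ℝ χ q.2‖ :=
        (ContinuousLinearMap.opNorm_comp_le _ _).trans
          (mul_le_of_le_one_right (norm_nonneg _) (ContinuousLinearMap.norm_snd_le _ _ _))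
      have h5 : ‖fderiv ℝ u q‖ ≤ (2 * (‖v q.1‖ * (‖fderiv ℝ v q.1‖ + ‖v q.1‖))) *
          (‖χ q.2‖ + ‖fderiv ℝ χ q.2‖) := by
        rw [h4]
        refine (norm_add_le _ _).trans ?_
        rw [norm_smul, norm_smul, norm_smul, norm_pow, nsmul_eq_mul, norm_mul]
        simp only [Nat.add_one_sub_one, pow_one, Nat.cast_ofNat, Real.norm_ofNat]
        generalize ‖(fderiv ℝ χ q.2).comp (ContinuousLinearMap.snd ℝ (Space d) (Space 2))‖ = k₂ at *
        generalize ‖(fderiv ℝ v q.1).comp (ContinuousLinearMap.fst ℝ (Space d) (Space 2))‖ = k₁ at *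
        have a1 := norm_nonneg (v q.1)
        have a2 := norm_nonneg (fderiv ℝ v q.1)
        have a3 := norm_nonneg (χ q.2)
        have a4 := norm_nonneg (fderiv ℝ χ q.2)
        generalize ‖v q.1‖ = α at *
        generalize ‖fderiv ℝ v q.1‖ = β at *
        generalize ‖χ q.2‖ = γ at *
        generalize ‖fderiv ℝ χ q.2‖ = δ at *
        have b1 : α ^ 2 * k₂ ≤ α ^ 2 * δ := by gcongr
        have b2 : γ * (2 * α * k₁) ≤ γ * (2 * α * β) := by gcongr
        have b3 : 0 ≤ α ^ 2 * δ := by positivity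
        have b4 : 0 ≤ α ^ 2 * γ := by positivity
        have b5 : 0 ≤ α * β * δ := by positivity
        linarith
      have h6 := ENNReal.ofReal_le_ofReal h5
      rw [ENNReal.ofReal_mul (by positivity), ENNReal.ofReal_mul (by positivity),
        ENNReal.ofReal_mul (by positivity), ENNReal.ofReal_add (by positivity) (by positivity),
        ENNReal.ofReal_add (by positivity) (by positivity)] at h6
      simpa only [ofReal_norm, ENNReal.ofReal_ofNat] using h6
    refine (lintegral_mono hpt).trans (le_of_eq ?_)
    rw [lintegral_prod_mul (f := fun x => 2 * (‖v x‖ₑ * (‖fderiv ℝ v x‖ₑ + ‖v x‖ₑ)))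
      (g := fun z => ‖χ z‖ₑ + ‖fderiv ℝ χ z‖ₑ), lintegral_const_mul]
    · ring
    · exact hv.continuous.enorm.measurable.mul
        (((hv.continuous_fderiv (by norm_num)).enorm.measurable).add hv.continuous.enorm.measurable)
    · exact ((hv.continuous.enorm.measurable.mul
        (((hv.continuous_fderiv (by norm_num)).enorm.measurable).add
          hv.continuous.enorm.measurable)).const_mul 2).aemeasurable
    · exact (χ.continuous.enorm.measurable.add
        (hχc.continuous_fderiv (by norm_num)).enorm.measurable).aemeasurable
  rw [lhs] at main
  have m2 : (∫⁻ x, (‖v x‖ₑ ^ 2) ^ p) * c₁ ≤ (C₀ * (2 * c₂) ^ p) * Z ^ p := by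
    refine main.trans ?_
    rw [mul_assoc, ← ENNReal.mul_rpow_of_nonneg _ _ hp0.le]
    gcongr
  rw [hK, ← ENNReal.mul_div_right_comm, ENNReal.le_div_iff_mul_le (.inl hc₁0) (.inl hc₁t)]
  exact m2


/-! ### Weighted Nash inequality with cut-offs. -/

theorem partialDeriv_pow {u : Space d → ℝ} (hu : Differentiable ℝ u) (n : ℕ) (i : Fin d) :
    partialDeriv i (fun x => u x ^ n) = fun x => n * u x ^ (n - 1) * partialDeriv i u x := by
  ext x
  have : HasFDerivAt (fun x => u x ^ n) _ x := (hu x).hasFDerivAt.pow n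
  rw [partialDeriv, this.fderiv]
  simp [partialDeriv]

theorem gradSq_mul_le {u v : Space d → ℝ} (hu : Differentiable ℝ u) (hv : Differentiable ℝ v)
    (x : Space d) : gradSq (fun x => u x * v x) x ≤
      2 * (v x ^ 2 * gradSq u x) + 2 * (u x ^ 2 * gradSq v x) := by
  unfold gradSq
  simp only [Finset.mul_sum]
  rw [← Finset.sum_add_distrib]
  refine Finset.sum_le_sum fun i _ => ?_
  rw [partialDeriv_mul hu hv]
  nlinarith [sq_nonneg (partialDeriv i u x * v x - u x * partialDeriv i v x)]

theorem gradSq_pow {u : Space d → ℝ} (hu : Differentiable ℝ u) (n : ℕ) (x : Space d) :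
    gradSq (fun x => u x ^ n) x = (n * u x ^ (n - 1)) ^ 2 * gradSq u x := by
  unfold gradSq
  rw [Finset.mul_sum]
  refine Finset.sum_congr rfl fun i _ => ?_
  rw [partialDeriv_pow hu, mul_pow]

theorem continuous_gradSq {u : Space d → ℝ} (hu : ContDiff ℝ 1 u) : Continuous (gradSq u) :=
  continuous_finsetSum _ fun i _ =>
    (contDiff_partialDeriv (n := 0) (m := 1) hu (by simp) i).continuous.pow 2

/-- The bookkeeping of exponents in the Hölder step of `exists_nash`, checked after raising both
sides to the power `n + 1`. -/
theorem rpow_mul_rpow_eq (n : ℕ) {r ξ Q : ℝ} (hr : 0 ≤ r) (hξ : 0 ≤ ξ) (hQ : 0 ≤ Q) :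
    ((r * ξ ^ (n + 1)) ^ 2) ^ ((n : ℝ) / (n + 1 : ℕ)) *
      (Q ^ (n + 1) * r) ^ ((2 : ℝ) / (n + 1 : ℕ)) = r ^ 2 * ξ ^ (2 * n) * Q ^ 2 := by
  have hn : ((n + 1 : ℕ) : ℝ) ≠ 0 := by positivity
  have key : ∀ {a : ℝ} (k : ℕ), 0 ≤ a → (a ^ ((k : ℝ) / (n + 1 : ℕ))) ^ (n + 1) = a ^ k := by
    intro a k ha
    rw [← Real.rpow_natCast, ← Real.rpow_mul ha, div_mul_cancel₀ _ hn, Real.rpow_natCast]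
  refine (pow_left_inj₀ (by positivity) (by positivity) (Nat.succ_ne_zero n)).1 ?_
  rw [mul_pow, key n (by positivity)]
  have := key (a := Q ^ (n + 1) * r) 2 (by positivity)
  rw [Nat.cast_ofNat] at this
  rw [Nat.succ_eq_add_one, this]
  ring

/-- Interpolate the weighted `L²` quantity `X` between a moment of `r` and a Sobolev norm of `v = r
ξ^(d+3)`: Hölder and `exists_lintegral_sq_rpow_le` give `X^(d+3) ≤ K^(d+1) Z^(d+2) M²`, with `Z` at
most the dissipation plus a multiple of `X`. The high power of `ξ` lets the derivatives of the
cut-off be absorbed by the weight `Q`, and the free parameter `l` replaces the choice of a small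
constant in Young's inequality. -/
theorem exists_nash (d : ℕ) : ∃ C : ℝ, 0 ≤ C ∧ ∀ (r ξ Q : Space d → ℝ) (M : ℝ), ContDiff ℝ 1 r →
    (∀ x, 0 ≤ r x) → ContDiff ℝ 1 ξ → HasCompactSupport ξ → (∀ x, 0 ≤ ξ x) → Continuous Q →
    (∀ x, ξ x ≤ Q x) → (∀ x, gradSq ξ x ≤ Q x ^ 2) → (Integrable fun x => Q x ^ (d + 3) * r x) →
    ∫ x, Q x ^ (d + 3) * r x ≤ M → ∀ l : ℝ, 1 ≤ l →
    l * ∫ x, r x ^ 2 * ξ x ^ (2 * (d + 2)) * Q x ^ 2 ≤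
      (∫ x, (ξ x ^ (d + 3)) ^ 2 * gradSq r x) + C * M ^ 2 * (l * (1 + l) ^ (d + 2)) := by
  obtain ⟨K, hK⟩ := exists_lintegral_sq_rpow_le d
  -- The square comes from differentiating `ξ^(d+3)`, the `2` covers the zeroth-order terms in `|v|
  -- (|∇v| + |v|)`.
  set c : ℝ := ((d + 3 : ℕ) : ℝ) ^ 2 + 2 with hc
  refine ⟨(K : ℝ) ^ (d + 1) * c ^ (d + 2), by positivity, ?_⟩
  intro r ξ Q M hr hr0 hξ hξc hξ0 hQ hξQ hgQ hI hM l hl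
  have hQ0 : ∀ x, 0 ≤ Q x := fun x => (hξ0 x).trans (hξQ x)
  have hM0 : 0 ≤ M := (integral_nonneg fun x => mul_nonneg (pow_nonneg (hQ0 x) _) (hr0 x)).trans hM
  set X := ∫ x, r x ^ 2 * ξ x ^ (2 * (d + 2)) * Q x ^ 2 with hX
  set D := ∫ x, (ξ x ^ (d + 3)) ^ 2 * gradSq r x with hD
  have hrd := hr.differentiable (by norm_num)
  have hξd := hξ.differentiable (by norm_num)
  have hgr := continuous_gradSq hr
  have hrc := hr.continuous
  have hξcont := hξ.continuous
  have cs : ∀ {k : ℕ}, k ≠ 0 → HasCompactSupport fun x => ξ x ^ k := fun {k} hk =>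
    hξc.comp_left (g := fun y => y ^ k) (zero_pow hk)
  have iX : Integrable fun x => r x ^ 2 * ξ x ^ (2 * (d + 2)) * Q x ^ 2 :=
    Continuous.integrable_of_hasCompactSupport (by fun_prop)
      ((cs (by omega)).mul_left.mul_right)
  have iD : Integrable fun x => (ξ x ^ (d + 3)) ^ 2 * gradSq r x :=
    Continuous.integrable_of_hasCompactSupport (by fun_prop)
      (HasCompactSupport.mul_right ((cs (k := d + 3) (by omega)).comp_left
        (g := fun y => y ^ 2) (by norm_num)))
  have hX0 : 0 ≤ X := integral_nonneg fun x => by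
    have := hξ0 x; have := hQ0 x; have := hr0 x; positivity
  have hD0 : 0 ≤ D := integral_nonneg fun x => mul_nonneg (sq_nonneg _) (gradSq_nonneg r x)
  set v : Space d → ℝ := fun x => r x * ξ x ^ (d + 3) with hv
  have hv1 : ContDiff ℝ 1 v := hr.mul (hξ.pow _)
  have hvc : HasCompactSupport v := (cs (by omega)).mul_left
  set Z := ∫ x, |v x| * (‖fderiv ℝ v x‖ + |v x|) with hZ
  have hfv := hv1.continuous_fderiv (by norm_num)
  have hvcont := hv1.continuous
  have iZ : Integrable fun x => |v x| * (‖fderiv ℝ v x‖ + |v x|) :=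
    Continuous.integrable_of_hasCompactSupport (by fun_prop)
      (HasCompactSupport.mul_right (hvc.comp_left (g := fun y => |y|) abs_zero))
  have hZ0 : 0 ≤ Z := integral_nonneg fun x => by positivity
  -- the energy controls `Z`
  have hZle : Z ≤ D + c * X := by
    rw [hD, hX, hZ, ← integral_const_mul, ← integral_add iD (iX.const_mul c)]
    refine integral_mono iZ (iD.add (iX.const_mul c)) fun x => ?_
    have h1 := norm_fderiv_sq_le v x
    have h2 := gradSq_mul_le hrd (hξ.pow (d + 3) |>.differentiable (by norm_num)) x
    rw [gradSq_pow hξd] at h2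
    have h3 : r x ^ 2 * ((((d + 3 : ℕ) : ℝ) * ξ x ^ (d + 3 - 1)) ^ 2 * gradSq ξ x) ≤
        ((d + 3 : ℕ) : ℝ) ^ 2 * (r x ^ 2 * ξ x ^ (2 * (d + 2)) * Q x ^ 2) := by
      have : ((d + 3 : ℕ) : ℝ) ^ 2 * (r x ^ 2 * ξ x ^ (2 * (d + 2)) * Q x ^ 2) =
        r x ^ 2 * ((((d + 3 : ℕ) : ℝ) * ξ x ^ (d + 3 - 1)) ^ 2 * Q x ^ 2) := by
        rw [show d + 3 - 1 = d + 2 by omega]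
        ring
      rw [this]
      have := hgQ x
      gcongr
    have h4 : v x ^ 2 ≤ r x ^ 2 * ξ x ^ (2 * (d + 2)) * Q x ^ 2 := by
      have e : v x ^ 2 = r x ^ 2 * ξ x ^ (2 * (d + 2)) * ξ x ^ 2 := by simp only [hv]; ring
      rw [e]
      have := hξ0 x; have := hξQ x; have := hr0 x
      gcongr
    have h5 := sq_abs (v x)
    change |v x| * (‖fderiv ℝ v x‖ + |v x|) ≤
      (ξ x ^ (d + 3)) ^ 2 * gradSq r x + c * (r x ^ 2 * ξ x ^ (2 * (d + 2)) * Q x ^ 2)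
    change gradSq v x ≤ _ at h2
    rw [hc]
    nlinarith [sq_nonneg (|v x| - ‖fderiv ℝ v x‖)]
  -- Hölder and Sobolev
  have hpow : X ^ (d + 3) ≤ (K : ℝ) ^ (d + 1) * Z ^ (d + 2) * M ^ 2 := by
    set F : Space d → ℝ≥0∞ := fun x => (‖v x‖ₑ ^ 2) ^ (((d + 2 : ℕ) : ℝ) / ((d + 1 : ℕ) : ℝ)) with hF
    set G : Space d → ℝ≥0∞ := fun x => ENNReal.ofReal (Q x ^ (d + 3) * r x) with hG
    have hd1 : ((d + 1 : ℕ) : ℝ) ≠ 0 := by positivity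
    have hd3 : ((d + 3 : ℕ) : ℝ) ≠ 0 := by positivity
    -- The Hölder weights `(d+1)/(d+3)` and `2/(d+3)` are those for which the product of the powers
    -- of `F` and `G` is the integrand of `X`.
    have hol := ENNReal.lintegral_mul_norm_pow_le (μ := (volume : Measure (Space d))) (f := F) (g := G)
      ((hvcont.enorm.measurable.pow_const 2).pow_const _).aemeasurable
      ((hQ.pow _).mul hrc).measurable.ennreal_ofReal.aemeasurable
      (p := ((d + 1 : ℕ) : ℝ) / ((d + 3 : ℕ) : ℝ)) (q := 2 / ((d + 3 : ℕ) : ℝ))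
      (by positivity) (by positivity) (by rw [← add_div, div_eq_one_iff_eq hd3]; push_cast; ring)
    have hFG : ∀ x, F x ^ (((d + 1 : ℕ) : ℝ) / ((d + 3 : ℕ) : ℝ)) * G x ^ (2 / ((d + 3 : ℕ) : ℝ)) =
        ENNReal.ofReal (r x ^ 2 * ξ x ^ (2 * (d + 2)) * Q x ^ 2) := by
      intro x
      have a1 := hr0 x; have a2 := hξ0 x; have a3 := hQ0 x
      rw [← rpow_mul_rpow_eq (d + 2) a1 a2 a3, ENNReal.ofReal_mul (by positivity),
        ← ENNReal.ofReal_rpow_of_nonneg (by positivity) (by positivity),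
        ← ENNReal.ofReal_rpow_of_nonneg (by positivity) (by positivity)]
      congr 1
      simp only [hF]
      rw [← ENNReal.rpow_mul, div_mul_div_cancel₀ hd1, Real.enorm_eq_ofReal_abs,
        ← ENNReal.ofReal_pow (abs_nonneg _), sq_abs]
    simp only [hFG] at hol
    rw [← ofReal_integral_eq_lintegral_ofReal iX (Eventually.of_forall fun x => by
      have := hξ0 x; have := hQ0 x; have := hr0 x; positivity)] at hol
    have hGM : ∫⁻ x, G x ≤ ENNReal.ofReal M := by
      rw [← ofReal_integral_eq_lintegral_ofReal hI (Eventually.of_forall fun x =>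
        mul_nonneg (pow_nonneg (hQ0 x) _) (hr0 x))]
      exact ENNReal.ofReal_le_ofReal hM
    have hZe : ∫⁻ x, ‖v x‖ₑ * (‖fderiv ℝ v x‖ₑ + ‖v x‖ₑ) = ENNReal.ofReal Z := by
      rw [ofReal_integral_eq_lintegral_ofReal iZ (Eventually.of_forall fun x => by positivity)]
      refine lintegral_congr fun x => ?_
      rw [ENNReal.ofReal_mul (abs_nonneg _), ENNReal.ofReal_add (norm_nonneg _) (abs_nonneg _),
        ofReal_norm, ← Real.enorm_eq_ofReal_abs]
    have hFK := hK v hv1 hvc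
    rw [hZe] at hFK
    have key : ∀ (a : ℝ≥0∞) (k : ℕ), (a ^ ((k : ℝ) / ((d + 3 : ℕ) : ℝ))) ^ (d + 3) = a ^ k := by
      intro a k
      rw [← ENNReal.rpow_natCast, ← ENNReal.rpow_mul, div_mul_cancel₀ _ hd3, ENNReal.rpow_natCast]
    have h1 : ENNReal.ofReal X ^ (d + 3) ≤
        (K * ENNReal.ofReal Z ^ (((d + 2 : ℕ) : ℝ) / ((d + 1 : ℕ) : ℝ))) ^ (d + 1) *
          ENNReal.ofReal M ^ 2 := by
      refine (pow_le_pow_left₀ zero_le hol (d + 3)).trans ?_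
      rw [mul_pow, key]
      have := key (∫⁻ x, G x) 2
      rw [Nat.cast_ofNat] at this
      rw [this]
      gcongr
    have h2 : (ENNReal.ofReal Z ^ (((d + 2 : ℕ) : ℝ) / ((d + 1 : ℕ) : ℝ))) ^ (d + 1) =
        ENNReal.ofReal Z ^ (d + 2) := by
      rw [← ENNReal.rpow_natCast, ← ENNReal.rpow_mul, div_mul_cancel₀ _ hd1, ENNReal.rpow_natCast]
    rw [mul_pow, h2, ← ENNReal.ofReal_pow hX0, ← ENNReal.ofReal_pow hZ0, ← ENNReal.ofReal_pow hM0,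
      ← ENNReal.ofReal_coe_nnreal, ← ENNReal.ofReal_pow K.coe_nonneg, ← ENNReal.ofReal_mul (by positivity),
      ← ENNReal.ofReal_mul (by positivity)] at h1
    exact (ENNReal.ofReal_le_ofReal_iff (by positivity)).1 h1
  -- Either the dissipation already dominates, or it is less than `l X`. In the second case `Z ≤ c
  -- (1 + l) X`, and dividing the interpolation inequality by `X^(d+2)` bounds `X` itself.
  by_cases hcase : l * X ≤ D
  · exact hcase.trans (le_add_of_nonneg_right (by positivity))
  · have hc1 : 1 ≤ c := by rw [hc]; nlinarith [sq_nonneg ((d + 3 : ℕ) : ℝ)]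
    have h1 : Z ≤ c * (1 + l) * X := by
      have : l * X ≤ c * l * X := by
        have : 0 ≤ l * X := by positivity
        nlinarith
      nlinarith
    have h2 : X ^ (d + 3) ≤ X ^ (d + 2) * ((K : ℝ) ^ (d + 1) * c ^ (d + 2) * M ^ 2 * (1 + l) ^ (d + 2)) := by
      refine hpow.trans ?_
      have h3 : Z ^ (d + 2) ≤ (c * (1 + l) * X) ^ (d + 2) := pow_le_pow_left₀ hZ0 h1 _
      calc (K : ℝ) ^ (d + 1) * Z ^ (d + 2) * M ^ 2
          ≤ (K : ℝ) ^ (d + 1) * (c * (1 + l) * X) ^ (d + 2) * M ^ 2 := by gcongr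
        _ = _ := by rw [mul_pow, mul_pow]; ring
    have h4 : X ≤ (K : ℝ) ^ (d + 1) * c ^ (d + 2) * M ^ 2 * (1 + l) ^ (d + 2) := by
      rcases hX0.eq_or_lt with h0 | h0
      · rw [← h0]; positivity
      · rw [pow_succ] at h2
        exact le_of_mul_le_mul_left h2 (by positivity)
    have h5 := mul_le_mul_of_nonneg_left h4 (by linarith : 0 ≤ l)
    linarith

/-! ### The energy inequality -/

/-- Integrate `∇ · (∇u + G)` by parts against `2 u η²` and use Young's inequality to keep half of
the dissipation. Used both for the solution itself and for its mollified derivatives. -/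
theorem energy_inequality {u η : Space d → ℝ} {G : Fin d → Space d → ℝ} (hu : ContDiff ℝ 2 u)
    (hG : ∀ i, LocBoundedDeriv (G i)) (hη : ContDiff ℝ 1 η) (hηc : HasCompactSupport η) :
    ∫ x, 2 * (u x * η x ^ 2) *
        (∑ i, partialDeriv i (partialDeriv i u) x + ∑ i, partialDeriv i (G i) x) ≤
      -(∫ x, η x ^ 2 * gradSq u x) +
        ∫ x, (10 * (u x ^ 2 * gradSq η x) + 4 * (η x ^ 2 * ∑ i, G i x ^ 2)) := by
  set g : Space d → ℝ := fun x => 2 * (u x * η x ^ 2) with hg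
  have hu1 : ContDiff ℝ 1 u := hu.of_le (by norm_num)
  have hg1 : ContDiff ℝ 1 g := contDiff_const.mul (hu1.mul (hη.pow 2))
  have hηc2 : HasCompactSupport fun x => η x ^ 2 := hηc.comp_left (g := fun y => y ^ 2) (by norm_num)
  have hgc : HasCompactSupport g := (hηc2.mul_left (f := u)).mul_left (f := fun _ => (2:ℝ))
  have hui : ∀ i, ContDiff ℝ 1 (partialDeriv i u) := fun i =>
    contDiff_partialDeriv (n := 1) (m := 2) hu (by norm_num) i
  have hf : ∀ i, LocBoundedDeriv fun x => partialDeriv i u x + G i x := fun i =>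
    (LocBoundedDeriv.of_contDiff (hui i)).add (hG i)
  have hpg : ∀ i, Continuous (partialDeriv i g) := fun i =>
    (contDiff_partialDeriv (n := 0) (m := 1) hg1 (by simp) i).continuous
  have hpη : ∀ i, Continuous (partialDeriv i η) := fun i =>
    (contDiff_partialDeriv (n := 0) (m := 1) hη (by simp) i).continuous
  have hGc : ∀ i, Continuous (G i) := fun i => (hG i).1.continuous
  have huc := hu.continuous
  have hηcont := hη.continuous
  have hgu := continuous_gradSq hu1
  have hgη := continuous_gradSq hη
  have hpe : ∀ i x, partialDeriv i g x =
      2 * (partialDeriv i u x * η x ^ 2 + u x * (2 * η x * partialDeriv i η x)) := by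
    intro i x
    have h1 := partialDeriv_mul (hu1.differentiable (by norm_num))
      ((hη.pow 2).differentiable (by norm_num)) i
    rw [partialDeriv_pow (hη.differentiable (by norm_num))] at h1
    have h2 := partialDeriv_mul (differentiable_const (2:ℝ))
      ((hu1.mul (hη.pow 2)).differentiable (by norm_num)) i
    rw [hg, h2, h1]
    have h3 : partialDeriv i (fun _ : Space d => (2:ℝ)) x = 0 := by simp [partialDeriv]
    beta_reduce
    rw [h3]
    norm_num
  have hgηc : HasCompactSupport (gradSq η) := by
    refine .of_support_subset_isCompact hηc fun x hx => ?_
    by_contra hx'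
    refine hx (Finset.sum_eq_zero fun i _ => ?_)
    rw [image_eq_zero_of_notMem_tsupport fun h => hx' (tsupport_partialDeriv_subset η i h)]
    norm_num
  have iL : ∀ i, Integrable fun x => partialDeriv i (fun x => partialDeriv i u x + G i x) x * g x :=
    fun i => (hf i).integrable_partialDeriv_mul hg1.continuous hgc i
  have i1 : Integrable fun x => η x ^ 2 * gradSq u x :=
    Continuous.integrable_of_hasCompactSupport (by fun_prop) hηc2.mul_right
  have i1' : Integrable fun x => -(η x ^ 2 * gradSq u x) := i1.neg
  have i2 : Integrable fun x => 10 * (u x ^ 2 * gradSq η x) + 4 * (η x ^ 2 * ∑ i, G i x ^ 2) := by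
    refine Continuous.integrable_of_hasCompactSupport (by fun_prop) ?_
    exact (hgηc.mul_left.mul_left).add (hηc2.mul_right.mul_left)
  have i3 : ∀ i, Integrable fun x => (partialDeriv i u x + G i x) * partialDeriv i g x := fun i =>
    ((hf i).1.continuous.mul (hpg i)).integrable_of_hasCompactSupport
      (hasCompactSupport_partialDeriv hgc i).mul_left
  have e1 : ∀ x, 2 * (u x * η x ^ 2) *
      (∑ i, partialDeriv i (partialDeriv i u) x + ∑ i, partialDeriv i (G i) x) =
      ∑ i, partialDeriv i (fun x => partialDeriv i u x + G i x) x * g x := by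
    intro x
    rw [← Finset.sum_add_distrib, Finset.mul_sum]
    refine Finset.sum_congr rfl fun i _ => ?_
    rw [partialDeriv_add ((hui i).differentiable (by norm_num)) (hG i).1, mul_comm]
  simp only [e1]
  rw [integral_finsetSum _ fun i _ => iL i]
  have e2 : ∀ i, _ := fun i => integral_partialDeriv_mul (hf i) hg1 hgc i
  simp only [e2]
  rw [Finset.sum_neg_distrib, ← integral_finsetSum _ fun i _ => i3 i, ← integral_neg, ← integral_neg,
    ← integral_add i1' i2]
  refine integral_mono (integrable_finsetSum _ fun i _ => i3 i).neg (i1'.add i2) fun x => ?_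
  change -(∑ i, (partialDeriv i u x + G i x) * partialDeriv i g x) ≤
    -(η x ^ 2 * gradSq u x) + (10 * (u x ^ 2 * gradSq η x) + 4 * (η x ^ 2 * ∑ i, G i x ^ 2))
  unfold gradSq
  simp only [Finset.mul_sum]
  rw [← Finset.sum_neg_distrib, ← Finset.sum_neg_distrib, ← Finset.sum_add_distrib,
    ← Finset.sum_add_distrib]
  refine Finset.sum_le_sum fun i _ => ?_
  rw [hpe]
  generalize partialDeriv i u x = p
  generalize partialDeriv i η x = e
  generalize G i x = q
  generalize u x = w
  generalize η x = h
  -- The constants `10` and `4` are such that the difference of the two sides equals these squares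
  -- with coefficients `1/2`, `1/2` and `2`.
  nlinarith [sq_nonneg (p * h + 4 * (w * e)), sq_nonneg (p * h + 2 * (q * h)),
    sq_nonneg (q * h + w * e)]

/-! ### Cut-off weights -/

/-- The power `wt ^ m`, cut off smoothly where `wt` lies between `R` and `2R`. -/
def wcut (m : ℕ) (R : ℝ) (x : Space d) : ℝ := Real.smoothTransition (2 - wt x / R) * wt x ^ m

theorem contDiff_wcut {m : ℕ} {R : ℝ} {n : ℕ∞} : ContDiff ℝ n (wcut (d := d) m R) :=
  (Real.smoothTransition.contDiff.comp (contDiff_const.sub (contDiff_wt.div_const R))).mul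
    (contDiff_wt.pow m)

theorem hasCompactSupport_wcut (m : ℕ) {R : ℝ} (hR : 0 < R) :
    HasCompactSupport (wcut (d := d) m R) := by
  refine .of_support_subset_isCompact (isCompact_closedBall (0 : Space d) (2 * R + 1)) fun x hx => ?_
  by_contra hx'
  have : 2 * R + 1 < ‖x‖ := by simpa using hx'
  have : 2 - wt x / R ≤ 0 := by
    rw [sub_nonpos, le_div_iff₀ hR]
    unfold wt; nlinarith
  exact hx (by simp [wcut, Real.smoothTransition.zero_of_nonpos this])

theorem wcut_nonneg (m : ℕ) (R : ℝ) (x : Space d) : 0 ≤ wcut m R x :=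
  mul_nonneg (Real.smoothTransition.nonneg _) (pow_nonneg (wt_pos x).le m)

theorem wcut_le (m : ℕ) (R : ℝ) (x : Space d) : wcut m R x ≤ wt x ^ m :=
  mul_le_of_le_one_left (pow_nonneg (wt_pos x).le m) (Real.smoothTransition.le_one _)

theorem tendsto_wcut (m : ℕ) (x : Space d) :
    ∀ᶠ n : ℕ in atTop, wcut m ((n : ℝ) + 1) x = wt x ^ m := by
  obtain ⟨N, hN⟩ := exists_nat_ge (wt x)
  filter_upwards [eventually_ge_atTop N] with n hn
  have h1 : wt x ≤ (n : ℝ) + 1 := by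
    have : (N : ℝ) ≤ n := by exact_mod_cast hn
    linarith
  have h2 : 1 ≤ 2 - wt x / ((n : ℝ) + 1) := by
    have := (div_le_one (by positivity : (0:ℝ) < (n : ℝ) + 1)).2 h1
    linarith
  rw [wcut, Real.smoothTransition.one_of_one_le h2, one_mul]

theorem exists_deriv_smoothTransition_le : ∃ B : ℝ, ∀ s, |deriv Real.smoothTransition s| ≤ B := by
  obtain ⟨B, hB⟩ := (isCompact_Icc (a := (0:ℝ)) (b := 1)).exists_bound_of_continuousOn
    ((Real.smoothTransition.contDiff (n := 1)).continuous_deriv (by norm_num)).continuousOn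
  have hB0 : 0 ≤ B := (norm_nonneg _).trans (hB 0 (by simp))
  refine ⟨B, fun s => ?_⟩
  by_cases hs : s ∈ Icc (0:ℝ) 1
  · exact hB s hs
  · have : deriv Real.smoothTransition s = 0 := by
      rw [mem_Icc, not_and_or, not_le, not_le] at hs
      rcases hs with hs | hs
      · refine HasDerivAt.deriv ((hasDerivAt_const s (0:ℝ)).congr_of_eventuallyEq ?_)
        filter_upwards [Iio_mem_nhds hs] with r hr
          using Real.smoothTransition.zero_of_nonpos (le_of_lt hr)
      · refine HasDerivAt.deriv ((hasDerivAt_const s (1:ℝ)).congr_of_eventuallyEq ?_)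
        filter_upwards [Ioi_mem_nhds hs] with r hr
          using Real.smoothTransition.one_of_one_le (le_of_lt hr)
    rw [this, abs_zero]
    exact hB0

theorem gradSq_comp_wt {g g' : ℝ → ℝ} (hg : ∀ r, HasDerivAt g (g' r) r) (x : Space d) :
    gradSq (fun x => g (wt x)) x = 4 * g' (wt x) ^ 2 * ‖x‖ ^ 2 := by
  unfold gradSq
  rw [EuclideanSpace.norm_sq_eq, Finset.mul_sum]
  refine Finset.sum_congr rfl fun i _ => ?_
  rw [partialDeriv_comp_wt hg, Real.norm_eq_abs, sq_abs]
  ring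

/-- Differentiating the cut-off costs `1 / R ≤ 1`, and `|x|² ≤ wt x` absorbs the inner derivative.
The loss of one power of the weight buys independence of `R`. -/
theorem exists_gradSq_wcut_le (m : ℕ) : ∃ A : ℝ, 0 ≤ A ∧ ∀ R : ℝ, 1 ≤ R → ∀ x : Space d,
    gradSq (wcut m R) x ≤ A * wt x ^ (2 * m + 1) := by
  obtain ⟨B, hB⟩ := exists_deriv_smoothTransition_le
  refine ⟨8 * B ^ 2 + 8 * m ^ 2, by positivity, fun R hR x => ?_⟩
  have hR0 : 0 < R := by linarith
  have h1 : ∀ r : ℝ, HasDerivAt (fun r : ℝ => Real.smoothTransition (2 - r / R))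
      (deriv Real.smoothTransition (2 - r / R) * -(1 / R)) r := by
    intro r
    have h2 : HasDerivAt Real.smoothTransition (deriv Real.smoothTransition (2 - r / R)) (2 - r / R) :=
      ((Real.smoothTransition.contDiff (n := 1)).differentiable (by norm_num) _).hasDerivAt
    exact h2.comp r (((hasDerivAt_id r).div_const R).const_sub 2)
  have h3 := gradSq_mul_le (u := fun x : Space d => Real.smoothTransition (2 - wt x / R))
    (v := fun x => wt x ^ m)
    ((Real.smoothTransition.contDiff.comp (contDiff_const.sub
      (contDiff_wt.div_const R))).differentiable (n := 1) (by norm_num))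
    ((contDiff_wt.pow m).differentiable (n := 1) (by norm_num)) x
  rw [gradSq_comp_wt h1, gradSq_comp_wt fun r => hasDerivAt_pow m r] at h3
  refine h3.trans ?_
  have w1 := one_le_wt x
  have hx : ‖x‖ ^ 2 ≤ wt x := by unfold wt; linarith
  have a1 : (deriv Real.smoothTransition (2 - wt x / R) * -(1 / R)) ^ 2 ≤ B ^ 2 := by
    rw [← sq_abs, abs_mul, abs_neg, abs_of_pos (by positivity : 0 < 1 / R)]
    have : 1 / R ≤ 1 := (div_le_one hR0).2 hR
    have h5 := hB (2 - wt x / R)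
    have : |deriv Real.smoothTransition (2 - wt x / R)| * (1 / R) ≤ B :=
      (mul_le_of_le_one_right (abs_nonneg _) this).trans h5
    gcongr
  have a2 : Real.smoothTransition (2 - wt x / R) ^ 2 ≤ 1 :=
    pow_le_one₀ (Real.smoothTransition.nonneg _) (Real.smoothTransition.le_one _)
  have a3 : (m * wt x ^ (m - 1)) ^ 2 * ‖x‖ ^ 2 ≤ m ^ 2 * wt x ^ (2 * m + 1) := by
    calc (m * wt x ^ (m - 1)) ^ 2 * ‖x‖ ^ 2 ≤ (m * wt x ^ m) ^ 2 * wt x := by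
          have := wt_pow_mono x (Nat.sub_le m 1)
          have := wt_pos x
          gcongr
      _ = _ := by ring
  have a4 : 0 ≤ (m * wt x ^ (m - 1)) ^ 2 * ‖x‖ ^ 2 := by positivity
  have w2 := (wt_pos x).le
  have b1 : (wt x ^ m) ^ 2 * (4 * (deriv Real.smoothTransition (2 - wt x / R) * -(1 / R)) ^ 2 * ‖x‖ ^ 2)
      ≤ (wt x ^ m) ^ 2 * (4 * B ^ 2 * wt x) := by gcongr
  have b2 : Real.smoothTransition (2 - wt x / R) ^ 2 * (4 * (m * wt x ^ (m - 1)) ^ 2 * ‖x‖ ^ 2) ≤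
      1 * (4 * (m ^ 2 * wt x ^ (2 * m + 1))) := by
    refine mul_le_mul a2 (by linarith) (by linarith) zero_le_one
  have b3 : (wt x ^ m) ^ 2 * (4 * B ^ 2 * wt x) = 4 * B ^ 2 * wt x ^ (2 * m + 1) := by ring
  linarith

/-! ### The weighted `L²` estimate -/

section LTwo

variable {V W : Space d → ℝ} {ρ : ℝ → Space d → ℝ}

theorem exists_drift_le {s : ℕ} (hVW : HessianBounds V W)
    (hV : HasPolyGrowthDerivs (s + 1) V) (hW : HasPolyGrowthDerivs (s + 1) W)
    {a : ℝ} (ha : 0 < a) (E T : ℝ) : ∃ B : ℝ, 0 ≤ B ∧ ∃ m : ℕ, ∀ ρ, Admissible V W a E ρ →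
      ∀ t ∈ Ioc 0 T, ∀ i, ContDiff ℝ s (drift V W (ρ t) i) ∧
        ∀ L : List (Fin d), L.length ≤ s → ∀ x, |lderiv L (drift V W (ρ t) i) x| ≤ B * wt x ^ m := by
  obtain ⟨C, hC, m, h⟩ := exists_drift_lderiv_le hVW hV hW
  obtain ⟨M, hM, hmom⟩ := exists_moment_le hVW ha E T m
  refine ⟨C * (1 + M), by positivity, m, fun ρ hρ t ht i => ?_⟩
  obtain ⟨h1, h2⟩ := hmom ρ hρ t ht
  obtain ⟨ρ₀, -, -, -, hsol⟩ := hρ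
  obtain ⟨h3, h4⟩ := h (ρ t) (hsol.isNiceDensity ht.1) h1 i
  refine ⟨h3, fun L hL x => (h4 L hL x).trans ?_⟩
  refine mul_le_mul_of_nonneg_right ?_ (pow_nonneg (wt_pos x).le m)
  gcongr

theorem IsClassicalSolution.hasDerivAt_integral_sq {ρ₀ : Space d → ℝ}
    (h : IsClassicalSolution V W ρ₀ ρ) {η : Space d → ℝ} (hη : ContDiff ℝ 1 η)
    (hηc : HasCompactSupport η) {t : ℝ} (ht : 0 < t) :
    HasDerivAt (fun τ => ∫ x, ρ τ x ^ 2 * η x ^ 2)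
      (∫ x, 2 * (ρ t x * η x ^ 2) * deriv (fun τ => ρ τ x) t) t := by
  refine hasDerivAt_integral_of_support (H := fun τ x => ρ τ x ^ 2 * η x ^ 2)
    (H' := fun t x => 2 * (ρ t x * η x ^ 2) * deriv (fun τ => ρ τ x) t) hηc ?_ ?_ ?_ ?_ ht
  · exact fun t ht => ((continuous_slice h.continuousOn ht).pow 2).mul (hη.continuous.pow 2)
  · intro t ht x
    have := ((h.differentiableAt_time t ht x).hasDerivAt.pow 2).mul_const (η x ^ 2)
    refine this.congr_deriv ?_
    norm_num
    ring
  · refine ContinuousOn.mul (continuousOn_const.mul (h.continuousOn.mul ?_)) h.continuousOn_time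
    exact ((hη.continuous.comp continuous_snd).pow 2).continuousOn
  · intro t _ x hx
    simp [image_eq_zero_of_notMem_tsupport hx]

/-- The damping rate may be chosen at each time. With `σ = t - τ / 2` and `l = (n + 1) / σ + c₀`,
the function `σ^(n+1) y` has bounded derivative and vanishes at `σ = 0`, so the value of `y` at the
starting time never enters. -/
theorem le_of_forall_damping {y y' : ℝ → ℝ} {n : ℕ} {c₀ D τ T : ℝ} (hc₀ : 1 ≤ c₀) (hD : 0 ≤ D)
    (hyd : ∀ t, 0 < t → HasDerivAt y (y' t) t) (hy0 : ∀ t, 0 ≤ y t)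
    (hdiff : ∀ t ∈ Ioc 0 T, ∀ l : ℝ, 1 ≤ l → c₀ ≤ l →
      (l - c₀) * y t + y' t ≤ D * (l * (1 + l) ^ n)) (hτ : 0 < τ) {t₁ : ℝ} (ht₁ : t₁ ∈ Icc τ T) :
    y t₁ ≤ D * (((n + 1 : ℕ) + c₀ * |T|) * (|T| + ((n + 1 : ℕ) + c₀ * |T|)) ^ n) * |T| /
      (τ / 2) ^ (n + 1) := by
  set S : ℝ := |T| with hS
  have hS0 : 0 ≤ S := abs_nonneg T
  set κ : ℝ := ((n + 1 : ℕ) : ℝ) + c₀ * S with hκ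
  set K' : ℝ := D * (κ * (S + κ) ^ n) with hK'
  have hκ0 : 0 ≤ κ := by positivity
  have hK'0 : 0 ≤ K' := by positivity
  set τ' := τ / 2 with hτ'
  have hτ'0 : 0 < τ' := by positivity
  have hlt : τ' < t₁ := by have := ht₁.1; linarith
  have hz : (t₁ - τ') ^ (n + 1) * y t₁ - K' * (t₁ - τ') ≤
      (τ' - τ') ^ (n + 1) * y τ' - K' * (τ' - τ') := by
    have hzd : ∀ t, 0 < t → HasDerivAt (fun t => (t - τ') ^ (n + 1) * y t - K' * (t - τ'))
        ((((n + 1 : ℕ) : ℝ) * (t - τ') ^ (n + 1 - 1) * 1) * y t + (t - τ') ^ (n + 1) * y' t -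
          K' * 1) t := fun t ht =>
      ((((hasDerivAt_id t).sub_const τ').pow (n + 1)).mul (hyd t ht)).sub
        (((hasDerivAt_id t).sub_const τ').const_mul K')
    refine le_of_hasDerivAt_nonpos_of_tendsto (τ := τ')
      (y := fun t => (t - τ') ^ (n + 1) * y t - K' * (t - τ')) hlt
      (fun t ht => hzd t (hτ'0.trans ht.1)) ?_
      ((hzd τ' hτ'0).continuousAt.tendsto.mono_left nhdsWithin_le_nhds)
    intro t ht
    have htT : t ∈ Ioc 0 T := ⟨hτ'0.trans ht.1, ht.2.trans ht₁.2⟩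
    set σ := t - τ' with hσ
    have hσ0 : 0 < σ := by have := ht.1; linarith
    have hσS : σ ≤ S := by
      have := htT.2
      have := le_abs_self T
      linarith
    set k : ℝ := ((n + 1 : ℕ) : ℝ) with hk
    have hk1 : 0 < k := by positivity
    have hkσ : 0 < k / σ := by positivity
    -- The power `σ^(n+1)` compensates exactly the `n + 1` factors of size `1 / σ` in `l (1 + l)^n`.
    have hdl := hdiff t htT (k / σ + c₀) (by linarith) (by linarith)
    rw [add_sub_cancel_right] at hdl
    have h1 := mul_le_mul_of_nonneg_left hdl (pow_nonneg hσ0.le (n + 1))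
    have h0 : σ * (k / σ) = k := mul_div_cancel₀ k hσ0.ne'
    have h2 : σ ^ (n + 1) * (k / σ * y t + y' t) =
        (k * σ ^ (n + 1 - 1) * 1) * y t + σ ^ (n + 1) * y' t := by
      rw [Nat.add_sub_cancel]
      linear_combination σ ^ n * y t * h0
    have h3 : σ ^ (n + 1) * (D * ((k / σ + c₀) * (1 + (k / σ + c₀)) ^ n)) ≤ K' := by
      have g1 : σ * (k / σ + c₀) = k + c₀ * σ := by rw [mul_add, h0, mul_comm σ]
      have g2 : σ * (1 + (k / σ + c₀)) = σ + (k + c₀ * σ) := by rw [mul_add, g1, mul_one]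
      have g3 : k + c₀ * σ ≤ κ := by rw [hκ]; gcongr
      have g4 : 0 ≤ k + c₀ * σ := by positivity
      calc σ ^ (n + 1) * (D * ((k / σ + c₀) * (1 + (k / σ + c₀)) ^ n))
          = D * ((σ * (k / σ + c₀)) * (σ * (1 + (k / σ + c₀))) ^ n) := by
            rw [mul_pow]; ring
        _ = D * ((k + c₀ * σ) * (σ + (k + c₀ * σ)) ^ n) := by rw [g1, g2]
        _ ≤ K' := by rw [hK']; gcongr
    rw [h2] at h1
    linarith
  have hlow : τ' ≤ t₁ - τ' := by have := ht₁.1; linarith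
  have hy0 := hy0 t₁
  rw [le_div_iff₀ (by positivity)]
  have h1 : (t₁ - τ') ^ (n + 1) * y t₁ ≤ K' * (t₁ - τ') := by
    rw [sub_self, zero_pow (by omega), zero_mul, mul_zero, sub_zero] at hz
    linarith
  have h2 : τ' ^ (n + 1) * y t₁ ≤ (t₁ - τ') ^ (n + 1) * y t₁ := by gcongr
  have h3 : K' * (t₁ - τ') ≤ K' * S := by
    have := ht₁.2
    have := le_abs_self T
    gcongr
    linarith
  linarith

-- The energy of `ρ` localised by `η = ξ^(d+3)` has error terms at most `c₀ X`, with `X` the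
-- quantity of `exists_nash`. The dissipation absorbs them and leaves damping at an arbitrary rate,
-- so `le_of_forall_damping` applies with constants depending on moments only; Fatou's lemma removes
-- the cut-off.
set_option maxHeartbeats 1000000 in
theorem exists_integral_sq_le (hVW : HessianBounds V W)
    (hV : HasPolyGrowthDerivs (0 + 1) V) (hW : HasPolyGrowthDerivs (0 + 1) W)
    {a : ℝ} (ha : 0 < a) (E : ℝ) {τ T : ℝ} (hτ : 0 < τ) (m : ℕ) : ∃ K : ℝ, 0 ≤ K ∧
      ∀ ρ, Admissible V W a E ρ → ∀ t ∈ Icc τ T,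
        (Integrable fun x => wt x ^ m * ρ t x ^ 2) ∧ ∫ x, wt x ^ m * ρ t x ^ 2 ≤ K := by
  obtain ⟨B, hB, mb, hdrift⟩ := exists_drift_le hVW hV hW ha E T
  obtain ⟨A, hA, hcut⟩ := exists_gradSq_wcut_le (d := d) m
  obtain ⟨C, hC, hnash⟩ := exists_nash d
  -- The weight `Q = A' wt^J` has to dominate the cut-off, its gradient and its product with the
  -- drift.
  set J := m + mb + 1 with hJ
  obtain ⟨M₁, hM₁, hmom⟩ := exists_moment_le hVW ha E T (J * (d + 3))
  set A' := 1 + A + d * B ^ 2 with hA'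
  have hA'1 : 1 ≤ A' := by rw [hA']; have : 0 ≤ d * B ^ 2 := by positivity
                           linarith
  have hA'2 : A ≤ A' ^ 2 := by have : 0 ≤ d * B ^ 2 := by positivity
                               nlinarith
  have hA'3 : d * B ^ 2 ≤ A' ^ 2 := by have : 0 ≤ d * B ^ 2 := by positivity
                                       nlinarith
  set M := A' ^ (d + 3) * M₁ with hM
  -- The two constants of `energy_inequality`, the first multiplied by the square of the exponent `d
  -- + 3` of `ξ`.
  set c₀ : ℝ := 10 * ((d + 3 : ℕ) : ℝ) ^ 2 + 4 with hc₀
  set S : ℝ := |T| with hS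
  set κ : ℝ := ((d + 3 : ℕ) : ℝ) + c₀ * S with hκ
  set K' : ℝ := C * M ^ 2 * (κ * (S + κ) ^ (d + 2)) with hK'
  have hκ0 : 0 ≤ κ := by positivity
  have hK'0 : 0 ≤ K' := by positivity
  refine ⟨K' * S / (τ / 2) ^ (d + 3), by positivity, fun ρ hρ t₁ ht₁ => ?_⟩
  have hdr := hdrift ρ hρ
  have hmo := hmom ρ hρ
  obtain ⟨ρ₀, -, -, -, h⟩ := hρ
  have htpos : 0 < t₁ := hτ.trans_le ht₁.1
  -- estimate with a cut-off
  have key : ∀ R : ℝ, 1 ≤ R → ∫ x, ρ t₁ x ^ 2 * (wcut m R x ^ (d + 3)) ^ 2 ≤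
      K' * S / (τ / 2) ^ (d + 3) := by
    intro R hR
    set ξ : Space d → ℝ := wcut m R with hξ
    have hξ1 : ContDiff ℝ 1 ξ := contDiff_wcut (n := 1)
    have hξc : HasCompactSupport ξ := hasCompactSupport_wcut m (by linarith)
    set η : Space d → ℝ := fun x => ξ x ^ (d + 3) with hη
    have hη1 : ContDiff ℝ 1 η := hξ1.pow _
    have hηc : HasCompactSupport η := hξc.comp_left (g := fun y => y ^ (d + 3)) (by simp)
    set Q : Space d → ℝ := fun x => A' * wt x ^ J with hQ
    have hQc : Continuous Q := continuous_const.mul (continuous_wt.pow J)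
    have hξQ : ∀ x, ξ x ≤ Q x := fun x =>
      ((wcut_le m R x).trans (wt_pow_mono x (by omega))).trans
        (le_mul_of_one_le_left (pow_nonneg (wt_pos x).le _) hA'1)
    have hgQ : ∀ x, gradSq ξ x ≤ Q x ^ 2 := by
      intro x
      refine (hcut R hR x).trans ?_
      have h1 : wt x ^ (2 * m + 1) ≤ wt x ^ (2 * J) := wt_pow_mono x (by omega)
      have h2 : 0 ≤ wt x ^ (2 * m + 1) := pow_nonneg (wt_pos x).le _
      calc A * wt x ^ (2 * m + 1) ≤ A' ^ 2 * wt x ^ (2 * J) := by gcongr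
        _ = _ := by simp only [hQ]; ring
    set y : ℝ → ℝ := fun t => ∫ x, ρ t x ^ 2 * η x ^ 2 with hy
    set y' : ℝ → ℝ := fun t => ∫ x, 2 * (ρ t x * η x ^ 2) * deriv (fun τ => ρ τ x) t with hy'
    have hyd : ∀ t, 0 < t → HasDerivAt y (y' t) t := fun t ht =>
      h.hasDerivAt_integral_sq hη1 hηc ht
    -- differential inequality
    have hdiff : ∀ t ∈ Ioc 0 T, ∀ l : ℝ, 1 ≤ l → c₀ ≤ l →
        (l - c₀) * y t + y' t ≤ C * M ^ 2 * (l * (1 + l) ^ (d + 2)) := by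
      intro t ht l hl hlc
      have hn := h.isNiceDensity ht.1
      have hr1 : ContDiff ℝ 1 (ρ t) := (h.contDiff_space t ht.1).of_le (by norm_num)
      set X := ∫ x, ρ t x ^ 2 * ξ x ^ (2 * (d + 2)) * Q x ^ 2 with hX
      have hb : ∀ i, Continuous (drift V W (ρ t) i) := fun i =>
        (locBoundedDeriv_drift hVW hn i).1.continuous
      have hρc := hn.continuous
      have hξcont := hξ1.continuous
      have cs : ∀ {k : ℕ}, k ≠ 0 → HasCompactSupport fun x => ξ x ^ k := fun {k} hk =>
        hξc.comp_left (g := fun y => y ^ k) (zero_pow hk)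
      have iX : Integrable fun x => ρ t x ^ 2 * ξ x ^ (2 * (d + 2)) * Q x ^ 2 :=
        Continuous.integrable_of_hasCompactSupport (by fun_prop)
          ((cs (by omega)).mul_left.mul_right)
      have iy : Integrable fun x => ρ t x ^ 2 * η x ^ 2 :=
        Continuous.integrable_of_hasCompactSupport (by fun_prop)
          (HasCompactSupport.mul_left (hηc.comp_left (g := fun y => y ^ 2) (by norm_num)))
      have e1 := energy_inequality (h.contDiff_space t ht.1)
        (h.locBoundedDeriv_mul_drift hVW ht.1) hη1 hηc
      have e2 : y' t = _ := integral_congr_ae (Eventually.of_forall fun x => by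
        beta_reduce
        rw [h.deriv_eq ht.1 x])
      have e3 : ∫ x, (10 * (ρ t x ^ 2 * gradSq η x) +
          4 * (η x ^ 2 * ∑ i, (ρ t x * drift V W (ρ t) i x) ^ 2)) ≤ c₀ * X := by
        rw [hX, ← integral_const_mul]
        refine integral_mono_of_nonneg (Eventually.of_forall fun x => ?_) (iX.const_mul c₀)
          (Eventually.of_forall fun x => ?_)
        · have := gradSq_nonneg η x
          have : 0 ≤ ∑ i, (ρ t x * drift V W (ρ t) i x) ^ 2 :=
            Finset.sum_nonneg fun _ _ => sq_nonneg _
          positivity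
        · have f1 : gradSq η x ≤ ((d + 3 : ℕ) : ℝ) ^ 2 * (ξ x ^ (2 * (d + 2)) * Q x ^ 2) := by
            rw [hη, gradSq_pow (hξ1.differentiable (by norm_num))]
            calc _ ≤ (((d + 3 : ℕ) : ℝ) * ξ x ^ (d + 3 - 1)) ^ 2 * Q x ^ 2 :=
                  mul_le_mul_of_nonneg_left (hgQ x) (sq_nonneg _)
              _ = _ := by rw [show d + 3 - 1 = d + 2 by omega]; ring
          have f2 : ∑ i, (ρ t x * drift V W (ρ t) i x) ^ 2 ≤
              ρ t x ^ 2 * (d * B ^ 2 * wt x ^ (2 * mb)) := by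
            calc ∑ i, (ρ t x * drift V W (ρ t) i x) ^ 2
                ≤ ∑ _i : Fin d, ρ t x ^ 2 * (B * wt x ^ mb) ^ 2 := by
                  refine Finset.sum_le_sum fun i _ => ?_
                  rw [mul_pow, ← sq_abs (drift V W (ρ t) i x)]
                  have := (hdr t ht i).2 [] (Nat.zero_le _) x
                  rw [lderiv_nil] at this
                  gcongr
              _ = _ := by simp; ring
          have f3 : ξ x ^ 2 * (d * B ^ 2 * wt x ^ (2 * mb)) ≤ Q x ^ 2 := by
            have g1 := wcut_le m R x
            have g2 := wcut_nonneg m R x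
            have g3 : wt x ^ (2 * m + 2 * mb) ≤ wt x ^ (2 * J) := wt_pow_mono x (by omega)
            have g4 : 0 ≤ wt x ^ (2 * mb) := pow_nonneg (wt_pos x).le _
            have g5 : 0 ≤ wt x ^ (2 * m + 2 * mb) := pow_nonneg (wt_pos x).le _
            calc ξ x ^ 2 * (d * B ^ 2 * wt x ^ (2 * mb))
                ≤ (wt x ^ m) ^ 2 * (d * B ^ 2 * wt x ^ (2 * mb)) := by gcongr
              _ = (d * B ^ 2) * wt x ^ (2 * m + 2 * mb) := by ring
              _ ≤ A' ^ 2 * wt x ^ (2 * J) := by gcongr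
              _ = Q x ^ 2 := by simp only [hQ]; ring
          have f4 : η x ^ 2 * ∑ i, (ρ t x * drift V W (ρ t) i x) ^ 2 ≤
              ρ t x ^ 2 * ξ x ^ (2 * (d + 2)) * Q x ^ 2 := by
            calc _ ≤ η x ^ 2 * (ρ t x ^ 2 * (d * B ^ 2 * wt x ^ (2 * mb))) :=
                  mul_le_mul_of_nonneg_left f2 (sq_nonneg _)
              _ = ρ t x ^ 2 * ξ x ^ (2 * (d + 2)) * (ξ x ^ 2 * (d * B ^ 2 * wt x ^ (2 * mb))) := by
                  simp only [hη]; ring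
              _ ≤ _ := by
                  refine mul_le_mul_of_nonneg_left f3 ?_
                  have := wcut_nonneg m R x
                  positivity
          have f5 := mul_le_mul_of_nonneg_left f1 (sq_nonneg (ρ t x))
          beta_reduce
          rw [hc₀]
          linarith
      have e4 : y t ≤ X := by
        refine integral_mono iy iX fun x => ?_
        have g1 := hξQ x
        have g2 : 0 ≤ ξ x := wcut_nonneg m R x
        calc ρ t x ^ 2 * η x ^ 2 = ρ t x ^ 2 * ξ x ^ (2 * (d + 2)) * ξ x ^ 2 := by
              simp only [hη]; ring
          _ ≤ _ := by gcongr
      have hmt := hmo t ht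
      have eQ : ∀ x, Q x ^ (d + 3) * ρ t x = A' ^ (d + 3) * (wt x ^ (J * (d + 3)) * ρ t x) := by
        intro x
        simp only [hQ]
        rw [mul_pow, ← pow_mul]
        ring
      have e5 := hnash (ρ t) ξ Q M hr1 hn.nonneg hξ1 hξc (wcut_nonneg m R) hQc hξQ hgQ
        (by simp only [eQ]; exact hmt.1.const_mul _)
        (by simp only [eQ]; rw [integral_const_mul, hM]; exact mul_le_mul_of_nonneg_left hmt.2
              (by positivity)) l hl
      have e6 : (l - c₀) * y t ≤ (l - c₀) * X := mul_le_mul_of_nonneg_left e4 (by linarith)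
      rw [← e2] at e1
      change l * X ≤ _ at e5
      have e7 := e1.trans (add_le_add_right e3 _)
      linarith
    exact le_of_forall_damping (n := d + 2) (c₀ := c₀) (D := C * M ^ 2)
      (by rw [hc₀]; nlinarith [sq_nonneg ((d + 3 : ℕ) : ℝ)]) (by positivity) hyd
      (fun t => integral_nonneg fun x => by positivity) hdiff hτ ht₁
  have hn := h.isNiceDensity htpos
  have hρc := hn.continuous
  have hlim := integrable_of_tendsto_of_integral_le
    (F := fun (n : ℕ) x => ρ t₁ x ^ 2 * (wcut m ((n : ℝ) + 1) x ^ (d + 3)) ^ 2)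
    (f := fun x => ρ t₁ x ^ 2 * ((wt x ^ m) ^ (d + 3)) ^ 2)
    (fun n => by
      have hc : Continuous (wcut (d := d) m ((n : ℝ) + 1)) := (contDiff_wcut (n := 0)).continuous
      refine Continuous.integrable_of_hasCompactSupport (by fun_prop) ?_
      exact HasCompactSupport.mul_left ((hasCompactSupport_wcut m (by positivity)).comp_left
        (g := fun y => (y ^ (d + 3)) ^ 2) (by simp)))
    (fun n x => by positivity)
    (by have := continuous_wt (d := d); exact Continuous.measurable (by fun_prop))
    (fun x => tendsto_const_nhds.congr' (by
      filter_upwards [tendsto_wcut m x] with n hn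
      rw [hn]))
    (fun n => key _ (by linarith [(Nat.cast_nonneg n : (0:ℝ) ≤ n)]))
  -- The argument yields the larger weight `wt^(2 m (d + 3))`, of which only `wt^m` is kept.
  have hle : ∀ x, wt x ^ m * ρ t₁ x ^ 2 ≤ ρ t₁ x ^ 2 * ((wt x ^ m) ^ (d + 3)) ^ 2 := by
    intro x
    rw [mul_comm, ← pow_mul, ← pow_mul]
    exact mul_le_mul_of_nonneg_left (wt_pow_mono x (by nlinarith)) (sq_nonneg _)
  have hint : Integrable fun x => wt x ^ m * ρ t₁ x ^ 2 := by
    refine hlim.1.mono' ?_ (Eventually.of_forall fun x => ?_)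
    · exact ((continuous_wt.pow m).mul (hρc.pow 2)).aestronglyMeasurable
    · rw [Real.norm_eq_abs, abs_of_nonneg (mul_nonneg (pow_nonneg (wt_pos x).le m) (sq_nonneg _))]
      exact hle x
  exact ⟨hint, (integral_mono hint hlim.1 hle).trans hlim.2⟩

end LTwo


/-! ### Mollification -/

section Mollify

variable {ψ φ f r : Space d → ℝ}

/-- `ψ` is a smooth function with compact support. -/
structure IsTest (ψ : Space d → ℝ) : Prop where
  contDiff : ContDiff ℝ ∞ ψ
  hasCompactSupport : HasCompactSupport ψ

theorem IsTest.lderiv (h : IsTest ψ) (L : List (Fin d)) : IsTest (lderiv L ψ) :=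
  ⟨contDiff_lderiv_infty L h.1, hasCompactSupport_lderiv L h.2⟩

theorem IsTest.partialDeriv (h : IsTest ψ) (i : Fin d) : IsTest (partialDeriv i ψ) := h.lderiv [i]

theorem IsTest.continuous (h : IsTest ψ) : Continuous ψ := h.1.continuous

theorem IsTest.contDiff_one (h : IsTest ψ) : ContDiff ℝ 1 ψ :=
  h.1.of_le (by exact_mod_cast le_top)

theorem IsTest.sub_left (h : IsTest ψ) (x : Space d) : IsTest fun y => ψ (x - y) :=
  ⟨h.1.comp (contDiff_const.sub contDiff_id),
    h.2.comp_homeomorph (Homeomorph.subLeft x)⟩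

theorem IsTest.integrable_mul (h : IsTest ψ) (hr : Continuous r) (x : Space d) :
    Integrable fun y => r y * ψ (x - y) :=
  (hr.mul (h.sub_left x).continuous).integrable_of_hasCompactSupport
    (h.sub_left x).hasCompactSupport.mul_left

theorem IsTest.contDiff_conv (h : IsTest ψ) (hr : Continuous r) : ContDiff ℝ ∞ (conv ψ r) :=
  h.2.contDiff_convolution_right _ hr.locallyIntegrable h.1

theorem IsTest.partialDeriv_conv (h : IsTest ψ) (hr : Continuous r) (i : Fin d) :
    McKeanVlasov.partialDeriv i (conv ψ r) = conv (McKeanVlasov.partialDeriv i ψ) r := by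
  ext x
  have h1 := h.2.hasFDerivAt_convolution_right (ContinuousLinearMap.mul ℝ ℝ)
    (μ := volume) hr.locallyIntegrable h.contDiff_one x
  change fderiv ℝ (r ⋆[ContinuousLinearMap.mul ℝ ℝ, volume] ψ) x _ = _
  rw [h1.fderiv, convolution_precompR_apply _ hr.locallyIntegrable (h.2.fderiv ℝ)
    (h.contDiff_one.continuous_fderiv one_ne_zero)]
  rfl

theorem IsTest.lderiv_conv (h : IsTest ψ) (hr : Continuous r) (L : List (Fin d)) :
    McKeanVlasov.lderiv L (conv ψ r) = conv (McKeanVlasov.lderiv L ψ) r := by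
  induction L with
  | nil => rfl
  | cons i L ih => rw [lderiv_cons, ih, (h.lderiv L).partialDeriv_conv hr, lderiv_cons]

theorem IsTest.partialDeriv_sub_left (h : IsTest ψ) (x y : Space d) (i : Fin d) :
    McKeanVlasov.partialDeriv i (fun y => ψ (x - y)) y =
      -McKeanVlasov.partialDeriv i ψ (x - y) := by
  have h1 : HasFDerivAt ψ (fderiv ℝ ψ (x - y)) (x - y) :=
    (h.contDiff_one.differentiable one_ne_zero _).hasFDerivAt
  have h2 := h1.comp y ((hasFDerivAt_id y).const_sub x)
  change fderiv ℝ (ψ ∘ HSub.hSub x) y _ = _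
  rw [h2.fderiv]
  simp [McKeanVlasov.partialDeriv]

theorem IsTest.conv_partialDeriv (h : IsTest ψ) (hf : LocBoundedDeriv f) (i : Fin d) :
    conv ψ (McKeanVlasov.partialDeriv i f) = conv (McKeanVlasov.partialDeriv i ψ) f := by
  ext x
  rw [conv_apply, conv_apply, integral_partialDeriv_mul hf (h.sub_left x).contDiff_one
    (h.sub_left x).hasCompactSupport, ← integral_neg]
  simp only [h.partialDeriv_sub_left, mul_neg, neg_neg]

theorem IsTest.conv_lderiv {L : List (Fin d)} (h : IsTest ψ) (hf : ContDiff ℝ L.length f) :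
    conv ψ (McKeanVlasov.lderiv L f) = conv (McKeanVlasov.lderiv L ψ) f := by
  induction L generalizing ψ with
  | nil => rfl
  | cons i L ih =>
    have h1 : ContDiff ℝ 1 (McKeanVlasov.lderiv L f) :=
      contDiff_lderiv (n := 1) (m := (L.length + 1 : ℕ)) L (by simpa using hf)
        (by push_cast; rw [add_comm])
    rw [lderiv_cons, h.conv_partialDeriv (.of_contDiff h1), ih (h.partialDeriv i)
      (hf.of_le (by simp))]
    congr 1
    have := lderiv_append L [i] ψ
    rw [lderiv_cons, lderiv_nil] at this
    rw [← this]
    exact lderiv_perm (List.perm_append_singleton i L)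
      (h.contDiff.of_le (by exact_mod_cast le_top))

theorem IsTest.continuousOn_conv (h : IsTest ψ) {g : ℝ → Space d → ℝ}
    (hg : ContinuousOn (fun p : ℝ × Space d => g p.1 p.2) (Ioi 0 ×ˢ univ)) :
    ContinuousOn (fun p : ℝ × Space d => conv ψ (g p.1) p.2) (Ioi 0 ×ˢ univ) := by
  -- After the change of variables the compact support no longer moves with the point `p`.
  have h1 : (fun p : ℝ × Space d => conv ψ (g p.1) p.2) =
      fun p => ∫ y, g p.1 (p.2 - y) * ψ y := by
    ext p
    rw [conv_apply, ← integral_sub_left_eq_self _ volume p.2]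
    simp
  rw [h1]
  refine continuousOn_integral_of_compact_support (f := fun (p : ℝ × Space d) y => g p.1 (p.2 - y) * ψ y)
    h.2 ?_ fun p x _ hx => by simp [image_eq_zero_of_notMem_tsupport hx]
  refine ContinuousOn.mul ?_ (h.continuous.comp continuous_snd).continuousOn
  refine hg.comp (f := fun q : (ℝ × Space d) × Space d => (q.1.1, q.1.2 - q.2)) (by fun_prop) ?_
  exact fun q hq => ⟨hq.1.1, mem_univ _⟩

/-- A smooth probability density supported in the unit ball. -/
structure IsMollifier (φ : Space d → ℝ) : Prop where
  contDiff : ContDiff ℝ ∞ φ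
  nonneg : ∀ x, 0 ≤ φ x
  integral_eq : ∫ x, φ x = 1
  eq_zero : ∀ x, 1 < ‖x‖ → φ x = 0

theorem IsMollifier.isTest (h : IsMollifier φ) : IsTest φ := by
  refine ⟨h.1, .of_support_subset_isCompact (isCompact_closedBall (0 : Space d) 1) fun x hx => ?_⟩
  by_contra hx'
  exact hx (h.eq_zero x (by simpa using hx'))

theorem IsMollifier.integral_sub_left (h : IsMollifier φ) (x : Space d) :
    ∫ y, φ (x - y) = 1 := by
  rw [integral_sub_left_eq_self φ volume x, h.integral_eq]

theorem IsMollifier.abs_conv_le (h : IsMollifier φ) (hr : Continuous r) {x : Space d} {M : ℝ}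
    (hM : ∀ y, ‖x - y‖ ≤ 1 → |r y| ≤ M) : |conv φ r x| ≤ M := by
  rw [conv_apply]
  calc |∫ y, r y * φ (x - y)| ≤ ∫ y, |r y * φ (x - y)| := abs_integral_le_integral_abs
    _ ≤ ∫ y, M * φ (x - y) := by
        refine integral_mono (h.isTest.integrable_mul hr x).abs ?_ fun y => ?_
        · exact ((h.isTest.sub_left x).continuous.integrable_of_hasCompactSupport
            (h.isTest.sub_left x).2).const_mul M
        · beta_reduce
          rw [abs_mul, abs_of_nonneg (h.nonneg _)]
          by_cases hy : ‖x - y‖ ≤ 1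
          · exact mul_le_mul_of_nonneg_right (hM y hy) (h.nonneg _)
          · rw [h.eq_zero _ (by linarith)]; simp
    _ = M := by rw [integral_const_mul, h.integral_sub_left, mul_one]

/-- Jensen's inequality for the probability density `φ (x - ·)`, in the form that a variance is
nonnegative. -/
theorem IsMollifier.conv_sq_le (h : IsMollifier φ) (hr : Continuous r) (x : Space d) :
    conv φ r x ^ 2 ≤ ∫ y, r y ^ 2 * φ (x - y) := by
  set c := conv φ r x with hc
  have i1 : Integrable fun y => r y ^ 2 * φ (x - y) := h.isTest.integrable_mul (hr.pow 2) x
  have i2 := h.isTest.integrable_mul hr x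
  have i3 : Integrable fun y => φ (x - y) := (h.isTest.sub_left x).continuous.integrable_of_hasCompactSupport
    (h.isTest.sub_left x).2
  have h1 : 0 ≤ ∫ y, (r y - c) ^ 2 * φ (x - y) :=
    integral_nonneg fun y => mul_nonneg (sq_nonneg _) (h.nonneg _)
  have h2 : ∫ y, (r y - c) ^ 2 * φ (x - y) = (∫ y, r y ^ 2 * φ (x - y)) - 2 * c * c + c ^ 2 := by
    have : ∀ y, (r y - c) ^ 2 * φ (x - y) = r y ^ 2 * φ (x - y) - 2 * c * (r y * φ (x - y)) +
        c ^ 2 * φ (x - y) := fun y => by ring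
    simp only [this]
    have i4 : Integrable fun y => r y ^ 2 * φ (x - y) - 2 * c * (r y * φ (x - y)) :=
      i1.sub (i2.const_mul _)
    rw [integral_add i4 (i3.const_mul _), integral_sub i1 (i2.const_mul _), integral_const_mul, integral_const_mul,
      h.integral_sub_left, show ∫ y, r y * φ (x - y) = c from rfl, mul_one]
  nlinarith

/-- Weighted convolution inequality. -/
theorem IsMollifier.lintegral_conv_sq_le (h : IsMollifier φ) (hr : Continuous r) (m : ℕ) :
    ∫⁻ x, ENNReal.ofReal (wt x ^ m * conv φ r x ^ 2) ≤
      4 ^ m * ∫⁻ x, ENNReal.ofReal (wt x ^ m * r x ^ 2) := by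
  have hw := continuous_wt (d := d)
  have hφ := h.isTest.continuous
  have h1 : ∀ x, ENNReal.ofReal (wt x ^ m * conv φ r x ^ 2) ≤
      ∫⁻ y, ENNReal.ofReal (4 ^ m * (wt y ^ m * r y ^ 2)) * ENNReal.ofReal (φ (x - y)) := by
    intro x
    have h2 : wt x ^ m * conv φ r x ^ 2 ≤ ∫ y, 4 ^ m * (wt y ^ m * r y ^ 2) * φ (x - y) := by
      calc wt x ^ m * conv φ r x ^ 2 ≤ wt x ^ m * ∫ y, r y ^ 2 * φ (x - y) :=
            mul_le_mul_of_nonneg_left (h.conv_sq_le hr x) (pow_nonneg (wt_pos x).le m)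
        _ = ∫ y, wt x ^ m * (r y ^ 2 * φ (x - y)) := (integral_const_mul _ _).symm
        _ ≤ _ := by
          refine integral_mono ((h.isTest.integrable_mul (hr.pow 2) x).const_mul _)
            (h.isTest.integrable_mul (by fun_prop) x) fun y => ?_
          beta_reduce
          by_cases hy : ‖x - y‖ ≤ 1
          · have := pow_le_pow_left₀ (wt_pos x).le (wt_le_of_norm_sub_le hy) m
            rw [mul_pow] at this
            have h3 := mul_le_mul_of_nonneg_right this
              (mul_nonneg (sq_nonneg (r y)) (h.nonneg (x - y)))
            linarith
          · rw [h.eq_zero _ (by linarith)]; simp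
    refine (ENNReal.ofReal_le_ofReal h2).trans ?_
    rw [ofReal_integral_eq_lintegral_ofReal (h.isTest.integrable_mul (by fun_prop) x)
      (Eventually.of_forall fun y => mul_nonneg (mul_nonneg (by positivity)
        (mul_nonneg (pow_nonneg (wt_pos y).le m) (sq_nonneg _))) (h.nonneg _))]
    refine lintegral_mono fun y => ?_
    rw [ENNReal.ofReal_mul (mul_nonneg (by positivity)
        (mul_nonneg (pow_nonneg (wt_pos y).le m) (sq_nonneg _)))]
  refine (lintegral_mono h1).trans ?_
  rw [lintegral_lintegral_swap (by fun_prop)]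
  have h4 : ∀ y, ∫⁻ x, ENNReal.ofReal (4 ^ m * (wt y ^ m * r y ^ 2)) * ENNReal.ofReal (φ (x - y)) =
      4 ^ m * ENNReal.ofReal (wt y ^ m * r y ^ 2) := by
    intro y
    rw [lintegral_const_mul _ (by fun_prop),
      lintegral_sub_right_eq_self (fun x => ENNReal.ofReal (φ x)) y,
      ← ofReal_integral_eq_lintegral_ofReal
        (hφ.integrable_of_hasCompactSupport h.isTest.2) (Eventually.of_forall h.nonneg),
      h.integral_eq, ENNReal.ofReal_one, mul_one, ENNReal.ofReal_mul (by positivity)]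
    congr 1
    rw [ENNReal.ofReal_pow (by norm_num)]
    norm_num
  simp only [h4]
  rw [lintegral_const_mul _ (by fun_prop)]

theorem exists_mollifier_seq (d : ℕ) : ∃ φ : ℕ → Space d → ℝ, (∀ n, IsMollifier (φ n)) ∧
    ∀ r : Space d → ℝ, Continuous r → ∀ x, Tendsto (fun n => conv (φ n) r x) atTop (𝓝 (r x)) := by
  let φ : ℕ → ContDiffBump (0 : Space d) := fun n =>
    ⟨1 / ((n : ℝ) + 1) / 2, 1 / ((n : ℝ) + 1), by positivity, half_lt_self (by positivity)⟩
  refine ⟨fun n => (φ n).normed volume, fun n => ⟨(φ n).contDiff_normed, (φ n).nonneg_normed,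
    (φ n).integral_normed, fun x hx => ?_⟩, fun r hr x => ?_⟩
  · have h1 : x ∉ Function.support ((φ n).normed volume) := by
      rw [(φ n).support_normed_eq, Metric.mem_ball, dist_zero_right, not_lt]
      refine le_trans ?_ hx.le
      change 1 / ((n : ℝ) + 1) ≤ 1
      rw [div_le_one (by positivity)]
      linarith [(Nat.cast_nonneg n : (0:ℝ) ≤ n)]
    simpa using h1
  · have h1 : Tendsto (fun n => (φ n).rOut) atTop (𝓝 0) := tendsto_one_div_add_atTop_nhds_zero_nat
    have h2 := ContDiffBump.convolution_tendsto_right_of_continuous (μ := volume) h1 hr x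
    refine h2.congr fun n => ?_
    rw [conv_apply, ← integral_sub_left_eq_self _ volume x, convolution_def]
    simp [mul_comm]

/-- The mollifiers live in the unit ball, so on the support of `ψ (x - ·)` all mollifications of `r`
are bounded by the maximum of `|r|` on a slightly larger ball, and dominated convergence applies. -/
theorem IsTest.tendsto_conv_mul (hψ : IsTest ψ) {φ : ℕ → Space d → ℝ}
    (hφ : ∀ n, IsMollifier (φ n))
    (hlim : ∀ r : Space d → ℝ, Continuous r → ∀ x,
      Tendsto (fun n => conv (φ n) r x) atTop (𝓝 (r x)))
    {r b : Space d → ℝ} (hr : Continuous r) (hb : Continuous b) (x : Space d) :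
    Tendsto (fun n => conv ψ (fun y => conv (φ n) r y * b y) x) atTop
      (𝓝 (conv ψ (fun y => r y * b y) x)) := by
  obtain ⟨R, hR⟩ := (hψ.sub_left x).2.isBounded.subset_closedBall 0
  obtain ⟨M, hM⟩ := (isCompact_closedBall (0 : Space d) (R + 1)).exists_bound_of_continuousOn
    hr.continuousOn
  have hc : ∀ n, Continuous (conv (φ n) r) := fun n => ((hφ n).isTest.contDiff_conv hr).continuous
  refine tendsto_integral_of_dominated_convergence (fun y => M * |b y * ψ (x - y)|) ?_ ?_ ?_ ?_
  · exact fun n => (hψ.integrable_mul ((hc n).mul hb) x).aestronglyMeasurable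
  · exact ((hψ.integrable_mul hb x).abs).const_mul M
  · refine fun n => Eventually.of_forall fun y => ?_
    by_cases hy : y ∈ tsupport fun y => ψ (x - y)
    · have h1 := hR hy
      rw [mem_closedBall_zero_iff] at h1
      have h2 : |conv (φ n) r y| ≤ M := (hφ n).abs_conv_le hr fun z hz => hM z (by
        rw [mem_closedBall_zero_iff]
        have := norm_sub_norm_le z y
        rw [norm_sub_rev] at this
        linarith)
      change ‖conv (φ n) r y * b y * ψ (x - y)‖ ≤ _
      rw [Real.norm_eq_abs, mul_assoc, abs_mul]
      exact mul_le_mul_of_nonneg_right h2 (abs_nonneg _)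
    · have : ψ (x - y) = 0 := image_eq_zero_of_notMem_tsupport (f := fun y => ψ (x - y)) hy
      simp [this]
  · exact Eventually.of_forall fun y => ((hlim r hr y).mul_const (b y)).mul_const (ψ (x - y))

end Mollify


/-! ### Weighted square integrals of mollified derivatives -/

section WeightedSq

variable {φ ψ f g r b : Space d → ℝ}

theorem lderiv_add {L : List (Fin d)} (hf : ContDiff ℝ L.length f) (hg : ContDiff ℝ L.length g) :
    lderiv L (fun x => f x + g x) = fun x => lderiv L f x + lderiv L g x := by
  induction L with
  | nil => rfl
  | cons i L ih =>
    have h : ∀ {u : Space d → ℝ}, ContDiff ℝ (i :: L).length u → Differentiable ℝ (lderiv L u) :=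
      fun {u} hu => (contDiff_lderiv (n := 1) (m := (L.length + 1 : ℕ)) L (by simpa using hu)
        (by push_cast; rw [add_comm])).differentiable one_ne_zero
    rw [lderiv_cons, ih (hf.of_le (by simp)) (hg.of_le (by simp)),
      partialDeriv_add (h hf) (h hg), lderiv_cons, lderiv_cons]

/-- The Leibniz rule in crude form: each derivative doubles the number of terms. Splitting off the
innermost derivative lets the same bounds `F` and `M` serve in both terms. -/
theorem abs_lderiv_mul_le {x : Space d} {F M : ℝ} {L : List (Fin d)} (hf : ContDiff ℝ L.length f)
    (hg : ContDiff ℝ L.length g)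
    (hF : ∀ L' : List (Fin d), L'.length ≤ L.length → |lderiv L' f x| ≤ F)
    (hM : ∀ L' : List (Fin d), L'.length ≤ L.length → |lderiv L' g x| ≤ M) :
    |lderiv L (fun y => f y * g y) x| ≤ 2 ^ L.length * (F * M) := by
  induction L using List.reverseRecOn generalizing f g with
  | nil =>
    have h1 := hF [] le_rfl
    have h2 := hM [] le_rfl
    simp only [lderiv_nil] at h1 h2
    simp only [lderiv_nil, List.length_nil, pow_zero, one_mul, abs_mul]
    exact mul_le_mul h1 h2 (abs_nonneg _) ((abs_nonneg _).trans h1)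
  | append_singleton L i ih =>
    rw [List.length_append, List.length_singleton] at hf hg hF hM
    have hn : (1 : WithTop ℕ∞) ≤ ((L.length + 1 : ℕ) : WithTop ℕ∞) := by
      exact_mod_cast Nat.le_add_left 1 L.length
    have hl : (L.length : WithTop ℕ∞) ≤ ((L.length + 1 : ℕ) : WithTop ℕ∞) := by
      exact_mod_cast Nat.le_succ _
    have hd : ∀ {u : Space d → ℝ}, ContDiff ℝ (L.length + 1 : ℕ) u →
        ContDiff ℝ L.length (partialDeriv i u) := fun {u} hu =>
      contDiff_partialDeriv (n := L.length) (m := (L.length + 1 : ℕ)) hu (by push_cast; rfl) i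
    have hD : ∀ {u : Space d → ℝ} {K : ℝ},
        (∀ L' : List (Fin d), L'.length ≤ L.length + 1 → |lderiv L' u x| ≤ K) →
        ∀ L' : List (Fin d), L'.length ≤ L.length → |lderiv L' (partialDeriv i u) x| ≤ K := by
      intro u K hu L' hL'
      have := hu (L' ++ [i]) (by simpa using hL')
      rwa [lderiv_append] at this
    rw [lderiv_append, lderiv_cons, lderiv_nil,
      partialDeriv_mul ((hf.of_le hn).differentiable one_ne_zero)
        ((hg.of_le hn).differentiable one_ne_zero),
      lderiv_add (f := fun y => partialDeriv i f y * g y) ((hd hf).mul (hg.of_le hl))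
        ((hf.of_le hl).mul (hd hg)), List.length_append, List.length_singleton, pow_succ]
    have h1 := ih (hd hf) (hg.of_le hl) (hD hF) fun L' h => hM L' (h.trans (Nat.le_succ _))
    have h2 := ih (hf.of_le hl) (hd hg) (fun L' h => hF L' (h.trans (Nat.le_succ _))) (hD hM)
    exact (abs_add_le _ _).trans (by linarith)

/-- The square of the weighted `L²` norm of `u`. -/
def weightedSq (m : ℕ) (u : Space d → ℝ) : ℝ≥0∞ :=
  ∫⁻ x, ENNReal.ofReal (wt x ^ m * u x ^ 2)

theorem weightedSq_mono {m n : ℕ} (h : m ≤ n) (u : Space d → ℝ) :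
    weightedSq m u ≤ weightedSq n u :=
  lintegral_mono fun x => ENNReal.ofReal_le_ofReal
    (mul_le_mul_of_nonneg_right (wt_pow_mono x h) (sq_nonneg _))

/-- The lists of directions of length at most `k`. -/
def dirLists (d k : ℕ) : Finset (List (Fin d)) := (List.finite_length_le (Fin d) k).toFinset

theorem mem_dirLists {k : ℕ} {L : List (Fin d)} : L ∈ dirLists d k ↔ L.length ≤ k := by
  simp [dirLists]

theorem weightedSq_lderiv_mul_le {k m n : ℕ} {B : ℝ} (hf : ContDiff ℝ ∞ f) (hb : ContDiff ℝ k b)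
    (hB : ∀ L : List (Fin d), L.length ≤ k → ∀ x, |lderiv L b x| ≤ B * wt x ^ n)
    {L : List (Fin d)} (hL : L.length ≤ k) :
    weightedSq m (lderiv L fun y => f y * b y) ≤
      ENNReal.ofReal (4 ^ k * B ^ 2 * (dirLists d k).card) *
        ∑ L' ∈ dirLists d k, weightedSq (m + 2 * n) (lderiv L' f) := by
  have hc : ∀ L' : List (Fin d), Continuous (lderiv L' f) := fun L' =>
    (contDiff_lderiv_infty L' hf).continuous
  have hw := continuous_wt (d := d)
  have hB0 : 0 ≤ 4 ^ k * B ^ 2 * ((dirLists d k).card : ℝ) := by positivity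
  have h1 : ∀ x, wt x ^ m * lderiv L (fun y => f y * b y) x ^ 2 ≤
      4 ^ k * B ^ 2 * (dirLists d k).card *
        ∑ L' ∈ dirLists d k, wt x ^ (m + 2 * n) * lderiv L' f x ^ 2 := by
    intro x
    set F := ∑ L' ∈ dirLists d k, |lderiv L' f x| with hF
    have h2 : |lderiv L (fun y => f y * b y) x| ≤ 2 ^ k * (F * (B * wt x ^ n)) := by
      have h0 : 0 ≤ B * wt x ^ n := (abs_nonneg _).trans (hB [] (Nat.zero_le _) x)
      have hF0 : 0 ≤ F := Finset.sum_nonneg fun _ _ => abs_nonneg _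
      refine (abs_lderiv_mul_le (F := F) (M := B * wt x ^ n) (hf.of_le (by exact_mod_cast le_top))
        (hb.of_le (by exact_mod_cast hL)) (fun L' hL' => ?_)
        fun L' hL' => hB L' (hL'.trans hL) x).trans ?_
      · exact Finset.single_le_sum (f := fun L' => |lderiv L' f x|) (fun _ _ => abs_nonneg _)
          (mem_dirLists.2 (hL'.trans hL))
      · gcongr
        norm_num
    have h3 : F ^ 2 ≤ (dirLists d k).card * ∑ L' ∈ dirLists d k, lderiv L' f x ^ 2 := by
      refine (sq_sum_le_card_mul_sum_sq).trans (le_of_eq ?_)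
      simp only [sq_abs]
    have hw0 := (wt_pos x).le
    calc wt x ^ m * lderiv L (fun y => f y * b y) x ^ 2
        ≤ wt x ^ m * (2 ^ k * (F * (B * wt x ^ n))) ^ 2 := by
          rw [← sq_abs (lderiv L (fun y => f y * b y) x)]
          gcongr
      _ = wt x ^ (m + 2 * n) * ((2 ^ 2) ^ k * B ^ 2) * F ^ 2 := by
          rw [← pow_mul 2 2 k]; ring
      _ ≤ wt x ^ (m + 2 * n) * ((2 ^ 2) ^ k * B ^ 2) *
          ((dirLists d k).card * ∑ L' ∈ dirLists d k, lderiv L' f x ^ 2) := by gcongr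
      _ = _ := by rw [← Finset.mul_sum]; norm_num; ring
  unfold weightedSq
  refine (lintegral_mono fun x => ENNReal.ofReal_le_ofReal (h1 x)).trans (le_of_eq ?_)
  rw [← lintegral_finsetSum _ fun L' _ => by have := hc L'; fun_prop,
    ← lintegral_const_mul' _ _ ENNReal.ofReal_ne_top]
  refine lintegral_congr fun x => ?_
  rw [ENNReal.ofReal_mul hB0, ENNReal.ofReal_sum_of_nonneg fun L' _ =>
    mul_nonneg (pow_nonneg (wt_pos x).le _) (sq_nonneg _)]

theorem weightedSq_le_liminf {u : ℕ → Space d → ℝ} {v : Space d → ℝ} {m : ℕ}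
    (hu : ∀ n, Continuous (u n)) (h : ∀ x, Tendsto (fun n => u n x) atTop (𝓝 (v x))) :
    weightedSq m v ≤ liminf (fun n => weightedSq m (u n)) atTop := by
  have hw := continuous_wt (d := d)
  refine le_trans (le_of_eq ?_) (lintegral_liminf_le
    (f := fun n x => ENNReal.ofReal (wt x ^ m * u n x ^ 2)) fun n => by have := hu n; fun_prop)
  refine lintegral_congr fun x => ?_
  exact ((ENNReal.tendsto_ofReal (((h x).pow 2).const_mul _)).liminf_eq).symm

/-- A Leibniz estimate for `∂^L (r b)` when `r` is only continuous. Replace `r` by the smooth `Φ j *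
r`, move `∂^L` off `φ` onto the product, expand, and let `j → ∞` by Fatou's lemma. The growth of `b`
raises the weight by `2 n`. -/
theorem weightedSq_conv_mul_le {k m n : ℕ} {B : ℝ} (hφ : IsMollifier φ) {Φ : ℕ → Space d → ℝ}
    (hΦ : ∀ n, IsMollifier (Φ n))
    (hlim : ∀ r : Space d → ℝ, Continuous r → ∀ x,
      Tendsto (fun n => conv (Φ n) r x) atTop (𝓝 (r x)))
    (hr : Continuous r) (hb : ContDiff ℝ k b)
    (hB : ∀ L : List (Fin d), L.length ≤ k → ∀ x, |lderiv L b x| ≤ B * wt x ^ n)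
    {L : List (Fin d)} (hL : L.length ≤ k) :
    weightedSq m (conv (lderiv L φ) fun y => r y * b y) ≤
      liminf (fun j => 4 ^ m * (ENNReal.ofReal (4 ^ k * B ^ 2 * (dirLists d k).card) *
        ∑ L' ∈ dirLists d k, weightedSq (m + 2 * n) (conv (lderiv L' (Φ j)) r))) atTop := by
  have hc : ∀ j, ContDiff ℝ ∞ (conv (Φ j) r) := fun j => (hΦ j).isTest.contDiff_conv hr
  have hcb : ∀ j, ContDiff ℝ k fun y => conv (Φ j) r y * b y := fun j =>
    ((hc j).of_le (by exact_mod_cast le_top)).mul hb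
  refine (weightedSq_le_liminf (u := fun j => conv (lderiv L φ) fun y => conv (Φ j) r y * b y)
    (fun j => ((hφ.isTest.lderiv L).contDiff_conv (hcb j).continuous).continuous)
    ((hφ.isTest.lderiv L).tendsto_conv_mul hΦ hlim hr hb.continuous)).trans ?_
  refine liminf_le_liminf (Eventually.of_forall fun j => ?_)
  have hcL : ContDiff ℝ L.length fun y => conv (Φ j) r y * b y :=
    (hcb j).of_le (by exact_mod_cast hL)
  rw [← hφ.isTest.conv_lderiv hcL]
  refine (hφ.lintegral_conv_sq_le (contDiff_lderiv (n := 0) (m := L.length) L hcL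
    (by simp)).continuous m).trans (mul_le_mul_right ?_ _)
  refine (weightedSq_lderiv_mul_le (m := m) (hc j) hb hB hL).trans (le_of_eq ?_)
  simp only [(hΦ j).isTest.lderiv_conv hr]

theorem aemeasurable_weightedSq_conv (hψ : IsTest ψ) {g : ℝ → Space d → ℝ}
    (hg : ContinuousOn (fun p : ℝ × Space d => g p.1 p.2) (Ioi 0 ×ˢ univ)) {τ T : ℝ} (hτ : 0 < τ)
    (m : ℕ) : AEMeasurable (fun t => weightedSq m (conv ψ (g t))) (volume.restrict (Icc τ T)) := by
  refine AEMeasurable.lintegral_prod_right'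
    (f := fun p : ℝ × Space d => ENNReal.ofReal (wt p.2 ^ m * conv ψ (g p.1) p.2 ^ 2)) ?_
  rw [← Measure.restrict_univ (μ := (volume : Measure (Space d))), Measure.prod_restrict]
  refine (ContinuousOn.aemeasurable (f := fun p : ℝ × Space d => wt p.2 ^ m * conv ψ (g p.1) p.2 ^ 2)
    ?_ (measurableSet_Icc.prod MeasurableSet.univ)).ennreal_ofReal
  refine ((continuous_wt.comp continuous_snd).pow m).continuousOn.mul
    (((hψ.continuousOn_conv hg).mono ?_).pow 2)
  exact prod_mono (fun t ht => hτ.trans_le ht.1) subset_rfl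

end WeightedSq


/-! ### Energy estimates for mollified solutions -/

theorem ofReal_integral_le_lintegral {α : Type*} [MeasurableSpace α] {μ : Measure α} (f : α → ℝ) :
    ENNReal.ofReal (∫ x, f x ∂μ) ≤ ∫⁻ x, ENNReal.ofReal (f x) ∂μ := by
  by_cases hf : Integrable f μ
  · rw [integral_eq_lintegral_pos_part_sub_lintegral_neg_part hf]
    exact (ENNReal.ofReal_le_ofReal (sub_le_self _ ENNReal.toReal_nonneg)).trans
      ENNReal.ofReal_toReal_le
  · simp [integral_undef hf]

/-- Integrate the derivative of `(t - τ) y`: the factor kills the initial value at the price of the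
integral of `y`, which `Φ` also controls. -/
theorem sub_mul_add_integral_le {y y' D : ℝ → ℝ} {Φ : ℝ → ℝ≥0∞} {K τ T : ℝ} (hτ : 0 < τ)
    (hK : 0 ≤ K) (hyd : ∀ t, 0 < t → HasDerivAt y (y' t) t) (hy' : ContinuousOn y' (Ioi 0))
    (hD : ContinuousOn D (Ioi 0)) (h1 : ∀ t ∈ Icc τ T, ENNReal.ofReal (y t) ≤ Φ t)
    (h2 : ∀ t ∈ Icc τ T, ENNReal.ofReal (y' t + D t) ≤ Φ t)
    (hΦ : ∫⁻ t in Icc τ T, Φ t ≤ ENNReal.ofReal K) {t : ℝ} (ht : t ∈ Icc τ T) :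
    (t - τ) * y t + ∫ σ in τ..t, (σ - τ) * D σ ≤ (1 + (T - τ)) * K := by
  have hT : τ ≤ T := ht.1.trans ht.2
  have hsub : uIcc τ t ⊆ Ioi 0 := by
    rw [uIcc_of_le ht.1]
    exact fun σ hσ => hτ.trans_le hσ.1
  have hyc : ContinuousOn y (Ioi 0) := fun σ hσ => (hyd σ hσ).continuousAt.continuousWithinAt
  have hzd : ∀ σ ∈ uIcc τ t, HasDerivAt (fun σ => (σ - τ) * y σ) (1 * y σ + (σ - τ) * y' σ) σ :=
    fun σ hσ => ((hasDerivAt_id σ).sub_const τ).mul (hyd σ (hsub hσ))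
  have c1 : ContinuousOn (fun σ => 1 * y σ + (σ - τ) * y' σ) (uIcc τ t) :=
    ((continuousOn_const.mul hyc).add (ContinuousOn.mul (by fun_prop) hy')).mono hsub
  have c2 : ContinuousOn (fun σ => (σ - τ) * D σ) (uIcc τ t) :=
    (ContinuousOn.mul (by fun_prop) hD).mono hsub
  have e1 := intervalIntegral.integral_eq_sub_of_hasDerivAt hzd c1.intervalIntegrable
  simp only [sub_self, zero_mul, sub_zero] at e1
  rw [← e1, ← intervalIntegral.integral_add c1.intervalIntegrable c2.intervalIntegrable,
    intervalIntegral.integral_of_le ht.1]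
  have hS : 0 ≤ 1 + (T - τ) := by linarith
  rw [← ENNReal.ofReal_le_ofReal_iff (by positivity)]
  refine (ofReal_integral_le_lintegral _).trans ?_
  calc ∫⁻ σ in Ioc τ t, ENNReal.ofReal (1 * y σ + (σ - τ) * y' σ + (σ - τ) * D σ)
      ≤ ∫⁻ σ in Ioc τ t, ENNReal.ofReal (1 + (T - τ)) * Φ σ := by
        refine setLIntegral_mono' measurableSet_Ioc fun σ hσ => ?_
        have hσ' : σ ∈ Icc τ T := ⟨hσ.1.le, hσ.2.trans ht.2⟩
        have g0 : 0 ≤ σ - τ := by linarith [hσ'.1]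
        rw [show 1 * y σ + (σ - τ) * y' σ + (σ - τ) * D σ = y σ + (σ - τ) * (y' σ + D σ) by ring,
          ENNReal.ofReal_add zero_le_one (by linarith), add_mul, ENNReal.ofReal_one, one_mul]
        refine ENNReal.ofReal_add_le.trans (add_le_add (h1 σ hσ') ?_)
        rw [ENNReal.ofReal_mul g0]
        exact mul_le_mul' (ENNReal.ofReal_le_ofReal (by linarith [hσ'.2])) (h2 σ hσ')
    _ ≤ ∫⁻ σ in Icc τ T, ENNReal.ofReal (1 + (T - τ)) * Φ σ :=
        lintegral_mono_set (fun σ hσ => ⟨hσ.1.le, hσ.2.trans ht.2⟩)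
    _ = ENNReal.ofReal (1 + (T - τ)) * ∫⁻ σ in Icc τ T, Φ σ :=
        lintegral_const_mul' _ _ ENNReal.ofReal_ne_top
    _ ≤ _ := by
        rw [ENNReal.ofReal_mul hS]
        gcongr

/-- Both bounds come from one inequality started at `τ / 2`, by dropping the dissipation or the
energy; for times beyond `τ` the factor `t - τ / 2` is at least `τ / 2`. -/
theorem bounds_of_energy_inequality {y y' D : ℝ → ℝ} {Φ : ℝ → ℝ≥0∞} {K τ T : ℝ} (hτ : 0 < τ)
    (hK : 0 ≤ K) (hyd : ∀ t, 0 < t → HasDerivAt y (y' t) t) (hy' : ContinuousOn y' (Ioi 0))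
    (hD : ContinuousOn D (Ioi 0)) (hy0 : ∀ t, 0 ≤ y t) (hD0 : ∀ t, 0 ≤ D t)
    (h1 : ∀ t ∈ Icc (τ / 2) T, ENNReal.ofReal (y t) ≤ Φ t)
    (h2 : ∀ t ∈ Icc (τ / 2) T, ENNReal.ofReal (y' t + D t) ≤ Φ t)
    (hΦ : ∫⁻ t in Icc (τ / 2) T, Φ t ≤ ENNReal.ofReal K) :
    (∀ t ∈ Icc τ T, y t ≤ (1 + |T|) * K / (τ / 2)) ∧
      ∫⁻ t in Icc τ T, ENNReal.ofReal (D t) ≤ ENNReal.ofReal ((1 + |T|) * K / (τ / 2)) := by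
  have hτ2 : 0 < τ / 2 := by positivity
  have hTa := le_abs_self T
  have hb : (1 + (T - τ / 2)) * K ≤ (1 + |T|) * K :=
    mul_le_mul_of_nonneg_right (by linarith) hK
  have hDi : ∀ a b, 0 < a → 0 < b → IntervalIntegrable (fun σ => (σ - τ / 2) * D σ) volume a b := by
    intro a b ha hb
    refine ContinuousOn.intervalIntegrable ((ContinuousOn.mul (by fun_prop) hD).mono ?_)
    intro σ hσ
    exact (lt_min ha hb).trans_le hσ.1
  constructor
  · intro t ht
    have h := sub_mul_add_integral_le hτ2 hK hyd hy' hD h1 h2 hΦ (t := t)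
      ⟨by linarith [ht.1], ht.2⟩
    have h3 : 0 ≤ ∫ σ in (τ / 2)..t, (σ - τ / 2) * D σ :=
      intervalIntegral.integral_nonneg (by linarith [ht.1]) fun σ hσ =>
        mul_nonneg (by linarith [hσ.1]) (hD0 σ)
    rw [le_div_iff₀ hτ2]
    have h4 : y t * (τ / 2) ≤ (t - τ / 2) * y t := by
      rw [mul_comm]
      exact mul_le_mul_of_nonneg_right (by linarith [ht.1]) (hy0 t)
    linarith
  · rcases lt_or_ge T τ with hT | hT
    · simp [Icc_eq_empty (not_le.2 hT)]
    have h := sub_mul_add_integral_le hτ2 hK hyd hy' hD h1 h2 hΦ (t := T) ⟨by linarith, le_rfl⟩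
    have hsub : uIcc τ T ⊆ Ioi 0 := by
      rw [uIcc_of_le hT]
      exact fun σ hσ => hτ.trans_le hσ.1
    have hDc : IntervalIntegrable D volume τ T := (hD.mono hsub).intervalIntegrable
    have h3 : (τ / 2) * ∫ σ in τ..T, D σ ≤ ∫ σ in τ..T, (σ - τ / 2) * D σ := by
      rw [← intervalIntegral.integral_const_mul]
      refine intervalIntegral.integral_mono_on hT (hDc.const_mul _)
        (hDi τ T hτ (hτ.trans_le hT)) fun σ hσ => ?_
      exact mul_le_mul_of_nonneg_right (by linarith [hσ.1]) (hD0 σ)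
    have h4 : 0 ≤ ∫ σ in (τ / 2)..τ, (σ - τ / 2) * D σ :=
      intervalIntegral.integral_nonneg (by linarith) fun σ hσ =>
        mul_nonneg (by linarith [hσ.1]) (hD0 σ)
    have h5 := intervalIntegral.integral_add_adjacent_intervals (hDi (τ / 2) τ hτ2 hτ)
      (hDi τ T hτ (hτ.trans_le hT))
    have h6 : 0 ≤ (T - τ / 2) * y T := mul_nonneg (by linarith) (hy0 T)
    rw [← Measure.restrict_congr_set (Ioc_ae_eq_Icc (μ := volume)), ← ofReal_integral_eq_lintegral_ofReal
      ((intervalIntegrable_iff_integrableOn_Ioc_of_le hT).1 hDc) (Eventually.of_forall hD0),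
      ← intervalIntegral.integral_of_le hT]
    refine ENNReal.ofReal_le_ofReal ?_
    rw [le_div_iff₀ hτ2]
    linarith

section Solution

variable {V W ρ₀ ψ : Space d → ℝ} {ρ : ℝ → Space d → ℝ}

theorem IsClassicalSolution.hasDerivAt_conv (h : IsClassicalSolution V W ρ₀ ρ) (hψ : IsTest ψ)
    {t : ℝ} (ht : 0 < t) (x : Space d) :
    HasDerivAt (fun τ => conv ψ (ρ τ) x) (conv ψ (fun y => deriv (fun τ => ρ τ y) t) x) t :=
  h.hasDerivAt_integral_mul (hψ.sub_left x).continuous (hψ.sub_left x).hasCompactSupport ht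

/-- Mollification commutes with the Laplacian and the divergence. The nonlinear flux is mollified as
a whole, which makes it a smooth field to which `energy_inequality` applies. -/
theorem IsClassicalSolution.conv_deriv_eq (hVW : HessianBounds V W)
    (h : IsClassicalSolution V W ρ₀ ρ) (hψ : IsTest ψ) {t : ℝ} (ht : 0 < t) (x : Space d) :
    conv ψ (fun y => deriv (fun τ => ρ τ y) t) x =
      ∑ i, partialDeriv i (partialDeriv i (conv ψ (ρ t))) x +
        ∑ i, partialDeriv i (conv ψ fun y => ρ t y * drift V W (ρ t) i y) x := by
  have hρ := h.contDiff_space t ht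
  have hρ1 : ∀ i, LocBoundedDeriv (partialDeriv i (ρ t)) := fun i =>
    .of_contDiff (contDiff_partialDeriv (n := 1) (m := 2) hρ (by norm_num) i)
  have hF := fun i => h.locBoundedDeriv_mul_drift hVW ht i
  have hx := hψ.sub_left x
  have e1 : ∀ i, partialDeriv i (partialDeriv i (conv ψ (ρ t))) x =
      ∫ y, partialDeriv i (partialDeriv i (ρ t)) y * ψ (x - y) := fun i => by
    rw [hψ.partialDeriv_conv hρ.continuous, (hψ.partialDeriv i).partialDeriv_conv hρ.continuous,
      ← (hψ.partialDeriv i).conv_partialDeriv (.of_contDiff (hρ.of_le (by norm_num))),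
      ← hψ.conv_partialDeriv (hρ1 i)]
    rfl
  have e2 : ∀ i, partialDeriv i (conv ψ fun y => ρ t y * drift V W (ρ t) i y) x =
      ∫ y, partialDeriv i (fun y => ρ t y * drift V W (ρ t) i y) y * ψ (x - y) := fun i => by
    rw [hψ.partialDeriv_conv (hF i).1.continuous, ← hψ.conv_partialDeriv (hF i)]
    rfl
  have i1 := fun i => (hρ1 i).integrable_partialDeriv_mul hx.continuous hx.2 i
  have i2 := fun i => (hF i).integrable_partialDeriv_mul hx.continuous hx.2 i
  simp only [e1, e2]
  rw [← integral_finsetSum _ fun i _ => i1 i, ← integral_finsetSum _ fun i _ => i2 i,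
    ← integral_add (integrable_finsetSum _ fun i _ => i1 i) (integrable_finsetSum _ fun i _ => i2 i),
    conv_apply]
  refine integral_congr_ae (Eventually.of_forall fun y => ?_)
  beta_reduce
  rw [h.deriv_eq ht y, add_mul, Finset.sum_mul, Finset.sum_mul]

variable {η : Space d → ℝ}

theorem IsClassicalSolution.continuousOn_conv_deriv (h : IsClassicalSolution V W ρ₀ ρ)
    (hψ : IsTest ψ) (hη : Continuous η) :
    ContinuousOn (fun p : ℝ × Space d => 2 * (conv ψ (ρ p.1) p.2 * η p.2 ^ 2) *
      conv ψ (fun y => deriv (fun τ => ρ τ y) p.1) p.2) (Ioi 0 ×ˢ univ) := by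
  refine ContinuousOn.mul (continuousOn_const.mul ((hψ.continuousOn_conv h.continuousOn).mul ?_))
    (hψ.continuousOn_conv (g := fun t y => deriv (fun τ => ρ τ y) t) h.continuousOn_time)
  exact ((hη.comp continuous_snd).pow 2).continuousOn

theorem IsClassicalSolution.hasDerivAt_integral_conv_sq (h : IsClassicalSolution V W ρ₀ ρ)
    (hψ : IsTest ψ) (hη : Continuous η) (hηc : HasCompactSupport η) {t : ℝ} (ht : 0 < t) :
    HasDerivAt (fun τ => ∫ x, conv ψ (ρ τ) x ^ 2 * η x ^ 2)
      (∫ x, 2 * (conv ψ (ρ t) x * η x ^ 2) * conv ψ (fun y => deriv (fun τ => ρ τ y) t) x) t := by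
  refine hasDerivAt_integral_of_support (H := fun τ x => conv ψ (ρ τ) x ^ 2 * η x ^ 2)
    (H' := fun t x => 2 * (conv ψ (ρ t) x * η x ^ 2) *
      conv ψ (fun y => deriv (fun τ => ρ τ y) t) x) hηc ?_ ?_ (h.continuousOn_conv_deriv hψ hη) ?_ ht
  · exact fun t ht => ((hψ.contDiff_conv (h.contDiff_space t ht).continuous).continuous.pow 2).mul
      (hη.pow 2)
  · intro t ht x
    refine (((h.hasDerivAt_conv hψ ht x).pow 2).mul_const (η x ^ 2)).congr_deriv ?_
    norm_num
    ring
  · intro t _ x hx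
    simp [image_eq_zero_of_notMem_tsupport hx]

theorem IsClassicalSolution.continuousOn_integral_conv_deriv (h : IsClassicalSolution V W ρ₀ ρ)
    (hψ : IsTest ψ) (hη : Continuous η) (hηc : HasCompactSupport η) :
    ContinuousOn (fun t => ∫ x, 2 * (conv ψ (ρ t) x * η x ^ 2) *
      conv ψ (fun y => deriv (fun τ => ρ τ y) t) x) (Ioi 0) :=
  continuousOn_integral_of_compact_support (f := fun t x => 2 * (conv ψ (ρ t) x * η x ^ 2) *
      conv ψ (fun y => deriv (fun τ => ρ τ y) t) x) hηc (h.continuousOn_conv_deriv hψ hη)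
    fun t x _ hx => by simp [image_eq_zero_of_notMem_tsupport hx]

theorem IsClassicalSolution.gradSq_conv (h : IsClassicalSolution V W ρ₀ ρ) (hψ : IsTest ψ) {t : ℝ}
    (ht : 0 < t) (x : Space d) :
    gradSq (conv ψ (ρ t)) x = ∑ i, conv (partialDeriv i ψ) (ρ t) x ^ 2 := by
  simp only [gradSq, hψ.partialDeriv_conv (h.contDiff_space t ht).continuous]

theorem IsClassicalSolution.continuousOn_integral_gradSq (h : IsClassicalSolution V W ρ₀ ρ)
    (hψ : IsTest ψ) (hη : Continuous η) (hηc : HasCompactSupport η) :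
    ContinuousOn (fun t => ∫ x, η x ^ 2 * gradSq (conv ψ (ρ t)) x) (Ioi 0) := by
  refine continuousOn_integral_of_compact_support
    (f := fun t x => η x ^ 2 * gradSq (conv ψ (ρ t)) x) hηc ?_
    fun t x _ hx => by simp [image_eq_zero_of_notMem_tsupport hx]
  refine ContinuousOn.congr (f := fun p : ℝ × Space d => η p.2 ^ 2 *
    ∑ i, conv (partialDeriv i ψ) (ρ p.1) p.2 ^ 2) ?_ fun p hp => by
      simp only [Function.uncurry, h.gradSq_conv hψ hp.1]
  refine ((hη.comp continuous_snd).pow 2).continuousOn.mul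
    (continuousOn_finsetSum _ fun i _ => ((hψ.partialDeriv i).continuousOn_conv h.continuousOn).pow 2)

theorem IsClassicalSolution.deriv_integral_conv_sq_le (hVW : HessianBounds V W)
    (h : IsClassicalSolution V W ρ₀ ρ) (hψ : IsTest ψ) (hη : ContDiff ℝ 1 η)
    (hηc : HasCompactSupport η) {t : ℝ} (ht : 0 < t) :
    (∫ x, 2 * (conv ψ (ρ t) x * η x ^ 2) * conv ψ (fun y => deriv (fun τ => ρ τ y) t) x) +
        ∫ x, η x ^ 2 * gradSq (conv ψ (ρ t)) x ≤
      ∫ x, (10 * (conv ψ (ρ t) x ^ 2 * gradSq η x) +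
        4 * (η x ^ 2 * ∑ i, conv ψ (fun y => ρ t y * drift V W (ρ t) i y) x ^ 2)) := by
  have h1 := energy_inequality (u := conv ψ (ρ t))
    (G := fun i => conv ψ fun y => ρ t y * drift V W (ρ t) i y)
    (by exact_mod_cast contDiff_infty.1 (hψ.contDiff_conv (h.contDiff_space t ht).continuous) 2)
    (fun i => .of_contDiff ((hψ.contDiff_conv
      (h.locBoundedDeriv_mul_drift hVW ht i).1.continuous).of_le (by exact_mod_cast le_top))) hη hηc
  simp only [← h.conv_deriv_eq hVW hψ ht] at h1
  linarith

end Solution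


/-! ### Propagation of regularity -/

section Regularity

variable {V W : Space d → ℝ} {a E : ℝ} {s k : ℕ}

/-- The mollified derivatives of order at most `k` of all admissible solutions are bounded in
weighted `L²` spaces of space-time, uniformly in the mollifier. -/
def EnergyBound (V W : Space d → ℝ) (a E : ℝ) (k : ℕ) : Prop :=
  ∀ (m : ℕ) (τ T : ℝ), 0 < τ → ∃ K : ℝ≥0, ∀ ρ, Admissible V W a E ρ → ∀ φ, IsMollifier φ →
    ∀ L : List (Fin d), L.length ≤ k →
      ∫⁻ t in Icc τ T, weightedSq m (conv (lderiv L φ) (ρ t)) ≤ K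

theorem energyBound_zero (hVW : HessianBounds V W) (hV : HasPolyGrowthDerivs (0 + 1) V)
    (hW : HasPolyGrowthDerivs (0 + 1) W) (ha : 0 < a) : EnergyBound V W a E 0 := by
  intro m τ T hτ
  obtain ⟨K, hK, h⟩ := exists_integral_sq_le hVW hV hW ha E (T := T) hτ m
  refine ⟨4 ^ m * K.toNNReal * (T - τ).toNNReal, fun ρ hρ φ hφ L hL => ?_⟩
  have hL0 : L = [] := List.length_eq_zero_iff.1 (Nat.le_zero.1 hL)
  subst hL0
  calc ∫⁻ t in Icc τ T, weightedSq m (conv (lderiv [] φ) (ρ t))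
      ≤ ∫⁻ t in Icc τ T, 4 ^ m * ENNReal.ofReal K := by
        refine setLIntegral_mono' measurableSet_Icc fun t ht => ?_
        obtain ⟨h1, h2⟩ := h ρ hρ t ht
        obtain ⟨ρ₀, -, -, -, hs⟩ := hρ
        have ht0 : 0 < t := hτ.trans_le ht.1
        refine (hφ.lintegral_conv_sq_le (hs.isNiceDensity ht0).continuous m).trans ?_
        rw [← ofReal_integral_eq_lintegral_ofReal h1 (Eventually.of_forall fun x =>
          mul_nonneg (pow_nonneg (wt_pos x).le m) (sq_nonneg _))]
        gcongr
    _ = _ := by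
        rw [setLIntegral_const, Real.volume_Icc]
        push_cast
        rfl

/-- The majorant `Ψ` must serve every mollifier `φ` and every `L` at once. It is the lower limit in
`weightedSq_conv_mul_le` along one fixed sequence of mollifiers, and Fatou's lemma in time bounds
its integral. -/
theorem EnergyBound.exists_drift_le (hk : EnergyBound V W a E k) (hks : k ≤ s)
    (hVW : HessianBounds V W) (hV : HasPolyGrowthDerivs (s + 1) V)
    (hW : HasPolyGrowthDerivs (s + 1) W) (ha : 0 < a) (m : ℕ) {τ : ℝ} (T : ℝ) (hτ : 0 < τ) :
    ∃ K : ℝ≥0, ∀ ρ, Admissible V W a E ρ → ∃ Ψ : ℝ → ℝ≥0∞, ∫⁻ t in Icc τ T, Ψ t ≤ K ∧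
      ∀ t ∈ Icc τ T, ∀ φ, IsMollifier φ → ∀ L : List (Fin d), L.length ≤ k → ∀ i,
        weightedSq m (conv (lderiv L φ) fun y => ρ t y * drift V W (ρ t) i y) ≤ Ψ t := by
  obtain ⟨B, -, n, hB⟩ := McKeanVlasov.exists_drift_le hVW hV hW ha E T
  obtain ⟨K, hK⟩ := hk (m + 2 * n) τ T hτ
  obtain ⟨Φ, hΦ, hlim⟩ := exists_mollifier_seq d
  set c : ℝ := 4 ^ k * B ^ 2 * (dirLists d k).card with hc
  refine ⟨4 ^ m * (c.toNNReal * ((dirLists d k).card * K)), fun ρ hρ => ?_⟩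
  have hB' := hB ρ hρ
  have hK' := hK ρ hρ
  obtain ⟨ρ₀, -, -, -, h⟩ := hρ
  refine ⟨fun t => liminf (fun j => 4 ^ m * (ENNReal.ofReal c *
    ∑ L' ∈ dirLists d k, weightedSq (m + 2 * n) (conv (lderiv L' (Φ j)) (ρ t)))) atTop, ?_, ?_⟩
  · have hme : ∀ j, ∀ L' : List (Fin d), AEMeasurable (fun t => weightedSq (m + 2 * n)
        (conv (lderiv L' (Φ j)) (ρ t))) (volume.restrict (Icc τ T)) := fun j L' =>
      aemeasurable_weightedSq_conv ((hΦ j).isTest.lderiv L') h.continuousOn hτ _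
    have hms : ∀ j, AEMeasurable (fun t => ∑ L' ∈ dirLists d k, weightedSq (m + 2 * n)
        (conv (lderiv L' (Φ j)) (ρ t))) (volume.restrict (Icc τ T)) := fun j =>
      Finset.aemeasurable_fun_sum _ fun L' _ => hme j L'
    refine (lintegral_liminf_le' fun j => ((hms j).const_mul _).const_mul _).trans ?_
    refine (liminf_le_liminf (v := fun _ => ((4 ^ m * (c.toNNReal * ((dirLists d k).card * K)) : ℝ≥0) :
      ℝ≥0∞)) (Eventually.of_forall fun j => ?_)).trans (liminf_const _).le
    rw [lintegral_const_mul' _ _ (by finiteness), lintegral_const_mul' _ _ ENNReal.ofReal_ne_top,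
      lintegral_finsetSum' _ fun L' _ => hme j L']
    push_cast
    gcongr
    · exact le_rfl
    · refine (Finset.sum_le_card_nsmul _ _ (K : ℝ≥0∞) fun L' hL' =>
        hK' _ (hΦ j) L' (mem_dirLists.1 hL')).trans (le_of_eq ?_)
      rw [nsmul_eq_mul]
  · intro t ht φ hφ L hL i
    have ht0 : 0 < t := hτ.trans_le ht.1
    obtain ⟨h1, h2⟩ := hB' t ⟨ht0, ht.2⟩ i
    exact weightedSq_conv_mul_le hφ hΦ hlim (h.isNiceDensity ht0).continuous
      (h1.of_le (by exact_mod_cast hks)) (fun L' hL' x => h2 L' (hL'.trans hks) x) hL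

/-! ### Removal of the spatial cut-off and induction on the order of differentiation. -/

theorem lintegral_wt_mul_le_liminf {w : Space d → ℝ} (hw : Continuous w) (hw0 : ∀ x, 0 ≤ w x) (m : ℕ) :
    ∫⁻ x, ENNReal.ofReal (wt x ^ (2 * m) * w x) ≤
      liminf (fun n : ℕ => ENNReal.ofReal (∫ x, wcut m ((n : ℝ) + 1) x ^ 2 * w x)) atTop := by
  have hc : ∀ n : ℕ, Continuous (wcut (d := d) m ((n : ℝ) + 1)) := fun n =>
    (contDiff_wcut (n := 0)).continuous
  have h1 : ∀ n : ℕ, ENNReal.ofReal (∫ x, wcut m ((n : ℝ) + 1) x ^ 2 * w x) =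
      ∫⁻ x, ENNReal.ofReal (wcut m ((n : ℝ) + 1) x ^ 2 * w x) := fun n => by
    have := hc n
    refine ofReal_integral_eq_lintegral_ofReal
      (Continuous.integrable_of_hasCompactSupport (by fun_prop) (HasCompactSupport.mul_right
        ((hasCompactSupport_wcut m (by positivity)).comp_left (g := fun y => y ^ 2) (by norm_num))))
      (Eventually.of_forall fun x => mul_nonneg (sq_nonneg _) (hw0 x))
  simp only [h1]
  refine le_trans (le_of_eq (lintegral_congr fun x => ?_)) (lintegral_liminf_le
    (f := fun (n : ℕ) x => ENNReal.ofReal (wcut m ((n : ℝ) + 1) x ^ 2 * w x))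
    fun n => by have := hc n; fun_prop)
  refine (Tendsto.liminf_eq (tendsto_const_nhds.congr' ?_)).symm
  filter_upwards [tendsto_wcut m x] with n hn
  rw [hn, ← pow_mul, mul_comm m 2]

theorem lintegral_const_mul_wt_sq (m : ℕ) (u : Space d → ℝ) {c : ℝ} (hc : 0 ≤ c) :
    ∫⁻ x, ENNReal.ofReal (c * (wt x ^ m * u x ^ 2)) = ENNReal.ofReal c * weightedSq m u := by
  rw [weightedSq, ← lintegral_const_mul' _ _ ENNReal.ofReal_ne_top]
  exact lintegral_congr fun x => ENNReal.ofReal_mul hc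

/-- All terms on the right of the energy inequality at order `k` are already integrable in time by
`EnergyBound`, used with larger weights on the longer interval starting at `τ / 2`. No absorption or
Grönwall argument is needed, and the bound does not depend on `R`. -/
theorem EnergyBound.cutoff_bounds (hk : EnergyBound V W a E k) (hks : k ≤ s)
    (hVW : HessianBounds V W) (hV : HasPolyGrowthDerivs (s + 1) V)
    (hW : HasPolyGrowthDerivs (s + 1) W) (ha : 0 < a) (m : ℕ) {τ : ℝ} (T : ℝ) (hτ : 0 < τ) :
    ∃ K : ℝ, ∀ ρ, Admissible V W a E ρ → ∀ φ, IsMollifier φ →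
      ∀ L : List (Fin d), L.length ≤ k → ∀ R : ℝ, 1 ≤ R →
        (∀ t ∈ Icc τ T, ∫ x, conv (lderiv L φ) (ρ t) x ^ 2 * wcut m R x ^ 2 ≤ K) ∧
        ∫⁻ t in Icc τ T, ENNReal.ofReal
          (∫ x, wcut m R x ^ 2 * gradSq (conv (lderiv L φ) (ρ t)) x) ≤ ENNReal.ofReal K := by
  have hτ2 : 0 < τ / 2 := by positivity
  obtain ⟨K₁, hK₁⟩ := hk (2 * m + 1) (τ / 2) T hτ2
  obtain ⟨K₂, hK₂⟩ := hk.exists_drift_le hks hVW hV hW ha (2 * m) T hτ2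
  obtain ⟨A, hA, hcut⟩ := exists_gradSq_wcut_le (d := d) m
  -- The term `10 A` comes from the gradient of the cut-off and `4 d` from the components of the
  -- flux; the added `1` lets the same majorant bound the energy itself.
  set K : ℝ := (10 * A + 1) * K₁ + 4 * d * K₂ with hK
  have hK0 : 0 ≤ K := by positivity
  refine ⟨(1 + |T|) * K / (τ / 2), fun ρ hρ φ hφ L hL R hR => ?_⟩
  obtain ⟨Ψ, hΨ1, hΨ2⟩ := hK₂ ρ hρ
  have hK₁' := hK₁ ρ hρ φ hφ L hL
  obtain ⟨ρ₀, -, -, -, h⟩ := hρ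
  have hψ := hφ.isTest.lderiv L
  have hΨ3 : ∀ t ∈ Icc (τ / 2) T, ∀ i, weightedSq (2 * m)
      (conv (lderiv L φ) fun y => ρ t y * drift V W (ρ t) i y) ≤ Ψ t := fun t ht i =>
    hΨ2 t ht φ hφ L hL i
  generalize lderiv L φ = ψ at hψ hK₁' hΨ3
  have hη : ContDiff ℝ 1 (wcut (d := d) m R) := contDiff_wcut (n := 1)
  have hηc : HasCompactSupport (wcut (d := d) m R) := hasCompactSupport_wcut m (by linarith)
  have hsq : ∀ x : Space d, wcut m R x ^ 2 ≤ wt x ^ (2 * m) := fun x => by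
    rw [mul_comm, pow_mul]
    exact pow_le_pow_left₀ (wcut_nonneg m R x) (wcut_le m R x) 2
  refine bounds_of_energy_inequality (Φ := fun t => ENNReal.ofReal (10 * A + 1) *
      weightedSq (2 * m + 1) (conv ψ (ρ t)) + ENNReal.ofReal (4 * d) * Ψ t) hτ hK0
    (fun t ht => h.hasDerivAt_integral_conv_sq hψ hη.continuous hηc ht)
    (h.continuousOn_integral_conv_deriv hψ hη.continuous hηc)
    (h.continuousOn_integral_gradSq hψ hη.continuous hηc)
    (fun t => integral_nonneg fun x => by positivity)
    (fun t => integral_nonneg fun x => mul_nonneg (sq_nonneg _) (gradSq_nonneg _ _)) ?_ ?_ ?_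
  · intro t ht
    refine (ofReal_integral_le_lintegral _).trans (le_trans ?_ le_self_add)
    have h1 : (1 : ℝ≥0∞) ≤ ENNReal.ofReal (10 * A + 1) := by
      rw [← ENNReal.ofReal_one]
      exact ENNReal.ofReal_le_ofReal (by linarith)
    refine le_trans (lintegral_mono fun x => ENNReal.ofReal_le_ofReal ?_) (le_mul_of_one_le_left' h1)
    rw [mul_comm]
    exact mul_le_mul_of_nonneg_right ((hsq x).trans (wt_pow_mono x (Nat.le_succ _))) (sq_nonneg _)
  · intro t ht
    have ht0 : 0 < t := hτ2.trans_le ht.1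
    have hu : Continuous (conv ψ (ρ t)) :=
      (hψ.contDiff_conv (h.contDiff_space t ht0).continuous).continuous
    have hG : ∀ i, Continuous (conv ψ fun y => ρ t y * drift V W (ρ t) i y) := fun i =>
      (hψ.contDiff_conv (h.locBoundedDeriv_mul_drift hVW ht0 i).1.continuous).continuous
    have hw := continuous_wt (d := d)
    refine (ENNReal.ofReal_le_ofReal (h.deriv_integral_conv_sq_le hVW hψ hη hηc ht0)).trans ?_
    refine (ofReal_integral_le_lintegral _).trans ?_
    calc _ ≤ ∫⁻ x, (ENNReal.ofReal (10 * A * (wt x ^ (2 * m + 1) * conv ψ (ρ t) x ^ 2)) +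
            ∑ i, ENNReal.ofReal (4 * (wt x ^ (2 * m) *
              conv ψ (fun y => ρ t y * drift V W (ρ t) i y) x ^ 2))) := by
          refine lintegral_mono fun x => ?_
          refine ENNReal.ofReal_add_le.trans (add_le_add (ENNReal.ofReal_le_ofReal ?_) ?_)
          · have := mul_le_mul_of_nonneg_left (hcut R hR x) (sq_nonneg (conv ψ (ρ t) x))
            linarith
          · rw [← ENNReal.ofReal_sum_of_nonneg fun i _ => mul_nonneg (by norm_num)
              (mul_nonneg (pow_nonneg (wt_pos x).le _) (sq_nonneg _)), ← Finset.mul_sum,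
              ← Finset.mul_sum]
            refine ENNReal.ofReal_le_ofReal (mul_le_mul_of_nonneg_left ?_ (by norm_num))
            exact mul_le_mul_of_nonneg_right (hsq x) (Finset.sum_nonneg fun _ _ => sq_nonneg _)
      _ = ENNReal.ofReal (10 * A) * weightedSq (2 * m + 1) (conv ψ (ρ t)) +
            ∑ i, ENNReal.ofReal 4 * weightedSq (2 * m)
              (conv ψ fun y => ρ t y * drift V W (ρ t) i y) := by
          rw [lintegral_add_left (by fun_prop), lintegral_finsetSum _ fun i _ => by
            have := hG i; fun_prop, lintegral_const_mul_wt_sq _ _ (by positivity)]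
          exact congrArg _ (Finset.sum_congr rfl fun i _ => lintegral_const_mul_wt_sq _ _ (by norm_num))
      _ ≤ _ := by
          refine add_le_add (mul_le_mul_left (ENNReal.ofReal_le_ofReal (by linarith)) _) ?_
          refine (Finset.sum_le_card_nsmul _ _ (ENNReal.ofReal 4 * Ψ t) fun i _ =>
            mul_le_mul_right (hΨ3 t ht i) _).trans (le_of_eq ?_)
          rw [nsmul_eq_mul, ENNReal.ofReal_mul (by norm_num), Finset.card_univ, Fintype.card_fin,
            ENNReal.ofReal_natCast]
          ring
  · have e : ENNReal.ofReal K = ENNReal.ofReal (10 * A + 1) * K₁ + ENNReal.ofReal (4 * d) * K₂ := by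
      rw [hK, ENNReal.ofReal_add (by positivity) (by positivity),
        ENNReal.ofReal_mul (p := 10 * A + 1) (by positivity),
        ENNReal.ofReal_mul (p := 4 * (d : ℝ)) (by positivity), ENNReal.ofReal_coe_nnreal,
        ENNReal.ofReal_coe_nnreal]
    rw [lintegral_add_left' ((aemeasurable_weightedSq_conv hψ h.continuousOn hτ2 _).const_mul _),
      lintegral_const_mul' _ _ ENNReal.ofReal_ne_top, lintegral_const_mul' _ _ ENNReal.ofReal_ne_top,
      e]
    gcongr

/-- The inductive gain: control integrated in time at order `k` becomes control at every time, and
the dissipation supplies one more derivative integrated in time. Fatou's lemma removes the cut-off.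
-/
theorem EnergyBound.exists_bounds (hk : EnergyBound V W a E k) (hks : k ≤ s)
    (hVW : HessianBounds V W) (hV : HasPolyGrowthDerivs (s + 1) V)
    (hW : HasPolyGrowthDerivs (s + 1) W) (ha : 0 < a) (m : ℕ) {τ : ℝ} (T : ℝ) (hτ : 0 < τ) :
    ∃ K : ℝ≥0, ∀ ρ, Admissible V W a E ρ → ∀ φ, IsMollifier φ →
      ∀ L : List (Fin d), L.length ≤ k →
        (∀ t ∈ Icc τ T, weightedSq m (conv (lderiv L φ) (ρ t)) ≤ K) ∧
        ∀ i, ∫⁻ t in Icc τ T, weightedSq m (conv (lderiv (i :: L) φ) (ρ t)) ≤ K := by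
  obtain ⟨K, hK⟩ := hk.cutoff_bounds hks hVW hV hW ha m T hτ
  refine ⟨K.toNNReal, fun ρ hρ φ hφ L hL => ?_⟩
  have hK' := fun n : ℕ => hK ρ hρ φ hφ L hL ((n : ℝ) + 1) (by simp)
  obtain ⟨ρ₀, -, -, -, h⟩ := hρ
  have hψ := hφ.isTest.lderiv L
  have hpos : ∀ t ∈ Icc τ T, 0 < t := fun t ht => hτ.trans_le ht.1
  have hcont : ∀ t ∈ Icc τ T, ContDiff ℝ ∞ (conv (lderiv L φ) (ρ t)) := fun t ht =>
    hψ.contDiff_conv (h.contDiff_space t (hpos t ht)).continuous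
  constructor
  · intro t ht
    refine (weightedSq_mono (by omega : m ≤ 2 * m) _).trans
      ((lintegral_wt_mul_le_liminf ((hcont t ht).continuous.pow 2) (fun _ => sq_nonneg _) m).trans ?_)
    refine (liminf_le_liminf (v := fun _ => (K.toNNReal : ℝ≥0∞))
      (Eventually.of_forall fun n => ENNReal.ofReal_le_ofReal ?_)).trans (liminf_const _).le
    simpa only [mul_comm, Pi.pow_apply] using (hK' n).1 t ht
  · intro i
    rw [lderiv_cons]
    calc ∫⁻ t in Icc τ T, weightedSq m (conv (partialDeriv i (lderiv L φ)) (ρ t))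
        ≤ ∫⁻ t in Icc τ T, liminf (fun n : ℕ => ENNReal.ofReal
            (∫ x, wcut m ((n : ℝ) + 1) x ^ 2 * gradSq (conv (lderiv L φ) (ρ t)) x)) atTop := by
          refine setLIntegral_mono' measurableSet_Icc fun t ht => ?_
          refine (weightedSq_mono (by omega : m ≤ 2 * m) _).trans (le_trans (lintegral_mono fun x => ?_)
            (lintegral_wt_mul_le_liminf (continuous_gradSq
              ((hcont t ht).of_le (by exact_mod_cast le_top))) (gradSq_nonneg _) m))
          refine ENNReal.ofReal_le_ofReal
            (mul_le_mul_of_nonneg_left ?_ (pow_nonneg (wt_pos x).le _))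
          rw [h.gradSq_conv hψ (hpos t ht)]
          exact Finset.single_le_sum (f := fun i => conv (partialDeriv i (lderiv L φ)) (ρ t) x ^ 2)
            (fun _ _ => sq_nonneg _) (Finset.mem_univ i)
      _ ≤ liminf (fun n : ℕ => ∫⁻ t in Icc τ T, ENNReal.ofReal
            (∫ x, wcut m ((n : ℝ) + 1) x ^ 2 * gradSq (conv (lderiv L φ) (ρ t)) x)) atTop := by
          refine lintegral_liminf_le' fun n => ?_
          refine ((ContinuousOn.aemeasurable (s := Icc τ T) ?_ measurableSet_Icc)).ennreal_ofReal
          exact (h.continuousOn_integral_gradSq hψ (contDiff_wcut (n := 0)).continuous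
            (hasCompactSupport_wcut m (by positivity))).mono fun t ht => hpos t ht
      _ ≤ K.toNNReal := (liminf_le_liminf (v := fun _ => (K.toNNReal : ℝ≥0∞))
          (Eventually.of_forall fun n => (hK' n).2)).trans (liminf_const _).le

theorem HasPolyGrowthDerivs.mono {m n : ℕ} {U : Space d → ℝ} (h : HasPolyGrowthDerivs n U)
    (hmn : m ≤ n) : HasPolyGrowthDerivs m U :=
  ⟨h.1.of_le (by exact_mod_cast hmn), fun α hα => h.2 α (hα.trans hmn)⟩

theorem energyBound_of_le (hVW : HessianBounds V W) (hV : HasPolyGrowthDerivs (s + 1) V)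
    (hW : HasPolyGrowthDerivs (s + 1) W) (ha : 0 < a) (hks : k ≤ s) : EnergyBound V W a E k := by
  induction k with
  | zero => exact energyBound_zero hVW (hV.mono (by omega)) (hW.mono (by omega)) ha
  | succ k ih =>
    intro m τ T hτ
    have hk := ih (by omega)
    obtain ⟨K₁, h₁⟩ := hk m τ T hτ
    obtain ⟨K₂, h₂⟩ := hk.exists_bounds (s := s) (by omega) hVW hV hW ha m T hτ
    refine ⟨max K₁ K₂, fun ρ hρ φ hφ L hL => ?_⟩
    rcases L with _ | ⟨i, L⟩
    · exact (h₁ ρ hρ φ hφ [] (Nat.zero_le _)).trans (by exact_mod_cast le_max_left _ _)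
    · exact ((h₂ ρ hρ φ hφ L (by simpa using hL)).2 i).trans (by exact_mod_cast le_max_right _ _)

/-- Uniform bounds on the mollified derivatives. -/
theorem exists_lintegral_conv_lderiv_sq_le (hVW : HessianBounds V W)
    (hV : HasPolyGrowthDerivs (s + 1) V) (hW : HasPolyGrowthDerivs (s + 1) W) (ha : 0 < a) (E : ℝ)
    {τ : ℝ} (T : ℝ) (hτ : 0 < τ) :
    ∃ K : ℝ≥0, ∀ ρ, Admissible V W a E ρ → ∀ t ∈ Icc τ T, ∀ φ, IsMollifier φ →
      ∀ L : List (Fin d), L.length ≤ s →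
        ∫⁻ x, ENNReal.ofReal (conv (lderiv L φ) (ρ t) x ^ 2) ≤ K := by
  obtain ⟨K, hK⟩ := (energyBound_of_le (E := E) hVW hV hW ha le_rfl).exists_bounds le_rfl
    hVW hV hW ha 0 T hτ
  refine ⟨K, fun ρ hρ t ht φ hφ L hL => ?_⟩
  have := (hK ρ hρ φ hφ L hL).1 t ht
  simpa only [weightedSq, pow_zero, one_mul] using this

end Regularity


/-! ### Weak derivatives -/

theorem norm_toLp_sq {v : Space d → ℝ} (hv : MemLp v 2) :
    ‖hv.toLp v‖ ^ 2 = ∫ x, v x ^ 2 := by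
  rw [← real_inner_self_eq_norm_sq, L2.inner_def]
  refine integral_congr_ae ?_
  filter_upwards [hv.coeFn_toLp] with x hx
  rw [hx, real_inner_self_eq_norm_sq, Real.norm_eq_abs, sq_abs]

theorem inner_toLp_right {v : Lp ℝ 2 (volume : Measure (Space d))} {g : Space d → ℝ}
    (hg : MemLp g 2) : inner ℝ v (hg.toLp g) = ∫ x, v x * g x := by
  rw [L2.inner_def]
  refine integral_congr_ae ?_
  filter_upwards [hg.coeFn_toLp] with x hx
  rw [hx, real_inner_eq_re_inner, RCLike.inner_apply]
  simp [mul_comm]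

theorem IsTest.memLp {g : Space d → ℝ} (hg : IsTest g) : MemLp g 2 :=
  hg.continuous.memLp_of_hasCompactSupport hg.2

/-- Weak compactness of bounded sets of `L²`, tested against smooth functions. -/
theorem exists_weak_limit {v : ℕ → Space d → ℝ} {K : ℝ} (hv : ∀ n, MemLp (v n) 2)
    (hK : ∀ n, ∫ x, v n x ^ 2 ≤ K) {l : (Space d → ℝ) → ℝ}
    (hl : ∀ g, IsTest g → Tendsto (fun n => ∫ x, v n x * g x) atTop (𝓝 (l g))) :
    ∃ w : Space d → ℝ, MemLp w 2 ∧ ∫ x, w x ^ 2 ≤ K ∧ ∀ g, IsTest g → ∫ x, w x * g x = l g := by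
  have hK0 : 0 ≤ K := (integral_nonneg fun x => sq_nonneg _).trans (hK 0)
  set D := InnerProductSpace.toDual ℝ (Lp ℝ 2 (volume : Measure (Space d))) with hD
  set Λ : ℕ → WeakDual ℝ (Lp ℝ 2 (volume : Measure (Space d))) := fun n =>
    StrongDual.toWeakDual (D ((hv n).toLp (v n))) with hΛ
  have hmem : ∀ n, Λ n ∈ WeakDual.toStrongDual ⁻¹'
      Metric.closedBall (0 : StrongDual ℝ (Lp ℝ 2 (volume : Measure (Space d)))) (Real.sqrt K) := by
    intro n
    rw [mem_preimage, mem_closedBall_zero_iff]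
    change ‖D ((hv n).toLp (v n))‖ ≤ _
    rw [hD, LinearIsometryEquiv.norm_map]
    exact Real.le_sqrt_of_sq_le (by rw [norm_toLp_sq]; exact hK n)
  -- A weak-* cluster point suffices, without extracting a subsequence: the pairings with test
  -- functions converge, so their cluster values are the prescribed limits.
  obtain ⟨w, hw, hcl⟩ := (WeakDual.isCompact_closedBall (𝕜 := ℝ)
    (0 : StrongDual ℝ (Lp ℝ 2 (volume : Measure (Space d)))) (Real.sqrt K)).exists_mapClusterPt_of_frequently
      (f := Λ) (l := atTop) (Eventually.of_forall hmem).frequently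
  set w' := D.symm (WeakDual.toStrongDual w) with hw'
  have hwn : ‖w'‖ ≤ Real.sqrt K := by
    rw [hw', LinearIsometryEquiv.norm_map]
    simpa using hw
  have hwL : MemLp w' 2 := Lp.memLp w'
  refine ⟨w', hwL, ?_, fun g hg => ?_⟩
  · rw [← norm_toLp_sq hwL, Lp.toLp_coeFn]
    calc ‖w'‖ ^ 2 ≤ Real.sqrt K ^ 2 := by gcongr
      _ = K := Real.sq_sqrt hK0
  · have h1 : MapClusterPt (w (hg.memLp.toLp g)) atTop fun n => Λ n (hg.memLp.toLp g) :=
      hcl.continuousAt_comp (WeakDual.eval_continuous (hg.memLp.toLp g)).continuousAt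
    have h2 : ∀ n, Λ n (hg.memLp.toLp g) = ∫ x, v n x * g x := by
      intro n
      change D ((hv n).toLp (v n)) (hg.memLp.toLp g) = _
      rw [hD, InnerProductSpace.toDual_apply_apply, inner_toLp_right]
      refine integral_congr_ae ?_
      filter_upwards [(hv n).coeFn_toLp] with x hx
      rw [hx]
    have h3 : w (hg.memLp.toLp g) = ∫ x, w' x * g x := by
      rw [← inner_toLp_right hg.memLp, ← InnerProductSpace.toDual_apply_apply, ← hD, hw',
        LinearIsometryEquiv.apply_symm_apply]
      rfl
    simp only [h2] at h1
    rw [← h3]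
    have h4 : (𝓝 (w (hg.memLp.toLp g)) ⊓ 𝓝 (l g)).NeBot :=
      NeBot.mono h1.clusterPt (inf_le_inf_left _ (hl g hg))
    exact eq_of_nhds_neBot h4

/-- Needed because `weakDeriv` picks an arbitrary representative, whose norm must be compared with
that of the one constructed. -/
theorem HasWeakDeriv.ae_eq {α : Fin d → ℕ} {u v w : Space d → ℝ} (hv : HasWeakDeriv α u v)
    (hw : HasWeakDeriv α u w) (hvl : LocallyIntegrable v) (hwl : LocallyIntegrable w) :
    v =ᵐ[volume] w := by
  refine ae_eq_of_integral_contDiff_smul_eq hvl hwl fun g hg hgc => ?_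
  have h := (hv g hg hgc).symm.trans (hw g hg hgc)
  have h0 : ((-1 : ℝ) ^ multiLength α) ≠ 0 := by positivity
  simpa only [smul_eq_mul, mul_comm] using mul_left_cancel₀ h0 h

theorem hasWeakDeriv_zero (u : Space d → ℝ) : HasWeakDeriv 0 u u := by
  intro φ _ _
  have h : multiList (0 : Fin d → ℕ) = [] :=
    List.length_eq_zero_iff.1 (by rw [length_multiList]; simp [multiLength])
  simp [multiDeriv_eq_lderiv, h, multiLength]

theorem integral_sq_le_of_lintegral_le {v : Space d → ℝ} {K : ℝ≥0} (hv : Continuous v)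
    (h : ∫⁻ x, ENNReal.ofReal (v x ^ 2) ≤ K) : MemLp v 2 ∧ ∫ x, v x ^ 2 ≤ K := by
  have hi : Integrable fun x => v x ^ 2 := by
    refine ⟨(hv.pow 2).aestronglyMeasurable, ?_⟩
    rw [hasFiniteIntegral_iff_ofReal (Eventually.of_forall fun x => sq_nonneg _)]
    exact h.trans_lt ENNReal.coe_lt_top
  refine ⟨(memLp_two_iff_integrable_sq hv.aestronglyMeasurable).2 hi, ?_⟩
  rw [← ofReal_integral_eq_lintegral_ofReal hi (Eventually.of_forall fun x => sq_nonneg _),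
    ENNReal.ofReal_le_iff_le_toReal ENNReal.coe_ne_top] at h
  simpa using h

/-- The derivative is a weak `L²` limit of `∂^α (Φ n * u)`. Against a test function, integration by
parts removes the derivative and `Φ n * u → u`; the norm bound survives the weak limit. -/
theorem exists_hasWeakDeriv {u : Space d → ℝ} (hu : Continuous u) {K : ℝ≥0} (α : Fin d → ℕ)
    (h : ∀ φ, IsMollifier φ →
      ∫⁻ x, ENNReal.ofReal (conv (lderiv (multiList α) φ) u x ^ 2) ≤ K) :
    ∃ v, MemLp v 2 ∧ HasWeakDeriv α u v ∧ ∫ x, v x ^ 2 ≤ K := by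
  obtain ⟨Φ, hΦ, hlim⟩ := exists_mollifier_seq d
  have hc : ∀ n, ContDiff ℝ ∞ (conv (Φ n) u) := fun n => (hΦ n).isTest.contDiff_conv hu
  have hb := fun n => integral_sq_le_of_lintegral_le
    (((hΦ n).isTest.lderiv (multiList α)).contDiff_conv hu).continuous (h (Φ n) (hΦ n))
  obtain ⟨v, hv, hvK, hvl⟩ := exists_weak_limit (fun n => (hb n).1) (fun n => (hb n).2)
    (l := fun g => (-1) ^ multiLength α * ∫ x, u x * multiDeriv α g x) fun g hg => by
      have h1 : ∀ n, ∫ x, conv (lderiv (multiList α) (Φ n)) u x * g x =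
          (-1) ^ multiLength α * ∫ x, conv (Φ n) u x * multiDeriv α g x := fun n => by
        rw [← (hΦ n).isTest.lderiv_conv hu, integral_lderiv_mul
          ((hc n).of_le (by exact_mod_cast le_top)) hg.contDiff hg.2, length_multiList,
          multiDeriv_eq_lderiv, lderiv_perm (List.reverse_perm _)
            (hg.contDiff.of_le (by exact_mod_cast le_top))]
      simp only [h1]
      refine Tendsto.const_mul _ ?_
      have h2 : IsTest (multiDeriv α g) := by
        rw [multiDeriv_eq_lderiv]
        exact hg.lderiv _
      -- The pairing with `∂^α g` is the convolution at `0` with the reflected test function, so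
      -- `IsTest.tendsto_conv_mul` applies with `b = 1`.
      have h3 : IsTest fun y => multiDeriv α g (-y) := by simpa using h2.sub_left 0
      have h4 := h3.tendsto_conv_mul hΦ hlim hu (b := fun _ => 1) continuous_const 0
      simpa [conv_apply] using h4
  refine ⟨v, hv, fun g hg hgc => ?_, hvK⟩
  rw [hvl g ⟨hg, hgc⟩, ← mul_assoc, ← mul_pow]
  norm_num

theorem memSobolev_of_conv_le {u : Space d → ℝ} (hu : Continuous u) {K : ℝ≥0} {s : ℕ}
    (h : ∀ φ, IsMollifier φ → ∀ L : List (Fin d), L.length ≤ s →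
      ∫⁻ x, ENNReal.ofReal (conv (lderiv L φ) u x ^ 2) ≤ K) :
    MemSobolev s u ∧ sobolevNorm s u ≤ Real.sqrt ((multiIndices d s).card * K) := by
  have h' : ∀ α : Fin d → ℕ, multiLength α ≤ s →
      ∃ v, MemLp v 2 ∧ HasWeakDeriv α u v ∧ ∫ x, v x ^ 2 ≤ K := fun α hα =>
    exists_hasWeakDeriv hu α fun φ hφ => h φ hφ _ (by rwa [length_multiList])
  have hloc : ∀ {v : Space d → ℝ}, MemLp v 2 → LocallyIntegrable v := fun {v} hv =>
    hv.locallyIntegrable (by norm_num)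
  refine ⟨⟨?_, fun α hα => ?_⟩, Real.sqrt_le_sqrt ?_⟩
  · obtain ⟨v, hv, hw, -⟩ := h' 0 (by simp [multiLength])
    exact (memLp_congr_ae ((hasWeakDeriv_zero u).ae_eq hw hu.locallyIntegrable (hloc hv))).2 hv
  · obtain ⟨v, hv, hw, -⟩ := h' α hα
    exact ⟨v, hv, hw⟩
  · rw [← nsmul_eq_mul]
    refine Finset.sum_le_card_nsmul _ _ _ fun α hα => ?_
    obtain ⟨v, hv, hw, hK⟩ := h' α (mem_multiIndices.1 hα)
    have hex : ∃ v, MemLp v 2 ∧ HasWeakDeriv α u v := ⟨v, hv, hw⟩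
    have h1 : weakDeriv α u = hex.choose := by rw [weakDeriv, dif_pos hex]
    have h2 : weakDeriv α u =ᵐ[volume] v := by
      rw [h1]
      exact hex.choose_spec.2.ae_eq hw (hloc hex.choose_spec.1) (hloc hv)
    refine (integral_congr_ae ?_).trans_le hK
    filter_upwards [h2] with x hx
    rw [hx, sq_abs]

/-! ### A continuous bound -/

theorem exists_sobolevNorm_le {s : ℕ} {V W : Space d → ℝ} (hVW : HessianBounds V W)
    (hV : HasPolyGrowthDerivs (s + 1) V) (hW : HasPolyGrowthDerivs (s + 1) W) {a : ℝ} (ha : 0 < a)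
    (E : ℝ) {τ : ℝ} (T : ℝ) (hτ : 0 < τ) : ∃ K : ℝ, 0 < K ∧ ∀ ρ, Admissible V W a E ρ →
      ∀ t ∈ Icc τ T, MemSobolev s (ρ t) ∧ sobolevNorm s (ρ t) ≤ K := by
  obtain ⟨K, hK⟩ := exists_lintegral_conv_lderiv_sq_le hVW hV hW ha E T hτ
  refine ⟨Real.sqrt ((multiIndices d s).card * K) + 1, by positivity, fun ρ hρ t ht => ?_⟩
  have hK' := hK ρ hρ t ht
  obtain ⟨ρ₀, -, -, -, h⟩ := hρ
  obtain ⟨h1, h2⟩ := memSobolev_of_conv_le (h.isNiceDensity (hτ.trans_le ht.1)).continuous hK'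
  exact ⟨h1, by linarith⟩

/-- The admissible bounds at each time form an upward closed, hence convex, subset of the positive
reals, and near each time a single constant is admissible. A partition of unity combines these
constants continuously. -/
theorem exists_continuousOn_bound {P : ℝ → ℝ → Prop}
    (hP : ∀ t, 0 < t → ∀ x y, P t x → x ≤ y → P t y)
    (h : ∀ τ T, 0 < τ → ∃ K, 0 < K ∧ ∀ t ∈ Icc τ T, P t K) :
    ∃ f : ℝ → ℝ, ContinuousOn f (Ioi 0) ∧ ∀ t, 0 < t → 0 < f t ∧ P t (f t) := by
  obtain ⟨F, hF⟩ := exists_continuous_forall_mem_convex_of_local_const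
    (t := fun t : Ioi (0:ℝ) => {y : ℝ | 0 < y ∧ P t y}) (fun t => by
      refine OrdConnected.convex ⟨fun x hx y hy z hz => ?_⟩
      exact ⟨hx.1.trans_le hz.1, hP t t.2 _ _ hx.2 hz.1⟩) fun t => by
      have ht : (0:ℝ) < t := t.2
      obtain ⟨K, hK0, hK⟩ := h (t / 2) (2 * t) (by positivity)
      refine ⟨K, ?_⟩
      have hn : Icc ((t : ℝ) / 2) (2 * t) ∈ 𝓝 (t : ℝ) := Icc_mem_nhds (by linarith) (by linarith)
      filter_upwards [continuous_subtype_val.continuousAt.preimage_mem_nhds hn] with σ hσ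
      exact ⟨hK0, hK σ hσ⟩
  refine ⟨fun t => if ht : 0 < t then F ⟨t, ht⟩ else 0, ?_, fun t ht => ?_⟩
  · rw [continuousOn_iff_continuous_domRestrict]
    refine F.continuous.congr fun t => ?_
    have ht : (0:ℝ) < t := t.2
    simp [ht]
  · simpa [ht] using hF ⟨t, ht⟩

end McKeanVlasov

end

theorem mainTheorem10 (d s : ℕ) (V W : McKeanVlasov.Space d → ℝ)
    (hVW : McKeanVlasov.HessianBounds V W)
    (hV : McKeanVlasov.HasPolyGrowthDerivs (s + 1) V)
    (hW : McKeanVlasov.HasPolyGrowthDerivs (s + 1) W)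
    (a E : ℝ) (ha : 0 < a) (hE : 0 < E) :
    ∃ f : ℝ → ℝ, ContinuousOn f (Ioi 0) ∧ (∀ t, 0 < t → 0 < f t) ∧
      ∀ ρ₀ : McKeanVlasov.Space d → ℝ, McKeanVlasov.IsProbDensity ρ₀ →
        Integrable (fun x => Real.exp (a * ‖x‖ ^ 2) * ρ₀ x) →
        ∫ x, Real.exp (a * ‖x‖ ^ 2) * ρ₀ x ≤ E →
        ∀ ρ : ℝ → McKeanVlasov.Space d → ℝ, McKeanVlasov.IsClassicalSolution V W ρ₀ ρ →
          ∀ t, 0 < t →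
            McKeanVlasov.MemSobolev s (ρ t) ∧ McKeanVlasov.sobolevNorm s (ρ t) ≤ f t := by
  obtain ⟨f, hf, hfP⟩ := McKeanVlasov.exists_continuousOn_bound
    -- The quantifier over all admissible solutions sits inside `P`, so the function obtained
    -- depends on none of them.
    (P := fun t y => ∀ ρ, McKeanVlasov.Admissible V W a E ρ →
      McKeanVlasov.MemSobolev s (ρ t) ∧ McKeanVlasov.sobolevNorm s (ρ t) ≤ y)
    (fun t _ x y hx hxy ρ hρ => ⟨(hx ρ hρ).1, (hx ρ hρ).2.trans hxy⟩) fun τ T hτ => by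
      obtain ⟨K, hK, h⟩ := McKeanVlasov.exists_sobolevNorm_le hVW hV hW ha E T hτ
      exact ⟨K, hK, fun t ht ρ hρ => h ρ hρ t ht⟩
  exact ⟨f, hf, fun t ht => (hfP t ht).1, fun ρ₀ h₁ h₂ h₃ ρ hρ t ht =>
    (hfP t ht).2 ρ ⟨ρ₀, h₁, h₂, h₃, hρ⟩⟩
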